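/- **Setting.** Let $G$ be a connected reductive complex linear algebraic group and $H\subset G$ a horosymmetric subgroup: $H$ is closed, and there are a parabolic subgroup $P$ of $G$ with unipotent radical $P^u$, a Levi subgroup $L$ of $P$ and an algebraic group involution $\sigma$ of $L$ with $P^u\subset H\subset P$ and $(L^\sigma)^0\subset L\cap H$ of finite index. Let $T\subset L$ be a $\sigma$-stable maximal torus containing a torus $T_s$ of maximal dimension among the tori of $L$ on which $\sigma$ acts as the inverse. Let $\theta$ be a Cartan involution of $G$ stabilizing $L$ and $T$, whose restriction to $L$ commutes with $\sigma$, let $K=G^\theta$ with Lie algebra $\mathfrak k$, and let $\mathfrak a_s=\mathfrak t_s\cap i\mathfrak k$. The induced maps on Lie algebras are again denoted by $\sigma,\theta$. Put $\mathcal H(y)=\frac{y+\sigma(y)}2$ and $\mathcal P(y)=\frac{y-\sigma(y)}2$ for $y\in\mathfrak l$, and $\Re(y)=\frac{y-\theta(y)}2$. Let $\Phi\supset\Phi_L,\Phi_{P^u}$ be the roots of $G$, $L$, $P^u$ with respect to $T$, let $\Phi_{Q^u}=-\Phi_{P^u}$ and $\Phi_s=\{\alpha\in\Phi_L:\sigma(\alpha)\ne\alpha\}$.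 Let $\Phi^+\supset\Phi_{Q^u}$ be a system of positive roots of $\Phi$ such that for $\alpha\in\Phi_L\cap\Phi^+$ either $\sigma(\alpha)=\alpha$ or $-\sigma(\alpha)\in\Phi_L\cap\Phi^+$, and put $\Phi_s^+=\Phi_s\cap\Phi^+$. Choose root vectors $0\neq e_\alpha\in\mathfrak g_\alpha$ with $[\theta(e_\alpha),e_\alpha]=\alpha^\vee$ (the coroot), and a basis $(l_1,\dots,l_r)$ of the real vector space $\mathfrak a_s$. For $\beta\in\Phi_s^+$ put $\tau_\beta=e_\beta-\sigma(e_\beta)$ and $\mu_\beta=e_\beta+\sigma(e_\beta)$. For $a\in\mathfrak a_s$ let $\gamma_\diamondsuit$, $\diamondsuit\in\{1,\dots,r\}\cup\Phi_{Q^u}\cup\Phi_s^+$, be the $(1,0)$-forms at $\exp(a)H\in G/H$ given by the local holomorphic coordinates $\exp(a)\exp\big(\sum_j z_jl_j+\sum_\alpha z_\alpha e_\alpha+\sum_\beta z_\beta\tau_\beta\big)H$, and let $\omega_{\diamondsuit,\bar\heartsuit}=i\gamma_\diamondsuit\wedge\bar\gamma_\heartsuit$. Let $\mathcal L$ be a $G$-linearized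 line bundle on $G/H$ with isotropy character $\chi:H\to\mathbb C^*$ ($h\cdot\xi=\chi(h)\xi$ for $\xi\in\mathcal L_{eH}$); write $\chi$ also for the Lie algebra character of $\mathfrak h$, and for $\chi\circ\mathcal H$ on $\mathfrak l$. Let $q$ be a smooth $K$-invariant hermitian metric on $\mathcal L$ with curvature form $\omega$ (locally $\omega=i\partial\bar\partial\varphi$, $\varphi=-\ln|s|_q^2$, for a local trivialization $s$). Let $0\neq\xi_0\in\mathcal L_{eH}$, and let $u:\mathfrak a_s\to\mathbb R$, $u(x)=-2\ln|\exp(x)\cdot\xi_0|_q$, be the toric potential. For $x\in\mathfrak t\cap i\mathfrak k$ write $d_au(x)=d_au(\mathcal P(x))$. **Theorem A.** Let $a\in\mathfrak a_s$ be such that $\beta(a)\neq0$ for all $\beta\in\Phi_s$. (1) One has $\omega_{\exp(a)H}=\sum_{\diamondsuit,\heartsuit}\Omega_{\diamondsuit,\bar\heartsuit}\,\omega_{\diamondsuit,\bar\heartsuit}$, where, all roots being evaluated at $a$, for $1\le j,j_1,j_2\le r$, for $\alpha,\alpha_1,\alpha_2\in\Phi_{Q^u}$ with $\alpha_2-\alpha_1\in\Phi_s$,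 and for $\beta,\beta_1,\beta_2\in\Phi_s^+$ with $\beta_1\ne\beta_2$, $$\Omega_{j_1,\bar j_2}=\tfrac14d_a^2u(l_{j_1},l_{j_2}),\qquad \Omega_{j,\bar\beta}=\overline{\Omega_{\beta,\bar j}}=\tfrac12\beta(l_j)\,(1-\tanh^2\beta)\,\chi(\theta(\mu_\beta)),$$ $$\Omega_{\alpha,\bar\alpha}=\frac{-e^{2\alpha}}2(d_au-2\chi)(\alpha^\vee),\qquad \Omega_{\alpha_1,\bar\alpha_2}=\frac{2\chi([\theta(e_{\alpha_2}),e_{\alpha_1}])}{e^{-2\alpha_1}+e^{-2\alpha_2}},$$ $$\Omega_{\beta_1,\bar\beta_2}=-\tanh(\beta_2-\beta_1)\Big\{\frac1{\sinh2\beta_1}-\frac1{\sinh2\beta_2}\Big\}\chi([\theta(e_{\beta_2}),e_{\beta_1}])-\tanh(\beta_1+\beta_2)\Big\{\frac1{\sinh2\beta_2}+\frac1{\sinh2\beta_1}\Big\}\chi([\theta(e_{\beta_2}),\sigma(e_{\beta_1})]),$$ $$\Omega_{\beta,\bar\beta}=\frac{d_au(\beta^\vee)}{\sinh2\beta}-\frac2{\cosh2\beta}\,\chi\big(\Re([\theta\sigma(e_\beta),e_\beta])\big),$$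 and all other coefficients are zero. (2) If the restriction of $\mathcal L$ to the symmetric fiber $L/L\cap H$ is a trivial line bundle, then $$\omega_{\exp(a)H}=\sum_{j_1,j_2=1}^r\tfrac14d_a^2u(l_{j_1},l_{j_2})\,\omega_{j_1,\bar j_2}+\sum_{\alpha\in\Phi_{Q^u}}\frac{-e^{2\alpha(a)}}2(d_au-2\chi)(\alpha^\vee)\,\omega_{\alpha,\bar\alpha}+\sum_{\beta\in\Phi_s^+}\frac{d_au(\beta^\vee)}{\sinh(2\beta(a))}\,\omega_{\beta,\bar\beta}.$$ -/

import Mathlib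

open Filter Topology Bundle
open scoped ContDiff

noncomputable section

namespace Horosym

variable {n : ℕ}

/-- Complex `n × n` matrices, the ambient space of all Lie algebras below. -/
abbrev Mat (n : ℕ) : Type := Matrix (Fin n) (Fin n) ℂ

/-- The group `GL_n(ℂ)`; linear algebraic groups are its Zariski closed subgroups. -/
abbrev GLn (n : ℕ) : Type := GL (Fin n) ℂ

/-! ### Linear algebraic groups -/

/-- The coordinates on `GL_n`: the entries of `g` and the entries of `g⁻¹`. They generate the
coordinate ring `ℂ[x_ij, 1 / det]`. -/
def coords (g : GLn n) : (Fin n × Fin n) ⊕ (Fin n × Fin n) → ℂ :=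
  Sum.elim (fun p => (g : Mat n) p.1 p.2) (fun p => ((g⁻¹ : GLn n) : Mat n) p.1 p.2)

/-- `S` is Zariski closed in `GL_n`. -/
def IsAlgebraic (S : Subgroup (GLn n)) : Prop :=
  ∃ I : Set (MvPolynomial ((Fin n × Fin n) ⊕ (Fin n × Fin n)) ℂ),
    ∀ g : GLn n, g ∈ S ↔ ∀ p ∈ I, MvPolynomial.eval (coords g) p = 0

/-- `f` is a regular function on `S`. -/
def IsRegular (S : Subgroup (GLn n)) (f : S → ℂ) : Prop :=
  ∃ p : MvPolynomial ((Fin n × Fin n) ⊕ (Fin n × Fin n)) ℂ,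
    ∀ g : S, f g = MvPolynomial.eval (coords (g : GLn n)) p

/-- Connectedness of an algebraic group: no proper closed subgroup of finite index. -/
def IsConnectedAlg (S : Subgroup (GLn n)) : Prop :=
  ∀ S' : Subgroup (GLn n), S' ≤ S → IsAlgebraic S' → S'.relIndex S ≠ 0 → S' = S

/-- The neutral component of an algebraic group: the intersection of all its closed subgroups
of finite index. -/
def neutralComponent (S : Subgroup (GLn n)) : Subgroup (GLn n) :=
  sInf {S' | S' ≤ S ∧ IsAlgebraic S' ∧ S'.relIndex S ≠ 0}

/-- All elements of `S` are unipotent. -/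
def IsUnipotent (S : Subgroup (GLn n)) : Prop :=
  ∀ g ∈ S, IsNilpotent ((g : Mat n) - 1)

/-- The unipotent radical of `S` is trivial. -/
def IsReductive (S : Subgroup (GLn n)) : Prop :=
  ∀ U : Subgroup (GLn n), U ≤ S → IsAlgebraic U → IsConnectedAlg U → IsUnipotent U →
    (∀ g ∈ S, ∀ u ∈ U, g * u * g⁻¹ ∈ U) → U = ⊥

/-- An algebraic torus: a connected diagonalizable algebraic group. -/
structure IsTorus (T : Subgroup (GLn n)) : Prop where
  isAlgebraic : IsAlgebraic T
  connected : IsConnectedAlg T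
  diagonalizable : ∃ g : GLn n, ∀ t ∈ T, ((g * t * g⁻¹ : GLn n) : Mat n).IsDiag

/-- A one-parameter subgroup `ℂˣ → GL_n` is algebraic if its entries are Laurent polynomials. -/
def IsAlgebraicOneParam (lam : ℂˣ →* GLn n) : Prop :=
  ∀ i j, ∃ (p : Polynomial ℂ) (k : ℕ), ∀ t : ℂˣ,
    (t : ℂ) ^ k * (lam t : Mat n) i j = p.eval (t : ℂ)

/-- The filter `t → 0` on `ℂˣ`. -/
def toZero : Filter ℂˣ := comap (fun t : ℂˣ => (t : ℂ)) (𝓝 0)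

/-- The parabolic subgroup `P(λ)` of `G` given by a one-parameter subgroup `λ`: all `g ∈ G` such
that `λ(t) g λ(t)⁻¹` has a limit as `t → 0`. When `G` is connected reductive, these are exactly
the parabolic subgroups of `G`. -/
def parabolic (G : Subgroup (GLn n)) (lam : ℂˣ →* GLn n) : Subgroup (GLn n) where
  carrier := {g | g ∈ G ∧ ∃ m : GLn n, Tendsto (fun t => lam t * g * (lam t)⁻¹) toZero (𝓝 m)}
  one_mem' := ⟨G.one_mem, 1, by simp [tendsto_const_nhds]⟩
  mul_mem' := by
    rintro g h ⟨hg, m, hm⟩ ⟨hh, m', hm'⟩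
    refine ⟨G.mul_mem hg hh, m * m', (hm.mul hm').congr fun t => ?_⟩
    group
  inv_mem' := by
    rintro g ⟨hg, m, hm⟩
    refine ⟨G.inv_mem hg, m⁻¹, hm.inv.congr fun t => ?_⟩
    group

/-- The unipotent radical `P(λ)ᵘ` of `P(λ)`: all `g ∈ G` such that `λ(t) g λ(t)⁻¹ → 1`. -/
def parabolicRadical (G : Subgroup (GLn n)) (lam : ℂˣ →* GLn n) : Subgroup (GLn n) where
  carrier := {g | g ∈ G ∧ Tendsto (fun t => lam t * g * (lam t)⁻¹) toZero (𝓝 1)}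
  one_mem' := ⟨G.one_mem, by simp [tendsto_const_nhds]⟩
  mul_mem' := by
    rintro g h ⟨hg, hm⟩ ⟨hh, hm'⟩
    refine ⟨G.mul_mem hg hh, ?_⟩
    have := hm.mul hm'
    rw [mul_one] at this
    refine this.congr fun t => ?_
    group
  inv_mem' := by
    rintro g ⟨hg, hm⟩
    refine ⟨G.inv_mem hg, ?_⟩
    have := hm.inv
    rw [inv_one] at this
    refine this.congr fun t => ?_
    group

/-- The Levi subgroup `Z_G(λ)` of `P(λ)`. Every Levi subgroup of a parabolic subgroup `P` of a
connected reductive group is of this form for some `λ` with `P = P(λ)`. -/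
def levi (G : Subgroup (GLn n)) (lam : ℂˣ →* GLn n) : Subgroup (GLn n) :=
  G ⊓ Subgroup.centralizer (Set.range lam)

/-! ### Lie algebras -/

/-- The exponential of a matrix as an element of `GL_n`. -/
def expGL (X : Mat n) : GLn n := (Matrix.isUnit_exp X).unit

/-- The exponential map of `S`, extended by `1` to matrices whose exponential is not in `S`. -/
def expIn (S : Subgroup (GLn n)) (X : Mat n) : S :=
  open Classical in if h : expGL X ∈ S then ⟨expGL X, h⟩ else 1

/-- The Lie algebra of `S`. -/
def lieAlg (S : Subgroup (GLn n)) : Set (Mat n) := {X | ∀ t : ℂ, expGL (t • X) ∈ S}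

/-- The (complex) dimension of an algebraic group. -/
def algDim (S : Subgroup (GLn n)) : ℕ := Module.finrank ℂ (Submodule.span ℂ (lieAlg S))

/-- The differential at the identity of a homomorphism `f : S → S`. -/
def dHom (S : Subgroup (GLn n)) (f : S →* S) (X : Mat n) : Mat n :=
  Matrix.of fun i j => deriv (fun t : ℝ => ((f (expIn S (t • X)) : GLn n) : Mat n) i j) 0

/-- The differential at the identity of a character `χ : S → ℂˣ`. -/
def dChar (S : Subgroup (GLn n)) (χ : S →* ℂˣ) (X : Mat n) : ℂ :=
  deriv (fun t : ℝ => (χ (expIn S (t • X)) : ℂ)) 0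

/-! ### Holomorphic and smooth functions on a closed subgroup of `GL_n`

A function on the submanifold `G` of the space of matrices is holomorphic (smooth) at a point if
near this point it is the restriction of a holomorphic (smooth) function of the matrix entries. -/

/-- The entries of an element of `G`, as a point of a normed space. -/
def entries {G : Subgroup (GLn n)} (g : G) : Fin n → Fin n → ℂ := fun i j => ((g : GLn n) : Mat n) i j

def HolAt {G : Subgroup (GLn n)} (f : G → ℂ) (g : G) : Prop :=
  ∃ F : (Fin n → Fin n → ℂ) → ℂ, AnalyticAt ℂ F (entries g) ∧
    ∀ᶠ x in 𝓝 g, f x = F (entries x)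

def HolAt₂ {G : Subgroup (GLn n)} (f : G × G → ℂ) (g : G × G) : Prop :=
  ∃ F : (Fin n → Fin n → ℂ) × (Fin n → Fin n → ℂ) → ℂ,
    AnalyticAt ℂ F (entries g.1, entries g.2) ∧ ∀ᶠ x in 𝓝 g, f x = F (entries x.1, entries x.2)

def SmoothAt {G : Subgroup (GLn n)} (f : G → ℝ) (g : G) : Prop :=
  ∃ F : (Fin n → Fin n → ℂ) → ℝ, ContDiffAt ℝ ∞ F (entries g) ∧
    ∀ᶠ x in 𝓝 g, f x = F (entries x)

/-! ### Horosymmetric homogeneous spaces -/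

/-- A connected reductive complex linear algebraic group `G` with a horosymmetric subgroup `H`:
a parabolic subgroup `P` and a Levi subgroup `L` of `P` (both given by a one-parameter subgroup
`lam` of `G`), and an algebraic involution `σ` of `L`, such that `Pᵘ ⊆ H ⊆ P` and `(L^σ)⁰` is a
finite index subgroup of `L ∩ H`. -/
structure HorosymmetricSpace (n : ℕ) where
  G : Subgroup (GLn n)
  G_algebraic : IsAlgebraic G
  G_connected : IsConnectedAlg G
  G_reductive : IsReductive G
  lam : ℂˣ →* GLn n
  lam_algebraic : IsAlgebraicOneParam lam
  lam_mem : ∀ t, lam t ∈ G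
  σ : levi G lam →* levi G lam
  σ_involutive : ∀ l, σ (σ l) = l
  σ_algebraic : ∀ i j, IsRegular (levi G lam) fun l => ((σ l : GLn n) : Mat n) i j
  H : Subgroup (GLn n)
  H_algebraic : IsAlgebraic H
  radical_le_H : parabolicRadical G lam ≤ H
  H_le_parabolic : H ≤ parabolic G lam
  fixed_le_H : neutralComponent ((σ.eqLocus (MonoidHom.id _)).map (levi G lam).subtype)
    ≤ levi G lam ⊓ H
  fixed_finiteIndex :
    (neutralComponent ((σ.eqLocus (MonoidHom.id _)).map (levi G lam).subtype)).relIndex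
      (levi G lam ⊓ H) ≠ 0

namespace HorosymmetricSpace

variable (D : HorosymmetricSpace n)

/-- The Levi subgroup `L`. -/
abbrev L : Subgroup (GLn n) := levi D.G D.lam

/-- The unipotent radical of `P`. -/
abbrev Pu : Subgroup (GLn n) := parabolicRadical D.G D.lam

theorem L_le_G : D.L ≤ D.G := inf_le_left

/-- The homogeneous space `G / H`, with the quotient topology and the left action of `G`. -/
abbrev Space : Type := D.G ⧸ (D.H.subgroupOf D.G)

/-- The quotient map `π : G → G / H`. -/
def proj (g : D.G) : D.Space := QuotientGroup.mk g

/-- The involution of the Lie algebra of `L` induced by `σ`. -/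
def dσ (X : Mat n) : Mat n := dHom D.L D.σ X

/-- `𝓗(y) = (y + σ(y)) / 2`. -/
def projH (y : Mat n) : Mat n := (2⁻¹ : ℂ) • (y + D.dσ y)

/-- `𝓟(y) = (y - σ(y)) / 2`. -/
def projP (y : Mat n) : Mat n := (2⁻¹ : ℂ) • (y - D.dσ y)

/-- A split torus in `L`. -/
def IsSplitTorus (T : Subgroup (GLn n)) : Prop :=
  IsTorus T ∧ T ≤ D.L ∧ ∀ l : D.L, (l : GLn n) ∈ T → D.σ l = l⁻¹

end HorosymmetricSpace

/-- A maximally split torus `T` of `L`, its maximal split subtorus `Ts`, and a Cartan involution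
`θ` of `G` (an antiholomorphic involution with compact fixed point group) which stabilizes `L` and
`T`, and whose restriction to `L` commutes with `σ`. -/
structure CartanData (D : HorosymmetricSpace n) where
  T : Subgroup (GLn n)
  T_torus : IsTorus T
  T_le_L : T ≤ D.L
  T_maximal : ∀ T' : Subgroup (GLn n), IsTorus T' → T' ≤ D.L → T ≤ T' → T' = T
  T_stable : ∀ l : D.L, (l : GLn n) ∈ T → (D.σ l : GLn n) ∈ T
  Ts : Subgroup (GLn n)
  Ts_le_T : Ts ≤ T
  Ts_split : D.IsSplitTorus Ts
  Ts_maximal : ∀ S : Subgroup (GLn n), D.IsSplitTorus S → algDim S ≤ algDim Ts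
  θ : D.G →* D.G
  θ_involutive : ∀ g, θ (θ g) = g
  θ_antiholomorphic : ∀ i j, ∀ g : D.G,
    HolAt (fun x : D.G => (starRingEnd ℂ) (((θ x : GLn n) : Mat n) i j)) g
  θ_compact : IsCompact {g : D.G | θ g = g}
  θ_L : ∀ g : D.G, (g : GLn n) ∈ D.L → (θ g : GLn n) ∈ D.L
  θ_T : ∀ g : D.G, (g : GLn n) ∈ T → (θ g : GLn n) ∈ T
  θ_comm : ∀ l l' : D.L, (l' : GLn n) = θ (Subgroup.inclusion D.L_le_G l) →
    (D.σ l' : GLn n) = θ (Subgroup.inclusion D.L_le_G (D.σ l))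

namespace CartanData

variable {D : HorosymmetricSpace n} (C : CartanData D)

/-- The maximal compact subgroup `K = G^θ`. -/
def K : Subgroup D.G := C.θ.eqLocus (MonoidHom.id _)

/-- The involution of the Lie algebra of `G` induced by `θ`. -/
def dθ (X : Mat n) : Mat n := dHom D.G C.θ X

/-- `ℜ(y) = (y - θ(y)) / 2`. -/
def reK (y : Mat n) : Mat n := (2⁻¹ : ℂ) • (y - C.dθ y)

/-- The Lie algebra of `K`. -/
def lieK : Set (Mat n) := {X | X ∈ lieAlg D.G ∧ ∀ t : ℝ, expIn D.G (t • X) ∈ C.K}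

/-- `𝔞_s = 𝔱_s ∩ i𝔨`. -/
def aS : Set (Mat n) := {X | X ∈ lieAlg C.Ts ∧ ∃ Y ∈ C.lieK, X = Complex.I • Y}

/-- Homomorphisms `T → ℂˣ`, a group written multiplicatively: the sum of two characters is their
product, the opposite of a character is its inverse. -/
abbrev Chars : Type := C.T →* ℂˣ

/-- The root space of a character of `T`. -/
def rootSpace (α : C.Chars) : Set (Mat n) :=
  {X | X ∈ lieAlg D.G ∧
    ∀ t : C.T, ((t : GLn n) : Mat n) * X * (((t : GLn n)⁻¹ : GLn n) : Mat n) = (α t : ℂ) • X}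

/-- The roots `Φ` of `(G, T)`. -/
def roots : Set C.Chars := {α | α ≠ 1 ∧ ∃ X ∈ C.rootSpace α, X ≠ 0}

/-- The roots `Φ_L` of `L`. -/
def rootsL : Set C.Chars := {α | α ∈ C.roots ∧ C.rootSpace α ⊆ lieAlg D.L}

/-- The roots `Φ_{Pᵘ}` of `Pᵘ`. -/
def rootsPu : Set C.Chars := {α | α ∈ C.roots ∧ C.rootSpace α ⊆ lieAlg D.Pu}

/-- `Φ_{Qᵘ} = -Φ_{Pᵘ}`. -/
def rootsQu : Set C.Chars := {α | α⁻¹ ∈ C.rootsPu}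

/-- The restriction of `σ` to `T`. -/
def σT : C.T →* C.T where
  toFun t := ⟨D.σ (Subgroup.inclusion C.T_le_L t), C.T_stable _ t.2⟩
  map_one' := by ext1; simp
  map_mul' _ _ := by ext1; simp

/-- `σ(α) = α ∘ σ`. -/
def σChar (α : C.Chars) : C.Chars := α.comp C.σT

/-- `Φ_s`, the roots of `L` that are not fixed by `σ`. -/
def rootsS : Set C.Chars := {α | α ∈ C.rootsL ∧ C.σChar α ≠ α}

/-- The value `α(x)` of a character at an element `x` of the Lie algebra of `T`. -/
def ev (α : C.Chars) (x : Mat n) : ℂ := dChar C.T α x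

/-- `c` is the coroot of the root `α`: the element of `[𝔤_α, 𝔤_{-α}]` with `α(c) = 2`. -/
def IsCoroot (α : C.Chars) (c : Mat n) : Prop :=
  (∃ x ∈ C.rootSpace α, ∃ y ∈ C.rootSpace α⁻¹, c = ⁅x, y⁆) ∧ C.ev α c = 2

end CartanData

/-- The choices that define the reference forms: a system `pos` of positive roots of `G` (the
roots of a Borel subgroup `B` with `T ⊆ B ⊆ Q`, where `Q` is opposite to `P`) such that for
`α ∈ Φ_L⁺` either `σ(α) = α` or `-σ(α) ∈ Φ_L⁺`; root vectors `e_α` with `[θ(e_α), e_α] = α^∨`;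
and a basis `l₁, …, l_r` of the real vector space `𝔞_s`. -/
structure ReferenceData {D : HorosymmetricSpace n} (C : CartanData D) where
  pos : Set C.Chars
  pos_subset : pos ⊆ C.roots
  pos_or : ∀ α ∈ C.roots, α ∈ pos ∨ α⁻¹ ∈ pos
  pos_not : ∀ α ∈ pos, α⁻¹ ∉ pos
  pos_add : ∀ α ∈ pos, ∀ β ∈ pos, α * β ∈ C.roots → α * β ∈ pos
  rootsQu_subset : C.rootsQu ⊆ pos
  pos_adapted : ∀ α ∈ pos ∩ C.rootsL, C.σChar α = α ∨ (C.σChar α)⁻¹ ∈ pos ∩ C.rootsL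
  coroot : C.Chars → Mat n
  coroot_spec : ∀ α ∈ C.roots, C.IsCoroot α (coroot α)
  e : C.Chars → Mat n
  e_mem : ∀ α ∈ C.roots, e α ∈ C.rootSpace α
  e_ne_zero : ∀ α ∈ C.roots, e α ≠ 0
  e_bracket : ∀ α ∈ C.roots, ⁅C.dθ (e α), e α⁆ = coroot α
  r : ℕ
  l : Fin r → Mat n
  l_independent : LinearIndependent ℝ l
  l_span : (Submodule.span ℝ (Set.range l) : Set (Mat n)) = C.aS

theorem CartanData.T_comm {D : HorosymmetricSpace n} (C : CartanData D) (s t : C.T) :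
    (s : GLn n) * t = t * s := by
  obtain ⟨g, hg⟩ := C.T_torus.diagonalizable
  have h1 := hg s s.2
  have h2 := hg t t.2
  have key : (g * (s : GLn n) * g⁻¹) * (g * t * g⁻¹) = (g * t * g⁻¹) * (g * (s : GLn n) * g⁻¹) := by
    apply Units.ext
    rw [Units.val_mul (g * (s : GLn n) * g⁻¹), Units.val_mul (g * (t : GLn n) * g⁻¹),
      ← (Matrix.isDiag_iff_diagonal_diag _).1 h1,
      ← (Matrix.isDiag_iff_diagonal_diag _).1 h2, Matrix.diagonal_mul_diagonal, Matrix.diagonal_mul_diagonal]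
    simp only [mul_comm]
  have e1 : (g * (s : GLn n) * g⁻¹) * (g * t * g⁻¹) = g * (s * t) * g⁻¹ := by group
  have e2 : (g * t * g⁻¹) * (g * (s : GLn n) * g⁻¹) = g * (t * s) * g⁻¹ := by group
  rw [e1, e2] at key
  exact mul_left_cancel (mul_right_cancel key)

theorem CartanData.finite_roots {D : HorosymmetricSpace n} (C : CartanData D) :
    C.roots.Finite := by
  let f : C.T → Module.End ℂ (Mat n) := fun t =>
    LinearMap.mulLeftRight ℂ (((t : GLn n) : Mat n), (((t : GLn n)⁻¹ : GLn n) : Mat n))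
  have hcomm : ∀ s t, Commute (f s) (f t) := by
    intro s t
    refine LinearMap.ext fun X => ?_
    have h1 : ((s : GLn n) : Mat n) * ((t : GLn n) : Mat n) = (t : GLn n) * (s : GLn n) := by
      rw [← Units.val_mul, C.T_comm, Units.val_mul]
    have h2 : (((t : GLn n)⁻¹ : GLn n) : Mat n) * (((s : GLn n)⁻¹ : GLn n) : Mat n) =
        (((s : GLn n)⁻¹ : GLn n) : Mat n) * (((t : GLn n)⁻¹ : GLn n) : Mat n) := by
      rw [← Units.val_mul, ← Units.val_mul, ← mul_inv_rev, C.T_comm, mul_inv_rev]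
    simp only [f, Module.End.mul_apply, LinearMap.mulLeftRight_apply]
    calc _ = (((s : GLn n) : Mat n) * ((t : GLn n) : Mat n)) * X *
          ((((t : GLn n)⁻¹ : GLn n) : Mat n) * (((s : GLn n)⁻¹ : GLn n) : Mat n)) := by
            simp only [mul_assoc]
      _ = _ := by rw [h1, h2]; simp only [mul_assoc]
  have hind := Module.End.independent_iInf_maxGenEigenspace_of_forall_mapsTo f
    (fun i j φ => Module.End.mapsTo_maxGenEigenspace_of_comm (hcomm j i) φ)
  have hfin := WellFoundedGT.finite_ne_bot_of_iSupIndep hind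
  refine Set.Finite.of_finite_image (f := fun (α : C.Chars) (t : C.T) => (α t : ℂ))
    (hfin.subset ?_) ?_
  · rintro _ ⟨α, ⟨-, X, hX, hX0⟩, rfl⟩ hbot
    refine hX0 ((Submodule.mem_bot ℂ).1 (hbot ▸ (Submodule.mem_iInf _).2 fun t => ?_))
    refine (Module.End.mem_maxGenEigenspace _ _ _).2 ⟨1, ?_⟩
    have := hX.2 t
    simp only [pow_one, LinearMap.sub_apply, f, LinearMap.mulLeftRight_apply,
      LinearMap.smul_apply, Module.End.one_apply, this, sub_self]
  · intro α _ β _ h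
    ext t
    exact congrFun h t

namespace ReferenceData

variable {D : HorosymmetricSpace n} {C : CartanData D} (R : ReferenceData C)

/-- `Φ_s⁺`. -/
def rootsSPos : Set C.Chars := R.pos ∩ C.rootsS

/-- The index set `{1, …, r} ∪ Φ_{Qᵘ} ∪ Φ_s⁺`. -/
abbrev Idx : Type := Fin R.r ⊕ (C.rootsQu ⊕ R.rootsSPos)

instance : Fintype C.rootsQu :=
  ((C.finite_roots.preimage inv_injective.injOn).subset fun _ h => h.1).fintype

instance : Fintype R.rootsSPos :=
  (C.finite_roots.subset fun _ h => R.pos_subset h.1).fintype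

/-- `τ_β = e_β - σ(e_β)`. -/
def tau (β : C.Chars) : Mat n := R.e β - D.dσ (R.e β)

/-- `μ_β = e_β + σ(e_β)`. -/
def mu (β : C.Chars) : Mat n := R.e β + D.dσ (R.e β)

/-- The family `(l_j), (e_α), (τ_β)`, a basis of a complement of `𝔥` in `𝔤`. -/
def basisVec : R.Idx → Mat n
  | .inl j => R.l j
  | .inr (.inl α) => R.e α
  | .inr (.inr β) => R.tau β

/-- The local holomorphic coordinates
`z ↦ g exp(∑ z_j l_j + ∑ z_α e_α + ∑ z_β τ_β) H` on `G / H` near `gH`. -/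
def coordMap (g : D.G) (z : R.Idx → ℂ) : D.Space :=
  D.proj (g * expIn D.G (∑ i, z i • R.basisVec i))

end ReferenceData

/-! ### `(1,1)`-forms in holomorphic coordinates -/

/-- The form `i dz_j ∧ dz̄_k` on `ℂ^I`. -/
def refForm {I : Type} (j k : I) (v w : I → ℂ) : ℂ :=
  Complex.I * (v j * (starRingEnd ℂ) (w k) - w j * (starRingEnd ℂ) (v k))

/-- The second real directional derivative at `0`. -/
def secondDeriv {I : Type} [Fintype I] (F : (I → ℂ) → ℝ) (v w : I → ℂ) : ℝ :=
  iteratedFDeriv ℝ 2 F 0 ![v, w]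

open Classical in
/-- `∂²F / ∂z_j ∂z̄_k` at `0`, where `∂/∂z = (∂/∂x - i ∂/∂y) / 2`, `∂/∂z̄ = (∂/∂x + i ∂/∂y) / 2`. -/
def wirtinger {I : Type} [Fintype I] (F : (I → ℂ) → ℝ) (j k : I) : ℂ :=
  (1 / 4 : ℂ) *
    ((secondDeriv F (Pi.single j 1) (Pi.single k 1) : ℂ)
      + (secondDeriv F (Pi.single j Complex.I) (Pi.single k Complex.I) : ℂ)
      + Complex.I * ((secondDeriv F (Pi.single j 1) (Pi.single k Complex.I) : ℂ)
        - (secondDeriv F (Pi.single j Complex.I) (Pi.single k 1) : ℂ)))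

/-- The value at `0` of the form `i ∂∂̄F = ∑ ∂²F / ∂z_j ∂z̄_k  i dz_j ∧ dz̄_k`. -/
def iddbar {I : Type} [Fintype I] (F : (I → ℂ) → ℝ) (v w : I → ℂ) : ℂ :=
  ∑ j, ∑ k, wirtinger F j k * refForm j k v w

/-! ### Linearized line bundles and invariant metrics -/

section Bundle

variable (D : HorosymmetricSpace n) (E : D.Space → Type*)
  [∀ x, AddCommGroup (E x)] [∀ x, Module ℂ (E x)] [∀ x, TopologicalSpace (E x)]
  [TopologicalSpace (TotalSpace ℂ E)] [FiberBundle ℂ E]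

/-- The local section of the line bundle given by a local trivialization. -/
def frame {D : HorosymmetricSpace n} {E : D.Space → Type*}
    [∀ x, AddCommGroup (E x)] [∀ x, Module ℂ (E x)] [TopologicalSpace (TotalSpace ℂ E)]
    (t : Trivialization ℂ (π ℂ E)) (x : D.Space) : TotalSpace ℂ E := ⟨x, t.symm x 1⟩

/-- The line bundle `E` on `G / H` is a holomorphic line bundle, and the action of `G` on its total
space is a linearization: it lifts the action on `G / H`, is linear on fibers and holomorphic.
(A function on `G / H` is holomorphic if its pullback to `G` is.) -/
structure IsLinearizedLineBundle [VectorBundle ℂ ℂ E] [MulAction D.G (TotalSpace ℂ E)] :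
    Prop where
  holomorphic : ∀ (t t' : Trivialization ℂ (π ℂ E)) [MemTrivializationAtlas t]
    [MemTrivializationAtlas t'] (g : D.G), D.proj g ∈ t.baseSet → D.proj g ∈ t'.baseSet →
    HolAt (fun x => (t' (frame t (D.proj x))).2) g
  action_linear : ∀ (g : D.G) (x : D.Space), ∃ A : E x →ₗ[ℂ] E (g • x), ∀ ξ : E x,
    g • (⟨x, ξ⟩ : TotalSpace ℂ E) = ⟨g • x, A ξ⟩
  action_holomorphic : ∀ (t t' : Trivialization ℂ (π ℂ E)) [MemTrivializationAtlas t]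
    [MemTrivializationAtlas t'] (g g' : D.G), D.proj g' ∈ t.baseSet →
    D.proj (g * g') ∈ t'.baseSet →
    HolAt₂ (fun x => (t' (x.1 • frame t (D.proj x.2))).2) (g, g')

/-- `χ` is the isotropy character of `E`: an algebraic character of `H` such that
`h • ξ = χ(h) ξ` for `ξ` in the fiber at `eH`. -/
structure IsIsotropyCharacter [MulAction D.G (TotalSpace ℂ E)] (χ : D.H →* ℂˣ) : Prop where
  algebraic : IsRegular D.H fun h => (χ h : ℂ)
  smul_eq : ∀ (h : D.H) (g : D.G), (g : GLn n) = h → ∀ ξ : E (D.proj 1),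
    g • (⟨D.proj 1, ξ⟩ : TotalSpace ℂ E) = ⟨D.proj 1, (χ h : ℂ) • ξ⟩

/-- `q` is (the norm of) a smooth `K`-invariant hermitian metric on `E`. -/
structure IsInvariantMetric [MulAction D.G (TotalSpace ℂ E)] (C : CartanData D)
    (q : TotalSpace ℂ E → ℝ) : Prop where
  norm_smul : ∀ (x : D.Space) (c : ℂ) (ξ : E x),
    q ⟨x, c • ξ⟩ = ‖c‖ * q ⟨x, ξ⟩
  pos : ∀ (x : D.Space) (ξ : E x), ξ ≠ 0 → 0 < q ⟨x, ξ⟩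
  smooth : ∀ (t : Trivialization ℂ (π ℂ E)) [MemTrivializationAtlas t] (g : D.G),
    D.proj g ∈ t.baseSet → SmoothAt (fun x => q (frame t (D.proj x))) g
  invariant : ∀ k ∈ C.K, ∀ v : TotalSpace ℂ E, q (k • v) = q v

/-- The restriction of `E` to the symmetric fiber `L / L ∩ H` is a trivial line bundle: it has a
nowhere vanishing regular section `lH ↦ f(l) (l • ξ₀)`. -/
def IsTrivialOnFiber [MulAction D.G (TotalSpace ℂ E)] (ξ₀ : E (D.proj 1)) : Prop :=
  ∃ (s : ∀ x, E x) (f : D.L → ℂ), IsRegular D.L f ∧ (∀ l, f l ≠ 0) ∧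
    ∀ (l : D.L) (ξ : E (D.proj (Subgroup.inclusion D.L_le_G l))),
      Subgroup.inclusion D.L_le_G l • (⟨D.proj 1, ξ₀⟩ : TotalSpace ℂ E) = ⟨_, ξ⟩ →
      s _ = f l • ξ

variable {D E}

/-- The quasipotential `φ(g) = -2 ln |s(g)|`, where `s(g) = g • ξ₀` is the equivariant
trivialization of the pullback of `E` to `G` with `s(e) = ξ₀`. -/
def quasipotential [MulAction D.G (TotalSpace ℂ E)] (q : TotalSpace ℂ E → ℝ)
    (ξ₀ : E (D.proj 1)) (g : D.G) : ℝ :=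
  -2 * Real.log (q (g • (⟨D.proj 1, ξ₀⟩ : TotalSpace ℂ E)))

/-- The toric potential `u(x) = φ(exp x)`, to be considered for `x ∈ 𝔞_s`. -/
def toricPotential [MulAction D.G (TotalSpace ℂ E)] (q : TotalSpace ℂ E → ℝ)
    (ξ₀ : E (D.proj 1)) (x : Mat n) : ℝ :=
  quasipotential q ξ₀ (expIn D.G x)

/-- The curvature form `ω = i ∂∂̄ φ`, `φ = -ln |s|²`, of the metric `q` at `gH`, computed with the
local section `s` of the trivialization `t` and in the local coordinates `R.coordMap g`. -/
def curvatureForm {C : CartanData D} (R : ReferenceData C) (q : TotalSpace ℂ E → ℝ)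
    (t : Trivialization ℂ (π ℂ E)) (g : D.G) (v w : R.Idx → ℂ) : ℂ :=
  iddbar (fun z => -Real.log (q (frame t (R.coordMap g z)) ^ 2)) v w

end Bundle

/-! ### The coefficients of the curvature form -/

/-- The differential `d_a u (x)` of a function on a real vector space of matrices. -/
def diff1 (u : Mat n → ℝ) (a x : Mat n) : ℝ := deriv (fun t : ℝ => u (a + t • x)) 0

/-- The second differential `d²_a u (x, y)`. -/
def diff2 (u : Mat n → ℝ) (a x y : Mat n) : ℝ :=
  deriv (fun s : ℝ => deriv (fun t : ℝ => u (a + s • x + t • y)) 0) 0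

section Coefficients

variable {D : HorosymmetricSpace n} {C : CartanData D} (R : ReferenceData C)
  (u : Mat n → ℝ) (χ : D.H →* ℂˣ) (a : Mat n)

/-- The Lie algebra character of `H` given by `χ`, extended to the Lie algebra of `L`
as `χ ∘ 𝓗`. -/
def chiL (x : Mat n) : ℂ := dChar D.H χ (D.projH x)

/-- `d_a u ∘ 𝓟`. -/
def duP (x : Mat n) : ℝ := diff1 u a (D.projP x)

/-- `Ω_{j₁, j₂}`. -/
def omegaJJ (j k : Fin R.r) : ℂ := (1 / 4 : ℂ) * (diff2 u a (R.l j) (R.l k) : ℂ)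

/-- `Ω_{j, β}`. -/
def omegaJB (j : Fin R.r) (β : C.Chars) : ℂ :=
  (1 / 2 : ℂ) * C.ev β (R.l j) * (1 - Complex.tanh (C.ev β a) ^ 2) * chiL χ (C.dθ (R.mu β))

open Classical in
/-- `Ω_{α₁, α₂}`. -/
def omegaAA (α₁ α₂ : C.Chars) : ℂ :=
  if α₁ = α₂ then
    -Complex.exp (2 * C.ev α₁ a) / 2 *
      ((duP (D := D) u a (R.coroot α₁) : ℂ) - 2 * chiL χ (R.coroot α₁))
  else if α₂ * α₁⁻¹ ∈ C.rootsS then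
    2 * chiL χ ⁅C.dθ (R.e α₂), R.e α₁⁆ /
      (Complex.exp (-2 * C.ev α₁ a) + Complex.exp (-2 * C.ev α₂ a))
  else 0

open Classical in
/-- `Ω_{β₁, β₂}`. -/
def omegaBB (β₁ β₂ : C.Chars) : ℂ :=
  if β₁ = β₂ then
    (duP (D := D) u a (R.coroot β₁) : ℂ) / Complex.sinh (2 * C.ev β₁ a)
      - 2 / Complex.cosh (2 * C.ev β₁ a)
        * chiL χ (C.reK ⁅C.dθ (D.dσ (R.e β₁)), R.e β₁⁆)
  else
    -Complex.tanh (C.ev β₂ a - C.ev β₁ a)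
        * (1 / Complex.sinh (2 * C.ev β₁ a) - 1 / Complex.sinh (2 * C.ev β₂ a))
        * chiL χ ⁅C.dθ (R.e β₂), R.e β₁⁆
      - Complex.tanh (C.ev β₁ a + C.ev β₂ a)
        * (1 / Complex.sinh (2 * C.ev β₂ a) + 1 / Complex.sinh (2 * C.ev β₁ a))
        * chiL χ ⁅C.dθ (R.e β₂), D.dσ (R.e β₁)⁆

/-- The matrix `Ω` of the coefficients of the curvature form at `exp(a)H`. -/
def omega : R.Idx → R.Idx → ℂ
  | .inl j, .inl k => omegaJJ R u a j k
  | .inl j, .inr (.inr β) => omegaJB R χ a j β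
  | .inr (.inr β), .inl j => (starRingEnd ℂ) (omegaJB R χ a j β)
  | .inr (.inl α₁), .inr (.inl α₂) => omegaAA R u χ a α₁ α₂
  | .inr (.inr β₁), .inr (.inr β₂) => omegaBB R u χ a β₁ β₂
  | .inl _, .inr (.inl _) => 0
  | .inr (.inl _), .inl _ => 0
  | .inr (.inl _), .inr (.inr _) => 0
  | .inr (.inr _), .inr (.inl _) => 0

end Coefficients

end Horosym

end

noncomputable section

namespace Horosym

variable {n : ℕ}

open NormedSpace

/-! ### One-parameter groups in Banach algebras -/

section Banach

variable {A : Type*} [NormedRing A] [NormedAlgebra ℝ A] [CompleteSpace A]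

/-! The whole statement is read off the second-order jet at exp(a) of the quasipotential φ(g) = -2
ln|g·ξ₀|. In a local frame s, φ differs from -ln|s|² by the logarithm of the modulus of a
nonvanishing holomorphic function. This is pluriharmonic (`wirtinger_log_norm`), so ω is i∂∂̄ of φ
in the exponential coordinates (`wirtinger_frame`). Moreover φ is left K-invariant, and right
multiplication by h in H subtracts 2 ln|χ(h)|.

Let lin be the first derivative of φ along one-parameter groups, and B(X, Y) the mixed derivative of
φ(exp(a) exp(sX) exp(tY)) at s = t = 0; B is symmetric up to lin[X, Y]. Split B and lin by complex
type: S is linear in X and antilinear in Y, N is antilinear in both variables, and Lam is the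
antilinear part of lin. The commutator terms cancel in S, which is therefore hermitian, and S gives
the coefficients of ω (`IsJet.wirtinger_eq`).

The two symmetries are then played against each other. Equivariance under H gives S(h, Y) = 0 and
N(h, Y) = Lam[h, Y] for h in 𝔥. If ad a acts on W by c and on θ(W) by -c, then W + θ(W) lies in 𝔨,
and since θ is antilinear, K-invariance gives N(θ(W), Y) = -e^(-2c) S(W, Y). For W = e_α with α in
Φ_{Qᵘ} one has θ(W) in 𝔥, and for τ_β both μ_β and θ(μ_β) lie in 𝔥; so S(e_α, Y) and S(τ_β, Y)
become explicit multiples of Lam of a bracket (`JetData.S_of_θ_mem`, `JetData.S_sub_of_add_mem`).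

It remains to know Lam. On coroots it is given by du and χ (`JetData.Lam_coroot`). On a vector of
nonzero ad a-weight in 𝔩, the values of Lam on the σ-fixed vectors W + σ(W) and θ(W + σ(W)) give two
linear equations for Lam(W) and Lam(σ(W)) (`JetData.Lam_weight`). On all root vectors outside Φ_s it
vanishes (`JetData.Lam_root_eq_zero`), because an algebraic character is trivial on unipotent
one-parameter groups.

The structural input is that σ is the identity on the root spaces of σ-fixed roots of L
(`ReferenceData.dσ_eq_self`) and that 𝓟 of a coroot lies in 𝔞_s
(`ReferenceData.projP_coroot_mem_aS`). Both use the maximality of T_s, together with the fact that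
elements of i𝔨 are diagonalizable because K is compact.

For the second part, a trivialization over the fiber yields a nowhere vanishing regular function on
L that cancels χ on L ∩ H. It is constant along unipotent one-parameter groups, so χ∘𝓗 kills every
root vector of 𝔩 (`IsTrivialOnFiber.chiL_eq_zero`) and only the diagonal root terms and the toric
block survive. -/

theorem hasDerivAt_exp_smul_zero (X : A) : HasDerivAt (fun s : ℝ => exp (s • X)) X 0 := by
  have := hasDerivAt_exp_smul_const (𝕂 := ℝ) X 0
  simpa using this

theorem exp_smul_neg_mul_exp (X : A) (t : ℝ) : exp (t • -X) * exp (t • X) = 1 := by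
  let _ : NormedAlgebra ℚ A := NormedAlgebra.restrictScalars ℚ ℝ A
  rw [smul_neg, ← exp_add_of_commute (Commute.neg_left (Commute.refl (t • X)))]
  simp

theorem hasDerivAt_conj_exp_aux (X Y : A) :
    HasDerivAt (fun s : ℝ => exp (s • X) * Y * exp (-(s • X))) (X * Y - Y * X) 0 := by
  have h2 : HasDerivAt (fun s : ℝ => exp (-(s • X))) (-X) 0 := by
    simpa using hasDerivAt_exp_smul_zero (-X)
  have := ((hasDerivAt_exp_smul_zero X).mul_const Y).mul h2
  refine this.congr_deriv ?_
  simp [sub_eq_add_neg]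

/-- The product f(t) exp(-tY) has zero derivative. This is how homomorphisms and characters are
recognised as exponentials of their differentials. -/
theorem eq_exp_of_hasDerivAt_aux {f : ℝ → A} {Y : A} (h0 : f 0 = 1)
    (hadd : ∀ s t, f (s + t) = f s * f t) (hd : HasDerivAt f Y 0) (t : ℝ) :
    f t = exp (t • Y) := by
  have hf : ∀ s, HasDerivAt f (f s * Y) s := by
    intro s
    have h1 : HasDerivAt (fun r => f (r - s)) Y s := by
      have : HasDerivAt f Y (s - s) := by simpa using hd
      simpa using this.comp_sub_const s s
    have h2 := h1.const_mul (f s)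
    refine h2.congr_of_eventuallyEq (Eventually.of_forall fun r => ?_)
    simp [← hadd]
  have hg : ∀ s, HasDerivAt (fun r : ℝ => f r * exp (r • (-Y))) 0 s := by
    intro s
    refine ((hf s).mul (hasDerivAt_exp_smul_const' (𝕂 := ℝ) (-Y) s)).congr_deriv ?_
    simp [mul_assoc]
  have hc : f t * exp (t • (-Y)) = f 0 * exp ((0 : ℝ) • (-Y)) :=
    is_const_of_deriv_eq_zero (fun s => (hg s).differentiableAt) (fun s => (hg s).deriv) t 0
  rw [h0, zero_smul, exp_zero, one_mul] at hc
  calc f t = f t * (exp (t • -Y) * exp (t • Y)) := by rw [exp_smul_neg_mul_exp, mul_one]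
    _ = _ := by rw [← mul_assoc, hc, one_mul]

theorem norm_pow_sub_pow_le {A : Type*} [NormedRing A] (h1 : ‖(1 : A)‖ ≤ 1) {x y : A} {M : ℝ}
    (hM : 1 ≤ M) (hx : ‖x‖ ≤ M) (hy : ‖y‖ ≤ M) (k : ℕ) : ‖x ^ k - y ^ k‖ ≤ k * ‖x - y‖ * M ^ k := by
  have hpow : ∀ k : ℕ, ‖y ^ k‖ ≤ M ^ k := by
    intro k
    induction k with
    | zero => simpa using h1
    | succ k ih =>
      rw [pow_succ, pow_succ]
      exact (norm_mul_le _ _).trans (mul_le_mul ih hy (norm_nonneg _) (by positivity))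
  induction k with
  | zero => simp
  | succ k ih =>
    have e : x ^ (k + 1) - y ^ (k + 1) = x * (x ^ k - y ^ k) + (x - y) * y ^ k := by
      rw [pow_succ', pow_succ']; noncomm_ring
    rw [e]
    have h2 : ‖x * (x ^ k - y ^ k)‖ ≤ M * (k * ‖x - y‖ * M ^ k) :=
      (norm_mul_le _ _).trans (mul_le_mul hx ih (norm_nonneg _) (by linarith))
    have h3 : ‖(x - y) * y ^ k‖ ≤ ‖x - y‖ * M ^ k :=
      (norm_mul_le _ _).trans (mul_le_mul_of_nonneg_left (hpow k) (norm_nonneg _))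
    have h4 : ‖x - y‖ * M ^ k ≤ ‖x - y‖ * M ^ k * M :=
      le_mul_of_one_le_right (by positivity) hM
    calc _ ≤ M * (k * ‖x - y‖ * M ^ k) + ‖x - y‖ * M ^ k * M :=
          (norm_add_le _ _).trans (add_le_add h2 (h3.trans h4))
      _ = _ := by push_cast; ring

/-- If `f(0) = 1` and `f` has the derivative `Z` at `0`, then `f(1/m)^m → exp Z`. -/
theorem tendsto_pow_of_hasDerivAt_aux (h1 : ‖(1 : A)‖ ≤ 1) {f : ℝ → A} {Z : A} (h0 : f 0 = 1)
    (hd : HasDerivAt f Z 0) :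
    Tendsto (fun m : ℕ => f ((m : ℝ)⁻¹) ^ m) atTop (𝓝 (exp Z)) := by
  let _ : NormedAlgebra ℚ A := NormedAlgebra.restrictScalars ℚ ℝ A
  have hinv : Tendsto (fun m : ℕ => ((m : ℝ)⁻¹)) atTop (𝓝 0) := tendsto_inv_atTop_nhds_zero_nat
  have hb : ∀ {g : ℝ → A}, g 0 = 1 → HasDerivAt g Z 0 →
      ∀ᶠ m : ℕ in atTop, ‖g ((m : ℝ)⁻¹)‖ ≤ 1 + (‖Z‖ + 1) * (m : ℝ)⁻¹ := by
    intro g g0 hg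
    filter_upwards [hinv.eventually (hg.isLittleO.def (c := 1) one_pos)] with m hm
    have h3 : ‖(m : ℝ)⁻¹‖ = (m : ℝ)⁻¹ := Real.norm_of_nonneg (by positivity)
    simp only [sub_zero, g0, one_mul, h3] at hm
    have e : g ((m : ℝ)⁻¹) = (g ((m : ℝ)⁻¹) - 1 - (m : ℝ)⁻¹ • Z) + 1 + (m : ℝ)⁻¹ • Z := by abel
    rw [e]
    refine (norm_add₃_le).trans ?_
    rw [norm_smul, h3]
    linarith
  have hexp0 : HasDerivAt (fun t : ℝ => exp (t • Z)) Z 0 := hasDerivAt_exp_smul_zero Z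
  have hA := hb h0 hd
  have hB := hb (g := fun t : ℝ => exp (t • Z)) (by simp) hexp0
  -- Both factors have norm at most 1 + (‖Z‖ + 1)/m, so powers of them up to the m-th are bounded by
  -- E uniformly in m. The tolerance ε/(2E) is chosen to make the telescoping estimate come out as
  -- ε/2.
  set E := Real.exp (‖Z‖ + 1) with hE
  have hEpos : 0 < E := Real.exp_pos _
  rw [tendsto_iff_norm_sub_tendsto_zero, Metric.tendsto_nhds]
  intro ε hε
  have hlo := (hd.sub hexp0).isLittleO.def (c := ε / (2 * E)) (by positivity)
  filter_upwards [hinv.eventually hlo, hA, hB, eventually_gt_atTop 0] with m hm hAm hBm hpos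
  have hmR : (0 : ℝ) < m := by exact_mod_cast hpos
  have h3 : ‖(m : ℝ)⁻¹‖ = (m : ℝ)⁻¹ := Real.norm_of_nonneg (by positivity)
  simp only [Pi.sub_apply, h0, zero_smul, exp_zero, sub_self, sub_zero, smul_zero, h3] at hm
  have hM1 : (1 : ℝ) ≤ 1 + (‖Z‖ + 1) * (m : ℝ)⁻¹ := by
    have : 0 ≤ (‖Z‖ + 1) * (m : ℝ)⁻¹ := by positivity
    linarith
  have hpow := norm_pow_sub_pow_le h1 hM1 hAm hBm m
  have hexp : exp ((m : ℝ)⁻¹ • Z) ^ m = exp Z := by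
    rw [← exp_nsmul, ← Nat.cast_smul_eq_nsmul ℝ, smul_smul, mul_inv_cancel₀ hmR.ne', one_smul]
  have hME : (1 + (‖Z‖ + 1) * (m : ℝ)⁻¹) ^ m ≤ E := by
    calc (1 + (‖Z‖ + 1) * (m : ℝ)⁻¹) ^ m ≤ Real.exp ((‖Z‖ + 1) * (m : ℝ)⁻¹) ^ m := by
          gcongr
          rw [add_comm]; exact Real.add_one_le_exp _
      _ = E := by
          rw [← Real.exp_nat_mul, hE]; congr 1; field_simp
  rw [hexp] at hpow
  rw [Real.dist_eq, sub_zero, abs_of_nonneg (norm_nonneg _)]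
  calc _ ≤ _ := hpow
    _ ≤ m * (ε / (2 * E) * (m : ℝ)⁻¹) * E := by gcongr
    _ = ε / 2 := by field_simp
    _ < ε := by linarith

theorem hasDerivAt_exp_mul_exp (X Y : A) :
    HasDerivAt (fun s : ℝ => exp (s • X) * exp (s • Y)) (X + Y) 0 := by
  refine ((hasDerivAt_exp_smul_zero X).mul (hasDerivAt_exp_smul_zero Y)).congr_deriv ?_
  simp

/-- A one-parameter group that is bounded on the real line has no Jordan blocks. -/
theorem sub_mul_eq_zero_of_bounded {C : ℝ} (μ : ℂ) {E : Type*} [NormedAddCommGroup E]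
    [NormedSpace ℂ E] {v w : E} (hv : ∀ t : ℝ, ‖Complex.exp (t * μ) • (v + (t : ℂ) • w)‖ ≤ C)
    (hw : ∀ t : ℝ, ‖Complex.exp (t * μ) • w‖ ≤ C) : w = 0 := by
  by_contra h
  have hw0 : 0 < ‖w‖ := norm_pos_iff.2 h
  have hC : 0 < C := by
    have := hw 0
    simp at this
    linarith
  -- At the time with t·Re μ = C/‖w‖, the inequality exp x ≥ x + 1 already beats the bound C. Once
  -- Re μ = 0, the linear growth of v + t w contradicts the bound in the same way.
  have hre : μ.re = 0 := by
    by_contra hμ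
    have := hw ((C / ‖w‖) / μ.re)
    rw [norm_smul, Complex.norm_exp] at this
    simp only [Complex.mul_re, Complex.ofReal_re, Complex.ofReal_im, zero_mul, sub_zero] at this
    rw [div_mul_cancel₀ _ hμ] at this
    have h2 := Real.add_one_le_exp (C / ‖w‖)
    have h3 : (C / ‖w‖ + 1) * ‖w‖ ≤ C := (mul_le_mul_of_nonneg_right h2 hw0.le).trans this
    rw [add_mul, div_mul_cancel₀ _ hw0.ne'] at h3
    linarith
  have h2 := hv ((C + ‖v‖ + 1) / ‖w‖)
  rw [norm_smul, Complex.norm_exp] at h2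
  simp only [Complex.mul_re, Complex.ofReal_re, Complex.ofReal_im, zero_mul, sub_zero, hre,
    mul_zero, Real.exp_zero, one_mul] at h2
  have h3 : ‖(((C + ‖v‖ + 1) / ‖w‖ : ℝ) : ℂ) • w‖ = C + ‖v‖ + 1 := by
    rw [norm_smul, Complex.norm_real, Real.norm_of_nonneg (by positivity),
      div_mul_cancel₀ _ hw0.ne']
  have h4 := norm_sub_le (v + (((C + ‖v‖ + 1) / ‖w‖ : ℝ) : ℂ) • w) v
  rw [add_sub_cancel_left, h3] at h4
  linarith

end Banach

/-! ### The matrix exponential -/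

@[simp] theorem expGL_val (X : Mat n) : (expGL X : Mat n) = exp X := rfl

@[simp] theorem expGL_zero : expGL (0 : Mat n) = 1 := Units.ext (by simp)

theorem expGL_add {X Y : Mat n} (h : Commute X Y) : expGL (X + Y) = expGL X * expGL Y :=
  Units.ext (by simpa using Matrix.exp_add_of_commute X Y h)

theorem expGL_neg (X : Mat n) : expGL (-X) = (expGL X)⁻¹ := by
  rw [eq_inv_iff_mul_eq_one, ← expGL_add (Commute.neg_left (Commute.refl X)), neg_add_cancel,
    expGL_zero]

theorem expGL_inv_val (X : Mat n) : (((expGL X)⁻¹ : GLn n) : Mat n) = exp (-X) := by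
  rw [← expGL_neg, expGL_val]

theorem expGL_nsmul (k : ℕ) (X : Mat n) : expGL (k • X) = expGL X ^ k :=
  Units.ext (by simpa using Matrix.exp_nsmul k X)

theorem expGL_conj (g : GLn n) (X : Mat n) :
    expGL ((g : Mat n) * X * ((g⁻¹ : GLn n) : Mat n)) = g * expGL X * g⁻¹ :=
  Units.ext (by simpa using Matrix.exp_units_conj g X)

open scoped Matrix.Norms.Operator in
theorem continuous_exp_mat : Continuous (exp : Mat n → Mat n) := exp_continuous

theorem continuous_expGL : Continuous (expGL : Mat n → GLn n) := by
  rw [Units.continuous_iff]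
  refine ⟨continuous_exp_mat, ?_⟩
  simp only [expGL_inv_val]
  exact continuous_exp_mat.comp continuous_neg

open scoped Matrix.Norms.Operator in
theorem hasDerivAt_exp (X : Mat n) : HasDerivAt (fun s : ℝ => exp (s • X)) X 0 :=
  hasDerivAt_exp_smul_zero X

open scoped Matrix.Norms.Operator in
theorem hasDerivAt_conj_exp (X Y : Mat n) :
    HasDerivAt (fun s : ℝ => exp (s • X) * Y * exp (-(s • X))) ⁅X, Y⁆ 0 :=
  hasDerivAt_conj_exp_aux X Y

open scoped Matrix.Norms.Operator in
theorem eq_exp_of_hasDerivAt {f : ℝ → Mat n} {Y : Mat n} (h0 : f 0 = 1)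
    (hadd : ∀ s t, f (s + t) = f s * f t) (hd : HasDerivAt f Y 0) (t : ℝ) :
    f t = exp (t • Y) :=
  eq_exp_of_hasDerivAt_aux h0 hadd hd t

open scoped Matrix.Norms.Operator in
theorem norm_one_le : ‖(1 : Mat n)‖ ≤ 1 := by
  rcases isEmpty_or_nonempty (Fin n) with h | h
  · rw [Subsingleton.elim (1 : Mat n) 0, norm_zero]; exact zero_le_one
  · exact norm_one.le

open scoped Matrix.Norms.Operator in
/-- The Lie product formula. -/
theorem tendsto_exp_mul_exp_pow (X Y : Mat n) :
    Tendsto (fun m : ℕ => (exp ((m : ℝ)⁻¹ • X) * exp ((m : ℝ)⁻¹ • Y)) ^ m) atTop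
      (𝓝 (exp (X + Y))) :=
  tendsto_pow_of_hasDerivAt_aux norm_one_le (by simp) (hasDerivAt_exp_mul_exp X Y)

open scoped Matrix.Norms.Operator in
theorem hasDerivAt_mat_unique {f : ℝ → Mat n} {X Y : Mat n} {t : ℝ} (h1 : HasDerivAt f X t)
    (h2 : HasDerivAt f Y t) : X = Y :=
  HasDerivAt.unique h1 h2

theorem exp_smul_injective {X Y : Mat n} (h : ∀ t : ℝ, exp (t • X) = exp (t • Y)) : X = Y := by
  have h1 := hasDerivAt_exp X
  rw [funext h] at h1
  exact hasDerivAt_mat_unique h1 (hasDerivAt_exp Y)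

-- A finite-dimensional subspace is closed and contains all difference quotients of the curve.
open scoped Matrix.Norms.Operator in
theorem hasDerivAt_mem {V : Submodule ℝ (Mat n)} {f : ℝ → Mat n} {X : Mat n}
    (h : HasDerivAt f X 0) (hf : ∀ t, f t ∈ V) : X ∈ V := by
  have hc : IsClosed (V : Set (Mat n)) := Submodule.closed_of_finiteDimensional V
  refine hc.mem_of_tendsto (b := 𝓝[≠] (0 : ℝ)) (hasDerivAt_iff_tendsto_slope.1 h)
    (Eventually.of_forall fun t => ?_)
  rw [slope_def_module]
  exact V.smul_mem _ (V.sub_mem (hf t) (hf 0))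

theorem hasDerivAt_mat_iff {f : ℝ → Mat n} {X : Mat n} {t : ℝ} :
    HasDerivAt f X t ↔ ∀ i j, HasDerivAt (fun s => f s i j) (X i j) t := by
  have h1 : HasDerivAt f X t ↔
      HasDerivAt (F := Fin n → Fin n → ℂ) (f := fun s i j => f s i j) (fun i j => X i j) t :=
  Iff.rfl
  rw [h1, hasDerivAt_pi]
  exact forall_congr' fun i => hasDerivAt_pi

open scoped Matrix.Norms.Operator in
theorem hasDerivAt_linear (D : Mat n →ₗ[ℝ] Mat n) {f : ℝ → Mat n} {X : Mat n} {t : ℝ}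
    (h : HasDerivAt f X t) : HasDerivAt (fun s => D (f s)) (D X) t :=
  (LinearMap.toContinuousLinearMap D).hasFDerivAt.comp_hasDerivAt t h

/-! ### Regular functions and closed subgroups -/

/-- `f` is a regular function on `GL_n`. -/
def RegFun (f : GLn n → ℂ) : Prop :=
  ∃ p : MvPolynomial ((Fin n × Fin n) ⊕ (Fin n × Fin n)) ℂ,
    ∀ g : GLn n, f g = MvPolynomial.eval (coords g) p

namespace RegFun

theorem const (c : ℂ) : RegFun (fun _ : GLn n => c) := ⟨MvPolynomial.C c, by simp⟩

theorem entry (i j : Fin n) : RegFun (fun g : GLn n => (g : Mat n) i j) :=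
  ⟨MvPolynomial.X (.inl (i, j)), by simp [coords]⟩

theorem inv_entry (i j : Fin n) : RegFun (fun g : GLn n => ((g⁻¹ : GLn n) : Mat n) i j) :=
  ⟨MvPolynomial.X (.inr (i, j)), by simp [coords]⟩

theorem eval (p : MvPolynomial ((Fin n × Fin n) ⊕ (Fin n × Fin n)) ℂ) :
    RegFun (fun g : GLn n => MvPolynomial.eval (coords g) p) := ⟨p, fun _ => rfl⟩

theorem mul {f₁ f₂ : GLn n → ℂ} (h₁ : RegFun f₁) (h₂ : RegFun f₂) :
    RegFun (fun g => f₁ g * f₂ g) := by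
  obtain ⟨p, hp⟩ := h₁
  obtain ⟨q, hq⟩ := h₂
  exact ⟨p * q, fun g => by simp [hp, hq]⟩

theorem sub {f₁ f₂ : GLn n → ℂ} (h₁ : RegFun f₁) (h₂ : RegFun f₂) :
    RegFun (fun g => f₁ g - f₂ g) := by
  obtain ⟨p, hp⟩ := h₁
  obtain ⟨q, hq⟩ := h₂
  exact ⟨p - q, fun g => by simp [hp, hq]⟩

theorem sum {ι : Type*} {s : Finset ι} {f : ι → GLn n → ℂ} (h : ∀ i, RegFun (f i)) :
    RegFun (fun g => ∑ i ∈ s, f i g) := by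
  choose p hp using h
  exact ⟨∑ i ∈ s, p i, fun g => by simp [hp]⟩

theorem mul_entry {f₁ f₂ : GLn n → Mat n} (h₁ : ∀ i j, RegFun fun g => f₁ g i j)
    (h₂ : ∀ i j, RegFun fun g => f₂ g i j) (i j : Fin n) : RegFun fun g => (f₁ g * f₂ g) i j := by
  simp only [Matrix.mul_apply]
  exact sum fun k => (h₁ i k).mul (h₂ k j)

end RegFun

theorem IsAlgebraic.of_regFun {S : Subgroup (GLn n)} {ι : Type*} {f : ι → GLn n → ℂ}
    (hf : ∀ i, RegFun (f i)) (h : ∀ g, g ∈ S ↔ ∀ i, f i g = 0) : IsAlgebraic S := by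
  choose p hp using hf
  refine ⟨Set.range p, fun g => ?_⟩
  rw [h]
  simp [hp]

theorem IsAlgebraic.sInf {F : Set (Subgroup (GLn n))} (h : ∀ S ∈ F, IsAlgebraic S) :
    IsAlgebraic (sInf F) := by
  choose! I hI using h
  refine ⟨⋃ S ∈ F, I S, fun g => ?_⟩
  simp only [Subgroup.mem_sInf, Set.mem_iUnion, exists_prop]
  constructor
  · rintro h p ⟨S, hS, hp⟩
    exact (hI S hS g).1 (h S hS) p hp
  · intro h S hS
    exact (hI S hS g).2 fun p hp => h p ⟨S, hS, hp⟩

theorem IsAlgebraic.inf {S S' : Subgroup (GLn n)} (h : IsAlgebraic S) (h' : IsAlgebraic S') :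
    IsAlgebraic (S ⊓ S') := by
  rw [← sInf_pair]
  refine IsAlgebraic.sInf ?_
  rintro _ (rfl | rfl)
  exacts [h, h']

theorem isAlgebraic_centralizer (s : Set (GLn n)) : IsAlgebraic (Subgroup.centralizer s) := by
  refine IsAlgebraic.of_regFun
    (f := fun (x : s × Fin n × Fin n) (g : GLn n) =>
      (((x.1 : GLn n) : Mat n) * (g : Mat n)) x.2.1 x.2.2
        - ((g : Mat n) * ((x.1 : GLn n) : Mat n)) x.2.1 x.2.2) (fun x => ?_) fun g => ?_
  · exact (RegFun.mul_entry (f₁ := fun _ => ((x.1 : GLn n) : Mat n)) (f₂ := fun g => (g : Mat n))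
      (fun i j => .const _) RegFun.entry _ _).sub
      (RegFun.mul_entry (f₁ := fun g => (g : Mat n)) (f₂ := fun _ => ((x.1 : GLn n) : Mat n))
        RegFun.entry (fun i j => .const _) _ _)
  · rw [Subgroup.mem_centralizer_iff]
    constructor
    · rintro h ⟨⟨x, hx⟩, i, j⟩
      rw [← Units.val_mul, ← Units.val_mul, h x hx, sub_self]
    · intro h x hx
      refine Units.ext (Matrix.ext fun i j => ?_)
      exact sub_eq_zero.1 (h (⟨x, hx⟩, i, j))

theorem isAlgebraic_levi {G : Subgroup (GLn n)} (hG : IsAlgebraic G) (lam : ℂˣ →* GLn n) :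
    IsAlgebraic (levi G lam) := hG.inf (isAlgebraic_centralizer _)

theorem continuous_coords : Continuous (coords : GLn n → _) := by
  refine continuous_pi fun x => ?_
  rcases x with ⟨i, j⟩ | ⟨i, j⟩
  · have : Continuous fun g : GLn n => (g : Mat n) := Units.continuous_val
    exact this.matrix_elem i j
  · have : Continuous fun g : GLn n => ((g⁻¹ : GLn n) : Mat n) :=
      Units.continuous_val.comp continuous_inv
    exact this.matrix_elem i j

theorem IsAlgebraic.isClosed {S : Subgroup (GLn n)} (h : IsAlgebraic S) :
    IsClosed (S : Set (GLn n)) := by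
  obtain ⟨I, hI⟩ := h
  have : (S : Set (GLn n)) = ⋂ p ∈ I, {g | MvPolynomial.eval (coords g) p = 0} := by
    ext g
    simp [hI]
  rw [this]
  refine isClosed_biInter fun p _ => isClosed_eq ?_ continuous_const
  exact (MvPolynomial.continuous_eval p).comp continuous_coords

/-! ### The neutral component -/

/-- The ideal of polynomials vanishing on a subgroup. -/
def vanIdeal (S : Subgroup (GLn n)) :
    Ideal (MvPolynomial ((Fin n × Fin n) ⊕ (Fin n × Fin n)) ℂ) where
  carrier := {p | ∀ g ∈ S, MvPolynomial.eval (coords g) p = 0}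
  add_mem' hp hq g hg := by simp [hp g hg, hq g hg]
  zero_mem' g _ := by simp
  smul_mem' c p hp g hg := by simp [hp g hg]

theorem IsAlgebraic.le_of_vanIdeal_le {S S' : Subgroup (GLn n)} (h : IsAlgebraic S)
    (hle : vanIdeal S ≤ vanIdeal S') : S' ≤ S := by
  obtain ⟨I, hI⟩ := h
  intro g hg
  exact (hI g).2 fun p hp => hle (x := p) (fun g' hg' => (hI g').1 hg' p hp) g hg

theorem neutralComponent_le (S : Subgroup (GLn n)) (hS : IsAlgebraic S) : neutralComponent S ≤ S :=
  sInf_le ⟨le_rfl, hS, by simp⟩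

theorem neutralComponent_isAlgebraic (S : Subgroup (GLn n)) : IsAlgebraic (neutralComponent S) :=
  IsAlgebraic.sInf fun _ h => h.2.1

/-- Hilbert's basis theorem gives a closed subgroup of finite index with maximal vanishing ideal.
Intersecting it with any other one does not make it smaller, so it is the neutral component itself.
-/
theorem neutralComponent_relIndex {S : Subgroup (GLn n)} (hS : IsAlgebraic S) :
    (neutralComponent S).relIndex S ≠ 0 := by
  let F : Set (Subgroup (GLn n)) := {S' | S' ≤ S ∧ IsAlgebraic S' ∧ S'.relIndex S ≠ 0}
  obtain ⟨I, ⟨S₀, hS₀, rfl⟩, hmax⟩ :=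
    (set_has_maximal_iff_noetherian (R := MvPolynomial ((Fin n × Fin n) ⊕ (Fin n × Fin n)) ℂ)).2
    inferInstance (vanIdeal '' F) ⟨_, S, ⟨le_rfl, hS, by simp⟩, rfl⟩
  have : neutralComponent S = S₀ := by
    refine le_antisymm (sInf_le hS₀) (le_sInf fun S' hS' => ?_)
    have hmem : S₀ ⊓ S' ∈ F :=
      ⟨inf_le_left.trans hS₀.1, hS₀.2.1.inf hS'.2.1, Subgroup.relIndex_inf_ne_zero hS₀.2.2 hS'.2.2⟩
    have hle : vanIdeal S₀ ≤ vanIdeal (S₀ ⊓ S') := fun p hp g hg => hp g hg.1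
    have := hmax _ ⟨_, hmem, rfl⟩
    have heq : vanIdeal (S₀ ⊓ S') ≤ vanIdeal S₀ := by
      by_contra hne
      exact this (lt_of_le_not_ge hle hne)
    exact (hmem.2.1.le_of_vanIdeal_le heq).trans inf_le_right
  rw [this]
  exact hS₀.2.2

theorem neutralComponent_isConnected {S : Subgroup (GLn n)} (hS : IsAlgebraic S) :
    IsConnectedAlg (neutralComponent S) := by
  intro S' hle halg hidx
  refine le_antisymm hle (sInf_le ⟨hle.trans (neutralComponent_le S hS), halg, ?_⟩)
  exact Subgroup.relIndex_ne_zero_trans hidx (neutralComponent_relIndex hS)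

theorem relIndex_ne_zero_of_le_right {H K L : Subgroup (GLn n)} (h : H.relIndex L ≠ 0)
    (hKL : K ≤ L) : H.relIndex K ≠ 0 :=
  mt (Subgroup.relIndex_eq_zero_of_le_right hKL) h

theorem IsConnectedAlg.le_of_relIndex {M S : Subgroup (GLn n)} (hM : IsConnectedAlg M)
    (hMa : IsAlgebraic M) (hS : IsAlgebraic S) (h : S.relIndex M ≠ 0) : M ≤ S := by
  have := hM (S ⊓ M) inf_le_right (hS.inf hMa) (by rwa [Subgroup.inf_relIndex_right])
  exact inf_eq_right.1 this

theorem IsConnectedAlg.le_neutralComponent {M S : Subgroup (GLn n)} (hM : IsConnectedAlg M)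
    (hMa : IsAlgebraic M) (h : M ≤ S) : M ≤ neutralComponent S :=
  le_sInf fun _ hS => hM.le_of_relIndex hMa hS.2.1 (relIndex_ne_zero_of_le_right hS.2.2 h)

/-! ### Lie algebras -/

theorem expGL_mem {S : Subgroup (GLn n)} {X : Mat n} (h : X ∈ lieAlg S) : expGL X ∈ S := by
  simpa using h 1

theorem expGL_real_mem {S : Subgroup (GLn n)} {X : Mat n} (h : X ∈ lieAlg S) (t : ℝ) :
    expGL (t • X) ∈ S := by
  simpa using h t

theorem expIn_val {S : Subgroup (GLn n)} {X : Mat n} (h : X ∈ lieAlg S) :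
    (expIn S X : GLn n) = expGL X := by
  rw [expIn, dif_pos (expGL_mem h)]

theorem lieAlg_mono {S S' : Subgroup (GLn n)} (h : S ≤ S') : lieAlg S ⊆ lieAlg S' :=
  fun _ hX t => h (hX t)

theorem lieAlg_smul {S : Subgroup (GLn n)} {X : Mat n} (h : X ∈ lieAlg S) (c : ℂ) :
    c • X ∈ lieAlg S := fun t => by
  rw [smul_smul]; exact h _

theorem lieAlg_real_smul {S : Subgroup (GLn n)} {X : Mat n} (h : X ∈ lieAlg S) (c : ℝ) :
    c • X ∈ lieAlg S := by
  simpa using lieAlg_smul h (c : ℂ)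

theorem lieAlg_neg {S : Subgroup (GLn n)} {X : Mat n} (h : X ∈ lieAlg S) : -X ∈ lieAlg S := by
  simpa using lieAlg_smul h (-1)

theorem lieAlg_conj {S : Subgroup (GLn n)} {X : Mat n} (h : X ∈ lieAlg S) {g : GLn n}
    (hg : g ∈ S) : (g : Mat n) * X * ((g⁻¹ : GLn n) : Mat n) ∈ lieAlg S := fun t => by
  have : t • ((g : Mat n) * X * ((g⁻¹ : GLn n) : Mat n))
      = (g : Mat n) * (t • X) * ((g⁻¹ : GLn n) : Mat n) := by simp
  rw [this, expGL_conj]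
  exact S.mul_mem (S.mul_mem hg (h t)) (S.inv_mem hg)

theorem lieAlg_relIndex {S S' : Subgroup (GLn n)} (h : S'.relIndex S ≠ 0) :
    lieAlg S ⊆ lieAlg S' := by
  intro X hX t
  -- The factorial is divisible by every positive k up to the index, which forces m-th powers of
  -- elements of S into S'. Then exp(tX) = exp(tX/m)^m finishes.
  set m := (S'.relIndex S).factorial with hm
  have hm0 : (m : ℂ) ≠ 0 := by exact_mod_cast Nat.factorial_ne_zero _
  have e : t • X = m • ((t / m) • X) := by
    rw [← Nat.cast_smul_eq_nsmul ℂ, smul_smul, mul_div_cancel₀ _ hm0]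
  rw [e, expGL_nsmul]
  exact (Subgroup.pow_mem_of_relIndex_ne_zero_of_dvd h (hX _)
    (fun k hk hk' => Nat.dvd_factorial hk hk')).1

theorem lieAlg_neutralComponent (S : Subgroup (GLn n)) : lieAlg S ⊆ lieAlg (neutralComponent S) :=
  fun _ hX t => Subgroup.mem_sInf.2 fun _ h' => lieAlg_relIndex h'.2.2 hX t

open scoped Matrix.Norms.Operator in
theorem tendsto_GL_iff {ι : Type*} {l : Filter ι} {f : ι → GLn n} {g : GLn n} :
    Tendsto f l (𝓝 g) ↔ Tendsto (fun i => (f i : Mat n)) l (𝓝 (g : Mat n)) :=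
  (Units.isOpenEmbedding_val (R := Mat n)).toIsEmbedding.tendsto_nhds_iff

/-- The Lie product formula writes exp(t(X + Y)) as a limit of elements of S, and algebraic
subgroups are closed in the usual topology. -/
theorem lieAlg_add {S : Subgroup (GLn n)} (hS : IsAlgebraic S) {X Y : Mat n} (hX : X ∈ lieAlg S)
    (hY : Y ∈ lieAlg S) : X + Y ∈ lieAlg S := by
  intro t
  have h : Tendsto (fun m : ℕ => (expGL ((m : ℝ)⁻¹ • t • X) * expGL ((m : ℝ)⁻¹ • t • Y)) ^ m) atTop
      (𝓝 (expGL (t • (X + Y)))) := by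
    rw [tendsto_GL_iff, smul_add]
    simpa using tendsto_exp_mul_exp_pow (t • X) (t • Y)
  refine hS.isClosed.mem_of_tendsto h (Eventually.of_forall fun m => ?_)
  exact S.pow_mem (S.mul_mem (expGL_real_mem (lieAlg_smul hX t) _)
    (expGL_real_mem (lieAlg_smul hY t) _)) _

theorem lieAlg_zero (S : Subgroup (GLn n)) : 0 ∈ lieAlg S := fun t => by simp [S.one_mem]

/-- The Lie algebra of a closed subgroup, as a subspace. -/
def lieSub {S : Subgroup (GLn n)} (hS : IsAlgebraic S) : Submodule ℂ (Mat n) where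
  carrier := lieAlg S
  add_mem' := lieAlg_add hS
  zero_mem' := lieAlg_zero S
  smul_mem' c _ h := lieAlg_smul h c

theorem lieAlg_sub {S : Subgroup (GLn n)} (hS : IsAlgebraic S) {X Y : Mat n} (hX : X ∈ lieAlg S)
    (hY : Y ∈ lieAlg S) : X - Y ∈ lieAlg S := (lieSub hS).sub_mem hX hY

/-- The bracket is the velocity of the curve Ad(exp(sX))Y, which stays in the Lie algebra. -/
theorem lieAlg_lie {S : Subgroup (GLn n)} (hS : IsAlgebraic S) {X Y : Mat n} (hX : X ∈ lieAlg S)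
    (hY : Y ∈ lieAlg S) : ⁅X, Y⁆ ∈ lieAlg S := by
  refine hasDerivAt_mem (V := (lieSub hS).restrictScalars ℝ) (hasDerivAt_conj_exp X Y) fun t => ?_
  have := lieAlg_conj hY (expGL_real_mem hX t)
  rwa [expGL_inv_val, expGL_val] at this

theorem commute_exp_iff {X M : Mat n} : (∀ t : ℂ, Commute M (exp (t • X))) ↔ Commute M X := by
  constructor
  · intro h
    have h0 := hasDerivAt_exp X
    have h1 := hasDerivAt_linear (LinearMap.mulLeft ℝ M) h0
    have h2 := hasDerivAt_linear (LinearMap.mulRight ℝ M) h0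
    have e : (fun s : ℝ => LinearMap.mulLeft ℝ M (exp (s • X)))
        = fun s : ℝ => LinearMap.mulRight ℝ M (exp (s • X)) := by
      funext s
      have := h s
      simpa using this.eq
    rw [e] at h1
    exact hasDerivAt_mat_unique h1 h2
  · intro h t
    exact (h.smul_right t).exp_right

theorem mem_lieAlg_levi {G : Subgroup (GLn n)} {lam : ℂˣ →* GLn n} {X : Mat n} :
    X ∈ lieAlg (levi G lam) ↔ X ∈ lieAlg G ∧ ∀ s, Commute (lam s : Mat n) X := by
  constructor
  · intro h
    refine ⟨lieAlg_mono inf_le_left h, fun s => commute_exp_iff.1 fun t => ?_⟩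
    have := Subgroup.mem_centralizer_iff.1 (h t).2 (lam s) ⟨s, rfl⟩
    exact congrArg Units.val this
  · rintro ⟨h, hc⟩ t
    refine ⟨h t, Subgroup.mem_centralizer_iff.2 ?_⟩
    rintro _ ⟨s, rfl⟩
    exact Units.ext (by simpa using (commute_exp_iff.2 (hc s) t).eq)

/-! ### Diagonalizable matrices -/

/-- The matrix `M` has no Jordan blocks of size two. -/
def IsSemisimpleMat (M : Mat n) : Prop :=
  ∀ (μ : ℂ) (V : Mat n), (M - μ • 1) * ((M - μ • 1) * V) = 0 → (M - μ • 1) * V = 0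

/-- On generalized eigenvectors of height two the exponential series of Y - μ stops after the linear
term. The proof multiplies the right-hand side by exp(-sY) and checks that the derivative is zero.
-/
theorem exp_mul_of_sq_mul_eq_zero {A : Type*} [NormedRing A] [NormedAlgebra ℂ A] [CompleteSpace A]
    {Y V : A} {μ : ℂ} (h : (Y - μ • 1) * ((Y - μ • 1) * V) = 0) (t : ℝ) :
    exp ((t : ℂ) • Y) * V = Complex.exp (t * μ) • (V + (t : ℂ) • ((Y - μ • 1) * V)) := by
  set N := Y - μ • 1 with hN
  have hcomm : Commute Y (μ • 1) := (Commute.one_right Y).smul_right μ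
  have hYN : Commute Y N := (Commute.refl Y).sub_right hcomm
  let f : ℂ → A := fun s => exp (s • -Y) * (Complex.exp (s * μ) • (V + s • (N * V)))
  have hd : ∀ s, HasDerivAt f 0 s := by
    intro s
    have h1 := hasDerivAt_exp_smul_const (𝕂 := ℂ) (-Y) s
    have h2 : HasDerivAt (fun s : ℂ => Complex.exp (s * μ)) (Complex.exp (s * μ) * μ) s := by
      simpa using ((hasDerivAt_id s).mul_const μ).cexp
    have h3 : HasDerivAt (fun s : ℂ => V + s • (N * V)) (N * V) s := by
      simpa using ((hasDerivAt_id s).smul_const (N * V)).const_add V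
    refine (h1.mul (h2.smul h3)).congr_deriv ?_
    have hY : Y = N + μ • 1 := by rw [hN]; abel
    have e1 : Y * (V + s • (N * V)) = N * V + μ • (V + s • (N * V)) := by
      rw [hY, add_mul, mul_add, mul_smul_comm, h, smul_mul_assoc, one_mul]
      simp
    have e2 : ((fun s : ℂ => Complex.exp (s * μ)) • fun s : ℂ => V + s • (N * V)) s
      = Complex.exp (s * μ) • (V + s • (N * V)) := rfl
    rw [e2, mul_neg, neg_mul, mul_assoc, mul_smul_comm, e1]
    generalize V + s • (N * V) = Q
    simp only [mul_add, mul_smul_comm, smul_add, smul_smul]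
    abel
  have hc := is_const_of_deriv_eq_zero
    (fun s => (hd s).differentiableAt) (fun s => (hd s).deriv) t 0
  simp only [f, zero_smul, exp_zero, zero_mul, Complex.exp_zero, one_smul, add_zero, one_mul] at hc
  have hinv : exp ((t : ℂ) • Y) * exp ((t : ℂ) • -Y) = 1 := by
    let _ : NormedAlgebra ℚ A := NormedAlgebra.restrictScalars ℚ ℂ A
    rw [smul_neg, ← exp_add_of_commute (Commute.neg_right (Commute.refl ((t : ℂ) • Y)))]
    simp
  calc exp ((t : ℂ) • Y) * V = exp ((t : ℂ) • Y) * (exp ((t : ℂ) • -Y) * _) := by rw [hc]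
    _ = _ := by rw [← mul_assoc, hinv, one_mul]

theorem sub_smul_mul_eq_zero_of_bounded {A : Type*} [NormedRing A] [NormedAlgebra ℂ A]
    [CompleteSpace A] {Y V : A} {μ : ℂ} {C : ℝ} (hC : ∀ t : ℝ, ‖exp ((t : ℂ) • Y)‖ ≤ C)
    (h : (Y - μ • 1) * ((Y - μ • 1) * V) = 0) : (Y - μ • 1) * V = 0 := by
  set N := Y - μ • 1 with hN
  have hC0 : 0 ≤ C := (norm_nonneg _).trans (hC 0)
  refine sub_mul_eq_zero_of_bounded (C := C * ‖V‖ + C * ‖N * V‖) μ (v := V)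
    (fun t => ?_) fun t => ?_
  · rw [← exp_mul_of_sq_mul_eq_zero h t]
    have := (norm_mul_le (exp ((t : ℂ) • Y)) V).trans
      (mul_le_mul_of_nonneg_right (hC t) (norm_nonneg _))
    have h2 : 0 ≤ C * ‖N * V‖ := by positivity
    linarith
  · have h' : N * (N * (N * V)) = 0 := by rw [h, mul_zero]
    have e := exp_mul_of_sq_mul_eq_zero h' t
    rw [← hN, h, smul_zero, add_zero] at e
    rw [← e]
    have := (norm_mul_le (exp ((t : ℂ) • Y)) (N * V)).trans
      (mul_le_mul_of_nonneg_right (hC t) (norm_nonneg _))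
    have h2 : 0 ≤ C * ‖V‖ := by positivity
    linarith

-- The only source of diagonalizability below: a Jordan block would make the one-parameter group
-- grow on the real line. It is applied to 𝔨 and to the generator of `lam`.
open scoped Matrix.Norms.Operator in
theorem isSemisimpleMat_of_isCompact {Y : Mat n} {s : Set (Mat n)} (hs : IsCompact s)
    (h : ∀ t : ℝ, exp ((t : ℂ) • Y) ∈ s) : IsSemisimpleMat Y := by
  obtain ⟨C, hC⟩ := hs.isBounded.exists_norm_le
  intro μ V hV
  exact sub_smul_mul_eq_zero_of_bounded (C := C) (fun t => hC _ (h t)) hV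

theorem IsSemisimpleMat.smul {Y : Mat n} (h : IsSemisimpleMat Y) {c : ℂ} (hc : c ≠ 0) :
    IsSemisimpleMat (c • Y) := by
  intro μ V hV
  have e : c • Y - μ • 1 = c • (Y - (c⁻¹ * μ) • 1) := by
    rw [smul_sub, smul_smul, mul_inv_cancel_left₀ hc]
  rw [e] at hV ⊢
  simp only [smul_mul_assoc, mul_smul_comm, smul_eq_zero, hc, false_or] at hV ⊢
  exact h _ _ hV

theorem isSemisimpleMat_of_isDiag {M : Mat n} {g : GLn n}
    (h : ((g : Mat n) * M * ((g⁻¹ : GLn n) : Mat n)).IsDiag) : IsSemisimpleMat M := by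
  intro μ V hV
  obtain ⟨d, hd⟩ : ∃ d, (g : Mat n) * M * ((g⁻¹ : GLn n) : Mat n) = Matrix.diagonal d :=
    ⟨_, ((Matrix.isDiag_iff_diagonal_diag _).1 h).symm⟩
  have hg : ((g⁻¹ : GLn n) : Mat n) * (g : Mat n) = 1 := by simp
  have hg' : (g : Mat n) * ((g⁻¹ : GLn n) : Mat n) = 1 := by simp
  have e : ∀ W : Mat n, (g : Mat n) * ((M - μ • 1) * W)
      = Matrix.diagonal (fun i => d i - μ) * ((g : Mat n) * W) := by
    intro W
    have h1 : Matrix.diagonal (fun i => d i - μ) = Matrix.diagonal d - μ • (1 : Mat n) := by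
      rw [← Matrix.diagonal_one, ← Matrix.diagonal_smul, Matrix.diagonal_sub]
      congr 1
      ext i
      simp
    rw [h1, ← hd]
    simp only [sub_mul, mul_sub, smul_mul_assoc, one_mul, mul_smul_comm, mul_assoc]
    rw [← mul_assoc ((g⁻¹ : GLn n) : Mat n), hg, one_mul]
  have h2 : Matrix.diagonal (fun i => d i - μ) * (Matrix.diagonal (fun i => d i - μ)
      * ((g : Mat n) * V)) = 0 := by
    rw [← e, ← e, hV, mul_zero]
  have h3 : (g : Mat n) * ((M - μ • 1) * V) = 0 := by
    rw [e]
    ext i j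
    have := congrFun (congrFun h2 i) j
    simp only [Matrix.diagonal_mul, Matrix.zero_apply, mul_eq_zero] at this ⊢
    tauto
  calc (M - μ • 1) * V = ((g⁻¹ : GLn n) : Mat n) * ((g : Mat n) * ((M - μ • 1) * V)) := by
        rw [← mul_assoc, hg, one_mul]
    _ = 0 := by rw [h3, mul_zero]

theorem IsSemisimpleMat.mulVec {M : Mat n} (h : IsSemisimpleMat M) (μ : ℂ) (v : Fin n → ℂ)
    (hv : (M - μ • 1).mulVec ((M - μ • 1).mulVec v) = 0) : (M - μ • 1).mulVec v = 0 := by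
  -- A vector is encoded as the matrix all of whose columns equal it.
  have e : ∀ (A : Mat n) (w : Fin n → ℂ), A * Matrix.of (fun i (_ : Fin n) => w i)
      = Matrix.of (fun i (_ : Fin n) => A.mulVec w i) := by
    intro A w
    ext i j
    simp [Matrix.mul_apply, Matrix.mulVec, dotProduct]
  have h1 := h μ (Matrix.of fun i _ => v i) (by rw [e, e, hv]; rfl)
  rw [e] at h1
  funext i
  exact congrFun (congrFun h1 i) i

theorem IsSemisimpleMat.maxGenEigenspace_le {M : Mat n} (h : IsSemisimpleMat M) (μ : ℂ)
    {v : Fin n → ℂ} (hv : v ∈ Module.End.maxGenEigenspace (Matrix.toLin' M) μ) :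
    M.mulVec v = μ • v := by
  obtain ⟨k, hk⟩ := (Module.End.mem_maxGenEigenspace _ _ _).1 hv
  have e : Matrix.toLin' M - μ • (1 : Module.End ℂ (Fin n → ℂ)) = Matrix.toLin' (M - μ • 1) := by
    rw [map_sub, map_smul, Matrix.toLin'_one]; rfl
  rw [e] at hk
  have key : ∀ (A : Mat n), (∀ w, A.mulVec (A.mulVec w) = 0 → A.mulVec w = 0) →
      ∀ k : ℕ, ((Matrix.toLin' A) ^ k) v = 0 → A.mulVec v = 0 := by
    intro A hA k
    induction k with
    | zero => intro h0; simp at h0; simp [h0]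
    | succ k ih =>
      intro h0
      rcases k with _ | k
      · simpa using h0
      · refine ih ?_
        rw [pow_succ', pow_succ'] at h0
        rw [pow_succ']
        exact hA ((Matrix.toLin' A ^ k) v) h0
  have := key _ (h.mulVec μ) k hk
  rw [Matrix.sub_mulVec, Matrix.smul_mulVec, Matrix.one_mulVec, sub_eq_zero] at this
  exact this

/-- Commuting diagonalizable matrices are simultaneously diagonalizable. -/
theorem exists_conj_isDiag {s : Set (Mat n)} (hcomm : ∀ M ∈ s, ∀ M' ∈ s, Commute M M')
    (hss : ∀ M ∈ s, IsSemisimpleMat M) :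
    ∃ g : GLn n, ∀ M ∈ s, ((g : Mat n) * M * ((g⁻¹ : GLn n) : Mat n)).IsDiag := by
  let f : s → Module.End ℂ (Fin n → ℂ) := fun M => Matrix.toLin' (M : Mat n)
  have htop :=
    Module.End.iSup_iInf_maxGenEigenspace_eq_top_of_iSup_maxGenEigenspace_eq_top_of_commute f
    (fun i j _ => by
      have := (hcomm i i.2 j j.2).eq
      change Matrix.toLin' _ * Matrix.toLin' _ = _ * _
      rw [Module.End.mul_eq_comp, Module.End.mul_eq_comp, ← Matrix.toLin'_mul,
        ← Matrix.toLin'_mul, this])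
    (fun i => Module.End.iSup_maxGenEigenspace_eq_top _)
  -- Joint eigenvectors. The joint generalized eigenspaces of a commuting family span, and
  -- semisimplicity turns them into eigenspaces; hence J contains a basis, whose members become the
  -- columns of the conjugating matrix.
  let J : Set (Fin n → ℂ) := {v | ∀ M ∈ s, ∃ c : ℂ, M.mulVec v = c • v}
  have hJ : Submodule.span ℂ J = ⊤ := by
    rw [eq_top_iff, ← htop]
    refine iSup_le fun χ v hv => Submodule.subset_span fun M hM => ⟨χ ⟨M, hM⟩, ?_⟩
    exact (hss M hM).maxGenEigenspace_le _ ((Submodule.mem_iInf _).1 hv ⟨M, hM⟩)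
  obtain ⟨b, hbJ, hspan, hli⟩ := exists_linearIndependent ℂ J
  let B₀ := Module.Basis.mk hli (by rw [Subtype.range_coe, hspan, hJ])
  have : Fintype b := FiniteDimensional.fintypeBasisIndex B₀
  have hcard : Fintype.card b = n := by
    rw [← Module.finrank_eq_card_basis B₀]; simp
  let B := B₀.reindex (Fintype.equivFinOfCardEq hcard)
  have hBJ : ∀ j, B j ∈ J := by
    intro j
    simp only [B, Module.Basis.reindex_apply, B₀, Module.Basis.mk_apply]
    exact hbJ (Subtype.mem _)
  let P : Mat n := Matrix.of fun i j => B j i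
  have hP : IsUnit P := by
    rw [← Matrix.linearIndependent_cols_iff_isUnit]
    exact B.linearIndependent
  refine ⟨hP.unit⁻¹, fun M hM => ?_⟩
  choose c hc using fun j => hBJ j M hM
  have hMP : M * P = P * Matrix.diagonal c := by
    ext i j
    rw [Matrix.mul_diagonal]
    have := congrFun (hc j) i
    simp only [Pi.smul_apply, smul_eq_mul] at this
    rw [mul_comm, show P i j = B j i from rfl, ← this]
    rfl
  have : (((hP.unit⁻¹ : GLn n)) : Mat n) * M * (((hP.unit⁻¹)⁻¹ : GLn n) : Mat n)
      = Matrix.diagonal c := by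
    rw [inv_inv, IsUnit.unit_spec, mul_assoc, hMP, ← mul_assoc]
    have : ((hP.unit⁻¹ : GLn n) : Mat n) * P = 1 := hP.val_inv_mul
    rw [this, one_mul]
  rw [this]
  exact Matrix.isDiag_diagonal c

/-! ### Groups of diagonalizable matrices -/

/-- The group of all elements that become diagonal after conjugation by `g`. -/
def diagGroup (g : GLn n) : Subgroup (GLn n) :=
  Subgroup.centralizer {x | ((g * x * g⁻¹ : GLn n) : Mat n).IsDiag}

theorem commute_of_isDiag {g s t : GLn n} (h1 : ((g * s * g⁻¹ : GLn n) : Mat n).IsDiag)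
    (h2 : ((g * t * g⁻¹ : GLn n) : Mat n).IsDiag) : s * t = t * s := by
  have key : (g * s * g⁻¹) * (g * t * g⁻¹) = (g * t * g⁻¹) * (g * s * g⁻¹) := by
    apply Units.ext
    rw [Units.val_mul (g * s * g⁻¹), Units.val_mul (g * t * g⁻¹),
      ← (Matrix.isDiag_iff_diagonal_diag _).1 h1,
      ← (Matrix.isDiag_iff_diagonal_diag _).1 h2, Matrix.diagonal_mul_diagonal,
      Matrix.diagonal_mul_diagonal]
    simp only [mul_comm]
  have e1 : (g * s * g⁻¹) * (g * t * g⁻¹) = g * (s * t) * g⁻¹ := by group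
  have e2 : (g * t * g⁻¹) * (g * s * g⁻¹) = g * (t * s) * g⁻¹ := by group
  rw [e1, e2] at key
  exact mul_left_cancel (mul_right_cancel key)

/-- The definition as a centralizer makes algebraicity immediate; it is the expected group because
the diagonal matrices are their own centralizer. -/
theorem mem_diagGroup {g t : GLn n} :
    t ∈ diagGroup g ↔ ((g * t * g⁻¹ : GLn n) : Mat n).IsDiag := by
  constructor
  · intro h i j hij
    -- Distinct entries force everything commuting with this matrix to be diagonal; the shift by 1
    -- keeps it invertible.
    let d : Fin n → ℂ := fun i => (i : ℂ) + 1
    have hd : ∀ i, d i ≠ 0 := fun i => by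
      simp only [d]; exact_mod_cast Nat.succ_ne_zero (i : ℕ)
    have hdu : IsUnit (Matrix.diagonal d) := by
      rw [Matrix.isUnit_diagonal]
      exact Pi.isUnit_iff.2 fun i => (hd i).isUnit
    have hx := Subgroup.mem_centralizer_iff.1 h (g⁻¹ * hdu.unit * g) (by
      have : g * (g⁻¹ * hdu.unit * g) * g⁻¹ = hdu.unit := by group
      rw [Set.mem_ofPred_eq, this, IsUnit.unit_spec]
      exact Matrix.isDiag_diagonal d)
    have hx' : hdu.unit * (g * t * g⁻¹) = (g * t * g⁻¹) * hdu.unit := by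
      calc hdu.unit * (g * t * g⁻¹) = g * (g⁻¹ * hdu.unit * g * t) * g⁻¹ := by group
        _ = g * (t * (g⁻¹ * hdu.unit * g)) * g⁻¹ := by rw [hx]
        _ = _ := by group
    have : (Matrix.diagonal d * ((g * t * g⁻¹ : GLn n) : Mat n)) i j
        = (((g * t * g⁻¹ : GLn n) : Mat n) * Matrix.diagonal d) i j := by
      have h5 : ((hdu.unit * (g * t * g⁻¹) : GLn n) : Mat n)
        = (((g * t * g⁻¹) * hdu.unit : GLn n) : Mat n) := by rw [hx']
      rw [Units.val_mul hdu.unit, Units.val_mul (g * t * g⁻¹) hdu.unit, IsUnit.unit_spec] at h5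
      rw [h5]
    rw [Matrix.diagonal_mul, Matrix.mul_diagonal, mul_comm, ← sub_eq_zero, ← mul_sub,
      mul_eq_zero] at this
    refine this.resolve_right fun h0 => hij ?_
    simp only [d, add_sub_add_right_eq_sub, sub_eq_zero] at h0
    exact Fin.ext (by exact_mod_cast h0)
  · intro h
    exact Subgroup.mem_centralizer_iff.2 fun x hx => commute_of_isDiag hx h

theorem isAlgebraic_diagGroup (g : GLn n) : IsAlgebraic (diagGroup g) := isAlgebraic_centralizer _

theorem diagGroup_comm {g s t : GLn n} (hs : s ∈ diagGroup g) (ht : t ∈ diagGroup g) :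
    s * t = t * s := commute_of_isDiag (mem_diagGroup.1 hs) (mem_diagGroup.1 ht)

theorem isTorus_neutralComponent {N : Subgroup (GLn n)} (hN : IsAlgebraic N) {g : GLn n}
    (hg : N ≤ diagGroup g) : IsTorus (neutralComponent N) where
  isAlgebraic := neutralComponent_isAlgebraic N
  connected := neutralComponent_isConnected hN
  diagonalizable := ⟨g, fun _ ht => mem_diagGroup.1 (hg (neutralComponent_le N hN ht))⟩

/-- A torus and a semisimple one-parameter group commuting with it are simultaneously
diagonalizable. -/
theorem exists_diagGroup {T : Subgroup (GLn n)} (hT : IsTorus T) {X : Mat n}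
    (hX : IsSemisimpleMat X) (hcomm : ∀ t ∈ T, Commute (t : Mat n) X) :
    ∃ g : GLn n, T ≤ diagGroup g ∧ X ∈ lieAlg (diagGroup g) := by
  obtain ⟨g₀, hg₀⟩ := hT.diagonalizable
  obtain ⟨g, hg⟩ := exists_conj_isDiag (s := insert X ((fun t : GLn n => (t : Mat n)) '' T)) (by
      rintro _ (rfl | ⟨t, ht, rfl⟩) _ (rfl | ⟨t', ht', rfl⟩)
      · exact Commute.refl _
      · exact (hcomm t' ht').symm
      · exact hcomm t ht
      · exact congrArg Units.val (commute_of_isDiag (hg₀ t ht) (hg₀ t' ht')))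
    (by
      rintro _ (rfl | ⟨t, ht, rfl⟩)
      · exact hX
      · exact isSemisimpleMat_of_isDiag (g := g₀) (by simpa using hg₀ t ht))
  refine ⟨g, fun t ht => mem_diagGroup.2 (by simpa using hg t (Or.inr ⟨t, ht, rfl⟩)), fun z => ?_⟩
  rw [mem_diagGroup, ← expGL_conj, expGL_val]
  have h1 := hg X (Or.inl rfl)
  rw [mul_smul_comm, smul_mul_assoc, ← (Matrix.isDiag_iff_diagonal_diag _).1 h1,
    ← Matrix.diagonal_smul, Matrix.exp_diagonal]
  exact Matrix.isDiag_diagonal _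

/-- After diagonalizing T and X simultaneously, the neutral component of the diagonalizable elements
of L is a torus containing T, hence equal to T. Passing to the neutral component does not change the
Lie algebra, which contains X. -/
theorem CartanData.mem_lieAlg_T {D : HorosymmetricSpace n} (C : CartanData D) {X : Mat n}
    (hXL : X ∈ lieAlg D.L) (hX : IsSemisimpleMat X)
    (hcomm : ∀ t ∈ C.T, Commute (t : Mat n) X) : X ∈ lieAlg C.T := by
  obtain ⟨g, hTg, hXg⟩ := exists_diagGroup C.T_torus hX hcomm
  have hN : IsAlgebraic (D.L ⊓ diagGroup g) :=
    (isAlgebraic_levi D.G_algebraic D.lam).inf (isAlgebraic_diagGroup g)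
  have h1 : C.T ≤ neutralComponent (D.L ⊓ diagGroup g) :=
    C.T_torus.connected.le_neutralComponent C.T_torus.isAlgebraic (le_inf C.T_le_L hTg)
  have h2 := C.T_maximal _ (isTorus_neutralComponent hN inf_le_right)
    ((neutralComponent_le _ hN).trans inf_le_left) h1
  rw [← h2]
  exact lieAlg_neutralComponent _ fun z => ⟨hXL z, hXg z⟩

theorem HorosymmetricSpace.L_algebraic (D : HorosymmetricSpace n) : IsAlgebraic D.L :=
  isAlgebraic_levi D.G_algebraic D.lam

/-- The elements of `L ∩ diagGroup g` that are inverted by `σ`. -/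
def splitGroup (D : HorosymmetricSpace n) (g : GLn n) : Subgroup (GLn n) where
  carrier := {x | ∃ h : x ∈ D.L, x ∈ diagGroup g ∧ D.σ ⟨x, h⟩ = ⟨x, h⟩⁻¹}
  one_mem' := ⟨D.L.one_mem, Subgroup.one_mem _, by
    have : (⟨1, D.L.one_mem⟩ : D.L) = 1 := rfl
    rw [this, map_one, inv_one]⟩
  mul_mem' := by
    rintro x y ⟨hx, hx', hxσ⟩ ⟨hy, hy', hyσ⟩
    refine ⟨D.L.mul_mem hx hy, Subgroup.mul_mem _ hx' hy', ?_⟩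
    have : (⟨x * y, D.L.mul_mem hx hy⟩ : D.L) = ⟨x, hx⟩ * ⟨y, hy⟩ := rfl
    rw [this, map_mul, hxσ, hyσ, mul_inv_rev]
    refine Subtype.ext ?_
    -- Elements inverted by an automorphism form a subgroup only where the group is commutative,
    -- hence the intersection with `diagGroup g`.
    have := diagGroup_comm (Subgroup.inv_mem _ hx') (Subgroup.inv_mem _ hy')
    simpa using this
  inv_mem' := by
    rintro x ⟨hx, hx', hxσ⟩
    refine ⟨D.L.inv_mem hx, Subgroup.inv_mem _ hx', ?_⟩
    have : (⟨x⁻¹, D.L.inv_mem hx⟩ : D.L) = ⟨x, hx⟩⁻¹ := rfl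
    rw [this, map_inv, hxσ]

theorem isAlgebraic_splitGroup (D : HorosymmetricSpace n) (g : GLn n) :
    IsAlgebraic (splitGroup D g) := by
  obtain ⟨I, hI⟩ := D.L_algebraic.inf (isAlgebraic_diagGroup g)
  choose p hp using D.σ_algebraic
  refine IsAlgebraic.of_regFun (f := Sum.elim (fun (q : I) x => MvPolynomial.eval (coords x) q.1)
    (fun (ij : Fin n × Fin n) x => MvPolynomial.eval (coords x) (p ij.1 ij.2)
      - ((x⁻¹ : GLn n) : Mat n) ij.1 ij.2)) ?_ fun x => ?_
  · rintro (q | ij)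
    · exact RegFun.eval _
    · exact (RegFun.eval _).sub (RegFun.inv_entry _ _)
  · constructor
    · rintro ⟨hx, hx', hxσ⟩ (q | ij)
      · exact (hI x).1 ⟨hx, hx'⟩ q.1 q.2
      · have h1 : ((D.σ ⟨x, hx⟩ : GLn n) : Mat n) ij.1 ij.2 = _ := hp ij.1 ij.2 ⟨x, hx⟩
        rw [hxσ] at h1
        exact sub_eq_zero.2 h1.symm
    · intro h
      have hx := (hI x).2 fun q hq => h (.inl ⟨q, hq⟩)
      refine ⟨hx.1, hx.2, Subtype.ext (Units.ext (Matrix.ext fun i j => ?_))⟩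
      have := h (.inr (i, j))
      simp only [Sum.elim_inr] at this
      exact (hp i j ⟨x, hx.1⟩).trans (sub_eq_zero.1 this)

/-- As for T, one obtains a split torus that contains T_s and has X in its Lie algebra. T_s is
maximal in dimension, so equality is obtained on the level of Lie algebras only. -/
theorem CartanData.mem_lieAlg_Ts {D : HorosymmetricSpace n} (C : CartanData D) {X : Mat n}
    (hXL : X ∈ lieAlg D.L) (hX : IsSemisimpleMat X)
    (hσ : ∀ z : ℂ, D.σ (expIn D.L (z • X)) = (expIn D.L (z • X))⁻¹)
    (hcomm : ∀ t ∈ C.Ts, Commute (t : Mat n) X) : X ∈ lieAlg C.Ts := by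
  obtain ⟨g, hTg, hXg⟩ := exists_diagGroup C.Ts_split.1 hX hcomm
  have hN := isAlgebraic_splitGroup D g
  have hle : splitGroup D g ≤ diagGroup g := fun x hx => hx.2.1
  have h1 : C.Ts ≤ neutralComponent (splitGroup D g) :=
    C.Ts_split.1.connected.le_neutralComponent C.Ts_split.1.isAlgebraic fun t ht =>
      ⟨C.Ts_split.2.1 ht, hTg ht, C.Ts_split.2.2 ⟨t, C.Ts_split.2.1 ht⟩ ht⟩
  have hXN : X ∈ lieAlg (neutralComponent (splitGroup D g)) := by
    refine lieAlg_neutralComponent _ fun z => ⟨hXL z, hXg z, ?_⟩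
    have : (⟨expGL (z • X), hXL z⟩ : D.L) = expIn D.L (z • X) := by
      rw [expIn, dif_pos (hXL z)]
    rw [this]
    exact hσ z
  have hdim := C.Ts_maximal (neutralComponent (splitGroup D g))
    ⟨isTorus_neutralComponent hN hle, fun x hx => (neutralComponent_le _ hN hx).1,
      fun l hl => (neutralComponent_le _ hN hl).2.2⟩
  have hTs := C.Ts_split.1.isAlgebraic
  have e1 : ∀ {S : Subgroup (GLn n)} (hS : IsAlgebraic S),
      Submodule.span ℂ (lieAlg S) = lieSub hS := fun hS =>
    Submodule.span_eq (lieSub hS)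
  rw [algDim, algDim, e1 hTs, e1 (neutralComponent_isAlgebraic _)] at hdim
  have h3 : lieSub hTs ≤ lieSub (neutralComponent_isAlgebraic (splitGroup D g)) := lieAlg_mono h1
  have h4 := Submodule.eq_of_le_of_finrank_le h3 hdim
  have : X ∈ lieSub hTs := by rw [h4]; exact hXN
  exact this

/-! ### Differentials of homomorphisms and characters -/

theorem hasDerivAt_entry {f : ℝ → Mat n} {X : Mat n} {t : ℝ} (h : HasDerivAt f X t) (i j : Fin n) :
    HasDerivAt (fun s => f s i j) (X i j) t := hasDerivAt_mat_iff.1 h i j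

theorem exists_hasDerivAt_eval (p : MvPolynomial ((Fin n × Fin n) ⊕ (Fin n × Fin n)) ℂ) :
    ∃ ℓ : Mat n →ₗ[ℂ] ℂ, ∀ X : Mat n,
      HasDerivAt (fun t : ℝ => MvPolynomial.eval (coords (expGL (t • X))) p) (ℓ X) 0 := by
  -- The velocity at t = 0 of the coordinates of exp(tX): X on the entries, -X on the entries of the
  -- inverse.
  let τ : Mat n →ₗ[ℂ] ((Fin n × Fin n) ⊕ (Fin n × Fin n) → ℂ) :=
    { toFun := fun X => Sum.elim (fun ij => X ij.1 ij.2) (fun ij => -X ij.1 ij.2)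
      map_add' := fun X Y => by
        ext (x | x)
        · simp
        · simp [add_comm]
      map_smul' := fun c X => by ext (x | x) <;> simp }
  have hdiff : DifferentiableAt ℂ (fun x => MvPolynomial.eval x p) (coords (1 : GLn n)) := by
    have := (AnalyticOnNhd.eval_mvPolynomial (𝕜 := ℂ) p) (coords (1 : GLn n)) (Set.mem_univ _)
    exact this.differentiableAt
  refine ⟨(fderiv ℂ (fun x => MvPolynomial.eval x p) (coords (1 : GLn n))).toLinearMap ∘ₗ τ,
    fun X => ?_⟩
  have hc : HasDerivAt (fun t : ℝ => coords (expGL (t • X))) (τ X) 0 := by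
    rw [hasDerivAt_pi]
    rintro (⟨i, j⟩ | ⟨i, j⟩)
    · exact hasDerivAt_entry (hasDerivAt_exp X) i j
    · have := hasDerivAt_entry (hasDerivAt_exp (-X)) i j
      refine this.congr_of_eventuallyEq (Eventually.of_forall fun t => ?_)
      simp only [coords, Sum.elim_inr]
      rw [expGL_inv_val, smul_neg]
  have h0 : coords (expGL ((0 : ℝ) • X)) = coords (1 : GLn n) := by simp
  have h1 := (hdiff.hasFDerivAt.restrictScalars ℝ)
  rw [← h0] at h1
  have := h1.comp_hasDerivAt (0 : ℝ) hc
  rw [h0] at this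
  exact this

@[simp] theorem expIn_zero (S : Subgroup (GLn n)) : expIn S (0 : Mat n) = 1 :=
  Subtype.ext (by rw [expIn_val (lieAlg_zero S)]; simp)

theorem expIn_add {S : Subgroup (GLn n)} {X Y : Mat n} (hX : X ∈ lieAlg S) (hY : Y ∈ lieAlg S)
    (hXY : X + Y ∈ lieAlg S) (h : Commute X Y) : expIn S (X + Y) = expIn S X * expIn S Y :=
  Subtype.ext (by simp [expIn_val, hX, hY, hXY, expGL_add h])

theorem expIn_add_smul {S : Subgroup (GLn n)} {X : Mat n} (hX : X ∈ lieAlg S) (s t : ℝ) :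
    expIn S ((s + t) • X) = expIn S (s • X) * expIn S (t • X) := by
  refine Subtype.ext ?_
  rw [Subgroup.coe_mul, expIn_val (lieAlg_real_smul hX _), expIn_val (lieAlg_real_smul hX _),
    expIn_val (lieAlg_real_smul hX _), add_smul, expGL_add]
  exact ((Commute.refl X).smul_left s).smul_right t

theorem expIn_neg {S : Subgroup (GLn n)} {X : Mat n} (hX : X ∈ lieAlg S) :
    expIn S (-X) = (expIn S X)⁻¹ := by
  refine Subtype.ext ?_
  rw [expIn_val (lieAlg_neg hX), Subgroup.coe_inv, expIn_val hX, expGL_neg]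

theorem expIn_conj {S : Subgroup (GLn n)} {X : Mat n} (hX : X ∈ lieAlg S) (g : S) :
    expIn S (((g : GLn n) : Mat n) * X * (((g : GLn n)⁻¹ : GLn n) : Mat n))
      = g * expIn S X * g⁻¹ := by
  refine Subtype.ext ?_
  rw [expIn_val (lieAlg_conj hX g.2), expGL_conj]
  simp [expIn_val hX]

theorem continuous_expIn {S : Subgroup (GLn n)} {E : Type*} [TopologicalSpace E] {f : E → Mat n}
    (hf : Continuous f) (h : ∀ x, f x ∈ lieAlg S) : Continuous fun x => expIn S (f x) := by
  refine continuous_induced_rng.2 ?_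
  have : (Subtype.val ∘ fun x => expIn S (f x)) = fun x => expGL (f x) := by
    funext x
    exact expIn_val (h x)
  rw [this]
  exact continuous_expGL.comp hf

theorem continuous_real_smul (X : Mat n) : Continuous fun t : ℝ => t • X :=
  continuous_id.smul continuous_const

theorem hasDerivAt_entries {S : Subgroup (GLn n)} {X : Mat n} (hX : X ∈ lieAlg S) :
    HasDerivAt (fun t : ℝ => entries (expIn S (t • X))) (fun i j => X i j) 0 := by
  rw [hasDerivAt_pi]
  intro i
  rw [hasDerivAt_pi]
  intro j
  refine (hasDerivAt_entry (hasDerivAt_exp X) i j).congr_of_eventuallyEq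
    (Eventually.of_forall fun t => ?_)
  simp only [entries]
  rw [expIn_val (lieAlg_real_smul hX t), expGL_val]

theorem HolAt.exists_hasDerivAt {S : Subgroup (GLn n)} {f : S → ℂ} (hf : HolAt f 1) :
    ∃ ℓ : Mat n →ₗ[ℂ] ℂ, ∀ X ∈ lieAlg S,
      HasDerivAt (fun t : ℝ => f (expIn S (t • X))) (ℓ X) 0 := by
  obtain ⟨F, hF, hev⟩ := hf
  let ι : Mat n →ₗ[ℂ] (Fin n → Fin n → ℂ) :=
    { toFun := fun X i j => X i j, map_add' := fun _ _ => rfl, map_smul' := fun _ _ => rfl }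
  refine ⟨(fderiv ℂ F (entries (1 : S))).toLinearMap ∘ₗ ι, fun X hX => ?_⟩
  have hc := hasDerivAt_entries hX
  have h0 : entries (expIn S ((0 : ℝ) • X)) = entries (1 : S) := by simp
  have h1 := hF.differentiableAt.hasFDerivAt.restrictScalars ℝ
  rw [← h0] at h1
  have h2 := h1.comp_hasDerivAt (0 : ℝ) hc
  rw [h0] at h2
  refine h2.congr_of_eventuallyEq ?_
  have hcont : Continuous fun t : ℝ => expIn S (t • X) :=
    continuous_expIn (continuous_real_smul X) fun t => lieAlg_real_smul hX t
  have ht : Tendsto (fun t : ℝ => expIn S (t • X)) (𝓝 0) (𝓝 1) := by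
    simpa using hcont.tendsto 0
  exact ht.eventually hev

/-- `D` is the differential of `f` on the Lie algebra of `S`. -/
def HasHomDeriv (S : Subgroup (GLn n)) (f : S →* S) (D : Mat n →ₗ[ℝ] Mat n) : Prop :=
  ∀ X ∈ lieAlg S, HasDerivAt (fun t : ℝ => ((f (expIn S (t • X)) : GLn n) : Mat n)) (D X) 0

namespace HasHomDeriv

variable {S : Subgroup (GLn n)} {f : S →* S} {D : Mat n →ₗ[ℝ] Mat n}

theorem dHom_eq (h : HasHomDeriv S f D) {X : Mat n} (hX : X ∈ lieAlg S) : dHom S f X = D X := by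
  ext i j
  exact (hasDerivAt_entry (h X hX) i j).deriv

theorem map_exp_smul (h : HasHomDeriv S f D) {X : Mat n} (hX : X ∈ lieAlg S) (t : ℝ) :
    (f (expIn S (t • X)) : GLn n) = expGL (t • D X) := by
  refine Units.ext ?_
  refine eq_exp_of_hasDerivAt (f := fun t : ℝ => ((f (expIn S (t • X)) : GLn n) : Mat n))
    (by simp) (fun s t => ?_) (h X hX) t
  rw [expIn_add_smul hX, map_mul, Subgroup.coe_mul, Units.val_mul]

theorem map_exp (h : HasHomDeriv S f D) {X : Mat n} (hX : X ∈ lieAlg S) :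
    (f (expIn S X) : GLn n) = expGL (D X) := by
  simpa using h.map_exp_smul hX 1

theorem map_conj (h : HasHomDeriv S f D) {X : Mat n} (hX : X ∈ lieAlg S) (g : S) :
    D (((g : GLn n) : Mat n) * X * (((g : GLn n)⁻¹ : GLn n) : Mat n))
      = ((f g : GLn n) : Mat n) * D X * (((f g : GLn n)⁻¹ : GLn n) : Mat n) := by
  refine exp_smul_injective fun t => ?_
  have h1 := h.map_exp_smul (lieAlg_conj hX g.2) t
  have e : t • (((g : GLn n) : Mat n) * X * (((g : GLn n)⁻¹ : GLn n) : Mat n))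
      = ((g : GLn n) : Mat n) * (t • X) * (((g : GLn n)⁻¹ : GLn n) : Mat n) := by simp
  rw [e, expIn_conj (lieAlg_real_smul hX t), map_mul, map_mul, map_inv, Subgroup.coe_mul,
    Subgroup.coe_mul, Subgroup.coe_inv, h.map_exp_smul hX, ← expGL_conj] at h1
  have h2 := congrArg Units.val h1
  rw [expGL_val, expGL_val] at h2
  rw [← h2]
  simp

theorem map_lie (h : HasHomDeriv S f D) {X Y : Mat n} (hX : X ∈ lieAlg S) (hY : Y ∈ lieAlg S) :
    D ⁅X, Y⁆ = ⁅D X, D Y⁆ := by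
  have h1 := hasDerivAt_linear D (hasDerivAt_conj_exp X Y)
  have h2 := hasDerivAt_conj_exp (D X) (D Y)
  have e : (fun s : ℝ => D (exp (s • X) * Y * exp (-(s • X))))
      = fun s : ℝ => exp (s • D X) * D Y * exp (-(s • D X)) := by
    funext s
    have := h.map_conj hY (expIn S (s • X))
    rw [expIn_val (lieAlg_real_smul hX s), h.map_exp_smul hX, expGL_inv_val, expGL_inv_val] at this
    exact this
  rw [e] at h1
  exact hasDerivAt_mat_unique h1 h2

theorem involutive (h : HasHomDeriv S f D) (hf : ∀ g, f (f g) = g) {X : Mat n} (hX : X ∈ lieAlg S)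
    (hDX : D X ∈ lieAlg S) : D (D X) = X := by
  refine exp_smul_injective fun t => ?_
  have h1 := h.map_exp_smul hDX t
  have h2 : expIn S (t • D X) = f (expIn S (t • X)) :=
    Subtype.ext (by rw [h.map_exp_smul hX, expIn_val (lieAlg_real_smul hDX t)])
  rw [h2, hf, expIn_val (lieAlg_real_smul hX t)] at h1
  exact (congrArg Units.val h1).symm

/-- For an antilinear differential, exp(t D(X)) is the image of the exponential at the conjugate
parameter. -/
theorem mem_of_conj (h : HasHomDeriv S f D)
    (hD : ∀ (c : ℂ) (X : Mat n), D (c • X) = (starRingEnd ℂ) c • D X) {X : Mat n}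
    (hX : X ∈ lieAlg S) : D X ∈ lieAlg S := fun t => by
  have := h.map_exp (lieAlg_smul hX ((starRingEnd ℂ) t))
  rw [hD, Complex.conj_conj] at this
  rw [← this]
  exact Subtype.mem _

theorem mem_of_linear (h : HasHomDeriv S f D)
    (hD : ∀ (c : ℂ) (X : Mat n), D (c • X) = c • D X) {X : Mat n}
    (hX : X ∈ lieAlg S) : D X ∈ lieAlg S := fun t => by
  have := h.map_exp (lieAlg_smul hX t)
  rw [hD] at this
  rw [← this]
  exact Subtype.mem _

end HasHomDeriv

/-- The differential of a homomorphism with regular components is complex linear. -/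
theorem exists_hasHomDeriv_of_regular {S : Subgroup (GLn n)} {f : S →* S}
    (hf : ∀ i j, IsRegular S fun l => ((f l : GLn n) : Mat n) i j) :
    ∃ D : Mat n →ₗ[ℝ] Mat n, HasHomDeriv S f D ∧ ∀ (c : ℂ) (X : Mat n), D (c • X) = c • D X := by
  choose p hp using hf
  choose ℓ hℓ using fun i j => exists_hasDerivAt_eval (p i j)
  refine ⟨{ toFun := fun X => Matrix.of fun i j => ℓ i j X
            map_add' := fun X Y => by ext; simp
            map_smul' := fun c X => by
              ext i j
              simp only [Matrix.of_apply, RingHom.id_apply, Matrix.smul_apply]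
              rw [← Complex.coe_smul, map_smul, Complex.coe_smul] }, fun X hX => ?_, fun c X => ?_⟩
  · rw [hasDerivAt_mat_iff]
    intro i j
    refine (hℓ i j X).congr_of_eventuallyEq (Eventually.of_forall fun t => ?_)
    exact (hp i j _).trans (by rw [expIn_val (lieAlg_real_smul hX t)])
  · ext i j
    simp

/-- The differential of a homomorphism with antiholomorphic components is antilinear. -/
theorem exists_hasHomDeriv_of_antiholomorphic {S : Subgroup (GLn n)} {f : S →* S}
    (hf : ∀ i j, HolAt (fun x : S => (starRingEnd ℂ) (((f x : GLn n) : Mat n) i j)) 1) :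
    ∃ D : Mat n →ₗ[ℝ] Mat n, HasHomDeriv S f D ∧
      ∀ (c : ℂ) (X : Mat n), D (c • X) = (starRingEnd ℂ) c • D X := by
  choose ℓ hℓ using fun i j => (hf i j).exists_hasDerivAt
  refine ⟨{ toFun := fun X => Matrix.of fun i j => (starRingEnd ℂ) (ℓ i j X)
            map_add' := fun X Y => by ext; simp
            map_smul' := fun c X => by
              ext i j
              simp only [Matrix.of_apply, RingHom.id_apply, Matrix.smul_apply]
              rw [← Complex.coe_smul, map_smul]
              simp }, fun X hX => ?_, fun c X => ?_⟩
  · rw [hasDerivAt_mat_iff]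
    intro i j
    have := (hℓ i j X hX).star
    simpa using this
  · ext i j
    simp

/-! ### The differentials of `σ` and `θ` -/

section

variable (D : HorosymmetricSpace n)

theorem HorosymmetricSpace.exists_dσ : ∃ A : Mat n →ₗ[ℝ] Mat n, HasHomDeriv D.L D.σ A ∧
    ∀ (c : ℂ) (X : Mat n), A (c • X) = c • A X := exists_hasHomDeriv_of_regular D.σ_algebraic

namespace HorosymmetricSpace

variable {D} {X Y : Mat n}

theorem dσ_mem (hX : X ∈ lieAlg D.L) : D.dσ X ∈ lieAlg D.L := by
  obtain ⟨A, hA, hlin⟩ := D.exists_dσ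
  rw [dσ, hA.dHom_eq hX]
  exact hA.mem_of_linear hlin hX

theorem dσ_add (hX : X ∈ lieAlg D.L) (hY : Y ∈ lieAlg D.L) : D.dσ (X + Y) = D.dσ X + D.dσ Y := by
  obtain ⟨A, hA, hlin⟩ := D.exists_dσ
  simp only [dσ, hA.dHom_eq hX, hA.dHom_eq hY, hA.dHom_eq (lieAlg_add D.L_algebraic hX hY), map_add]

theorem dσ_smul (hX : X ∈ lieAlg D.L) (c : ℂ) : D.dσ (c • X) = c • D.dσ X := by
  obtain ⟨A, hA, hlin⟩ := D.exists_dσ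
  simp only [dσ, hA.dHom_eq hX, hA.dHom_eq (lieAlg_smul hX c), hlin]

theorem dσ_neg (hX : X ∈ lieAlg D.L) : D.dσ (-X) = -D.dσ X := by
  simpa using dσ_smul hX (-1)

theorem dσ_sub (hX : X ∈ lieAlg D.L) (hY : Y ∈ lieAlg D.L) : D.dσ (X - Y) = D.dσ X - D.dσ Y := by
  rw [sub_eq_add_neg, dσ_add hX (lieAlg_neg hY), dσ_neg hY, ← sub_eq_add_neg]

theorem dσ_lie (hX : X ∈ lieAlg D.L) (hY : Y ∈ lieAlg D.L) : D.dσ ⁅X, Y⁆ = ⁅D.dσ X, D.dσ Y⁆ := by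
  obtain ⟨A, hA, hlin⟩ := D.exists_dσ
  simp only [dσ, hA.dHom_eq hX, hA.dHom_eq hY, hA.dHom_eq (lieAlg_lie D.L_algebraic hX hY),
    hA.map_lie hX hY]

theorem dσ_dσ (hX : X ∈ lieAlg D.L) : D.dσ (D.dσ X) = X := by
  obtain ⟨A, hA, hlin⟩ := D.exists_dσ
  have h1 := hA.mem_of_linear hlin hX
  rw [dσ, dσ, hA.dHom_eq hX, hA.dHom_eq h1]
  exact hA.involutive D.σ_involutive hX h1

theorem σ_exp (hX : X ∈ lieAlg D.L) : D.σ (expIn D.L X) = expIn D.L (D.dσ X) := by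
  obtain ⟨A, hA, hlin⟩ := D.exists_dσ
  refine Subtype.ext ?_
  rw [hA.map_exp hX, expIn_val (dσ_mem hX), dσ, hA.dHom_eq hX]

theorem dσ_conj (hX : X ∈ lieAlg D.L) (g : D.L) :
    D.dσ (((g : GLn n) : Mat n) * X * (((g : GLn n)⁻¹ : GLn n) : Mat n))
      = ((D.σ g : GLn n) : Mat n) * D.dσ X * (((D.σ g : GLn n)⁻¹ : GLn n) : Mat n) := by
  obtain ⟨A, hA, hlin⟩ := D.exists_dσ
  rw [dσ, dσ, hA.dHom_eq hX, hA.dHom_eq (lieAlg_conj hX g.2), hA.map_conj hX]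

end HorosymmetricSpace

end

namespace CartanData

variable {D : HorosymmetricSpace n} (C : CartanData D) {X Y : Mat n}

theorem exists_dθ : ∃ A : Mat n →ₗ[ℝ] Mat n, HasHomDeriv D.G C.θ A ∧
    ∀ (c : ℂ) (X : Mat n), A (c • X) = (starRingEnd ℂ) c • A X :=
  exists_hasHomDeriv_of_antiholomorphic fun i j => C.θ_antiholomorphic i j 1

theorem dθ_mem (hX : X ∈ lieAlg D.G) : C.dθ X ∈ lieAlg D.G := by
  obtain ⟨A, hA, hlin⟩ := C.exists_dθ
  rw [dθ, hA.dHom_eq hX]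
  exact hA.mem_of_conj hlin hX

theorem dθ_add (hX : X ∈ lieAlg D.G) (hY : Y ∈ lieAlg D.G) : C.dθ (X + Y) = C.dθ X + C.dθ Y := by
  obtain ⟨A, hA, hlin⟩ := C.exists_dθ
  simp only [dθ, hA.dHom_eq hX, hA.dHom_eq hY, hA.dHom_eq (lieAlg_add D.G_algebraic hX hY), map_add]

theorem dθ_smul (hX : X ∈ lieAlg D.G) (c : ℂ) : C.dθ (c • X) = (starRingEnd ℂ) c • C.dθ X := by
  obtain ⟨A, hA, hlin⟩ := C.exists_dθ
  simp only [dθ, hA.dHom_eq hX, hA.dHom_eq (lieAlg_smul hX c), hlin]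

theorem dθ_neg (hX : X ∈ lieAlg D.G) : C.dθ (-X) = -C.dθ X := by
  simpa using C.dθ_smul hX (-1)

theorem dθ_sub (hX : X ∈ lieAlg D.G) (hY : Y ∈ lieAlg D.G) : C.dθ (X - Y) = C.dθ X - C.dθ Y := by
  rw [sub_eq_add_neg, C.dθ_add hX (lieAlg_neg hY), C.dθ_neg hY, ← sub_eq_add_neg]

theorem dθ_lie (hX : X ∈ lieAlg D.G) (hY : Y ∈ lieAlg D.G) : C.dθ ⁅X, Y⁆ = ⁅C.dθ X, C.dθ Y⁆ := by
  obtain ⟨A, hA, hlin⟩ := C.exists_dθ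
  simp only [dθ, hA.dHom_eq hX, hA.dHom_eq hY, hA.dHom_eq (lieAlg_lie D.G_algebraic hX hY),
    hA.map_lie hX hY]

theorem dθ_dθ (hX : X ∈ lieAlg D.G) : C.dθ (C.dθ X) = X := by
  obtain ⟨A, hA, hlin⟩ := C.exists_dθ
  have h1 := hA.mem_of_conj hlin hX
  rw [dθ, dθ, hA.dHom_eq hX, hA.dHom_eq h1]
  exact hA.involutive C.θ_involutive hX h1

theorem θ_exp (hX : X ∈ lieAlg D.G) : C.θ (expIn D.G X) = expIn D.G (C.dθ X) := by
  obtain ⟨A, hA, hlin⟩ := C.exists_dθ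
  refine Subtype.ext ?_
  rw [hA.map_exp hX, expIn_val (C.dθ_mem hX), dθ, hA.dHom_eq hX]

theorem dθ_conj (hX : X ∈ lieAlg D.G) (g : D.G) :
    C.dθ (((g : GLn n) : Mat n) * X * (((g : GLn n)⁻¹ : GLn n) : Mat n))
      = ((C.θ g : GLn n) : Mat n) * C.dθ X * (((C.θ g : GLn n)⁻¹ : GLn n) : Mat n) := by
  obtain ⟨A, hA, hlin⟩ := C.exists_dθ
  rw [dθ, dθ, hA.dHom_eq hX, hA.dHom_eq (lieAlg_conj hX g.2), hA.map_conj hX]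

theorem lieL_le {X : Mat n} (hX : X ∈ lieAlg D.L) : X ∈ lieAlg D.G := lieAlg_mono D.L_le_G hX

theorem dθ_mem_L (hX : X ∈ lieAlg D.L) : C.dθ X ∈ lieAlg D.L := fun t => by
  have hXG := lieL_le hX
  have h1 := C.θ_exp (lieAlg_smul hXG ((starRingEnd ℂ) t))
  rw [C.dθ_smul hXG, Complex.conj_conj] at h1
  have h2 := C.θ_L (expIn D.G ((starRingEnd ℂ) t • X)) (by
    rw [expIn_val (lieAlg_smul hXG _)]
    exact hX _)
  rwa [h1, expIn_val (lieAlg_smul (C.dθ_mem hXG) t)] at h2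

theorem dσ_dθ (hX : X ∈ lieAlg D.L) : D.dσ (C.dθ X) = C.dθ (D.dσ X) := by
  refine exp_smul_injective fun t => ?_
  have hX' := lieAlg_real_smul hX t
  have hXG := lieL_le hX
  have hθ := lieAlg_real_smul (C.dθ_mem_L hX) t
  have hr : ∀ {Z : Mat n}, Z ∈ lieAlg D.G → C.dθ (t • Z) = t • C.dθ Z := fun hZ => by
    simpa using C.dθ_smul hZ (t : ℂ)
  have hs : ∀ {Z : Mat n}, Z ∈ lieAlg D.L → D.dσ (t • Z) = t • D.dσ Z := fun hZ => by
    simpa using HorosymmetricSpace.dσ_smul hZ (t : ℂ)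
  have hin : ∀ {Z : Mat n}, Z ∈ lieAlg D.L →
      Subgroup.inclusion D.L_le_G (expIn D.L Z) = expIn D.G Z := fun hZ =>
    Subtype.ext (by simp [expIn_val hZ, expIn_val (lieL_le hZ)])
  have h1 := C.θ_comm (expIn D.L (t • X)) (expIn D.L (t • C.dθ X)) (by
    rw [hin hX', C.θ_exp (lieL_le hX'), hr hXG, expIn_val hθ, expIn_val (lieL_le hθ)])
  rw [HorosymmetricSpace.σ_exp hθ, HorosymmetricSpace.σ_exp hX', hs (C.dθ_mem_L hX), hs hX,
    hin (lieAlg_real_smul (HorosymmetricSpace.dσ_mem hX) t),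
    C.θ_exp (lieL_le (lieAlg_real_smul (HorosymmetricSpace.dσ_mem hX) t)),
    hr (lieL_le (HorosymmetricSpace.dσ_mem hX)),
    expIn_val (lieAlg_real_smul (HorosymmetricSpace.dσ_mem (C.dθ_mem_L hX)) t),
    expIn_val (lieAlg_real_smul (C.dθ_mem (lieL_le (HorosymmetricSpace.dσ_mem hX))) t)] at h1
  exact congrArg Units.val h1

theorem mem_lieK (hX : X ∈ lieAlg D.G) (h : C.dθ X = X) : X ∈ C.lieK := by
  refine ⟨hX, fun t => ?_⟩
  change C.θ _ = _
  have : C.dθ (t • X) = t • X := by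
    have := C.dθ_smul hX (t : ℂ)
    simpa [h] using this
  rw [C.θ_exp (lieAlg_real_smul hX t), this]
  rfl

theorem dθ_of_mem_lieK (h : X ∈ C.lieK) : C.dθ X = X := by
  refine exp_smul_injective fun t => ?_
  have h1 : C.θ (expIn D.G (t • X)) = expIn D.G (t • X) := h.2 t
  have h2 : C.dθ (t • X) = t • C.dθ X := by simpa using C.dθ_smul h.1 (t : ℂ)
  rw [C.θ_exp (lieAlg_real_smul h.1 t), h2] at h1
  have h3 := congrArg Subtype.val h1
  rw [expIn_val (lieAlg_real_smul h.1 t), expIn_val (lieAlg_real_smul (C.dθ_mem h.1) t)] at h3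
  exact congrArg Units.val h3

/-- Multiplication by i moves X into 𝔨, whose one-parameter groups stay in the compact group K. -/
theorem isSemisimpleMat_of_dθ_neg (hX : X ∈ lieAlg D.G) (h : C.dθ X = -X) :
    IsSemisimpleMat X := by
  have hY : Complex.I • X ∈ C.lieK := C.mem_lieK (lieAlg_smul hX _) (by
    rw [C.dθ_smul hX, h]; simp)
  have hs : IsSemisimpleMat (Complex.I • X) := by
    refine isSemisimpleMat_of_isCompact
      (s := (fun g : D.G => ((g : GLn n) : Mat n)) '' {g : D.G | C.θ g = g}) ?_ fun t => ?_
    · exact C.θ_compact.image (Units.continuous_val.comp continuous_subtype_val)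
    · refine ⟨expIn D.G (t • Complex.I • X), hY.2 t, ?_⟩
      simp only
      rw [expIn_val (lieAlg_real_smul hY.1 t), expGL_val, Complex.coe_smul]
  have := hs.smul (c := -Complex.I) (by simp)
  simpa [smul_smul] using this

/-- An element of `𝔩 ∩ i𝔨` on which `σ` acts as `-1` and which commutes with `T_s` lies in
`𝔱_s`. -/
theorem mem_lieAlg_Ts_of_neg (hX : X ∈ lieAlg D.L) (hθ : C.dθ X = -X) (hσ : D.dσ X = -X)
    (hcomm : ∀ t ∈ C.Ts, Commute (t : Mat n) X) : X ∈ lieAlg C.Ts := by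
  refine C.mem_lieAlg_Ts hX (C.isSemisimpleMat_of_dθ_neg (lieL_le hX) hθ) (fun z => ?_) hcomm
  rw [HorosymmetricSpace.σ_exp (lieAlg_smul hX z), HorosymmetricSpace.dσ_smul hX, hσ, smul_neg,
    expIn_neg (lieAlg_smul hX z)]

theorem mem_aS (hX : X ∈ lieAlg C.Ts) (hXG : X ∈ lieAlg D.G) (hθ : C.dθ X = -X) : X ∈ C.aS := by
  refine ⟨hX, -Complex.I • X, C.mem_lieK (lieAlg_smul hXG _) ?_, by simp [smul_smul]⟩
  rw [C.dθ_smul hXG, hθ]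
  simp

end CartanData

/-! ### The adjoint action -/

/-- Conjugation by `g`. -/
def Ad (g : GLn n) : Mat n →ₗ[ℂ] Mat n where
  toFun X := (g : Mat n) * X * ((g⁻¹ : GLn n) : Mat n)
  map_add' X Y := by rw [mul_add, add_mul]
  map_smul' c X := by simp

theorem Ad_apply (g : GLn n) (X : Mat n) : Ad g X = (g : Mat n) * X * ((g⁻¹ : GLn n) : Mat n) := rfl

theorem Ad_mul_apply (g : GLn n) (X Y : Mat n) : Ad g (X * Y) = Ad g X * Ad g Y := by
  simp only [Ad_apply, mul_assoc]
  rw [← mul_assoc ((g⁻¹ : GLn n) : Mat n) (g : Mat n), Units.inv_mul, one_mul]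

theorem Ad_lie (g : GLn n) (X Y : Mat n) : Ad g ⁅X, Y⁆ = ⁅Ad g X, Ad g Y⁆ := by
  simp only [Ring.lie_def, map_sub, Ad_mul_apply]

theorem Ad_Ad (g h : GLn n) (X : Mat n) : Ad g (Ad h X) = Ad (g * h) X := by
  simp only [Ad_apply, mul_inv_rev, Units.val_mul, mul_assoc]

@[simp] theorem Ad_one (X : Mat n) : Ad (1 : GLn n) X = X := by simp [Ad_apply]

theorem Ad_eq_self_iff {g : GLn n} {X : Mat n} : Ad g X = X ↔ Commute (g : Mat n) X := by
  rw [Ad_apply, Units.mul_inv_eq_iff_eq_mul]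
  exact Iff.rfl

-- The hypothesis says X(Y + c) = YX. Exponentiating this semiconjugation gives e^c X exp(Y) =
-- exp(Y) X.
open scoped Matrix.Norms.Operator in
theorem Ad_exp {X Y : Mat n} {c : ℂ} (h : ⁅Y, X⁆ = c • X) :
    Ad (expGL Y) X = Complex.exp c • X := by
  have hs : SemiconjBy X (Y + c • 1) Y := by
    rw [SemiconjBy, mul_add, mul_smul_comm, mul_one, ← h, Ring.lie_def]
    abel
  have h2 : exp (Y + c • (1 : Mat n)) = Complex.exp c • exp Y := by
    rw [Matrix.exp_add_of_commute _ _ ((Commute.one_right Y).smul_right c)]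
    have : exp (c • (1 : Mat n)) = Complex.exp c • 1 := by
      have h3 : c • (1 : Mat n) = Matrix.diagonal fun _ => c := by
        rw [← Matrix.diagonal_one, ← Matrix.diagonal_smul]; congr 1; ext; simp
      rw [h3, Matrix.exp_diagonal, ← Matrix.diagonal_one, ← Matrix.diagonal_smul]
      congr 1
      ext i
      simp [Complex.exp_eq_exp_ℂ, Pi.coe_exp]
    rw [this, mul_smul_comm, mul_one]
  have h1 : Complex.exp c • (X * exp Y) = exp Y * X := by
    rw [← mul_smul_comm, ← h2]
    exact hs.exp_right.eq
  rw [Ad_apply, expGL_val, ← h1, smul_mul_assoc, mul_assoc, ← expGL_val Y, Units.mul_inv, mul_one]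

/-- If the line through `X` is stable under `exp(tY)`, then `X` is an eigenvector of `ad Y`. -/
theorem exists_lie_eq_smul {X Y : Mat n} (h : ∀ t : ℝ, ∃ c : ℂ, Ad (expGL (t • Y)) X = c • X) :
    ∃ c : ℂ, ⁅Y, X⁆ = c • X := by
  have := hasDerivAt_mem (V := (Submodule.span ℂ {X}).restrictScalars ℝ)
    (hasDerivAt_conj_exp Y X) fun t => by
      obtain ⟨c, hc⟩ := h t
      rw [Ad_apply, expGL_inv_val, expGL_val] at hc
      rw [hc]
      exact Submodule.smul_mem _ _ (Submodule.mem_span_singleton_self X)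
  obtain ⟨c, hc⟩ := Submodule.mem_span_singleton.1 this
  exact ⟨c, hc.symm⟩

/-! ### Nilpotency -/

theorem isNilpotent_of_spectrum {X : Mat n} (h : ∀ μ ∈ spectrum ℂ X, μ = 0) : IsNilpotent X := by
  have h1 := (IsAlgClosed.splits X.charpoly).eq_prod_roots_of_monic X.charpoly_monic
  have h2 : X.charpoly.roots = Multiset.replicate (Multiset.card X.charpoly.roots) 0 := by
    refine Multiset.eq_replicate_card.2 fun μ hμ => h μ ?_
    rw [Matrix.mem_spectrum_iff_isRoot_charpoly]
    exact Polynomial.isRoot_of_mem_roots hμ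
  rw [h2] at h1
  simp only [Multiset.map_replicate, map_zero, sub_zero, Multiset.prod_replicate] at h1
  refine ⟨Multiset.card X.charpoly.roots, ?_⟩
  have := Matrix.aeval_self_charpoly X
  rw [h1] at this
  simpa using this

/-- A matrix that is conjugate to infinitely many of its multiples is nilpotent. -/
theorem isNilpotent_of_infinite {X : Mat n} (h : {c : ℂ | ∃ g : GLn n, Ad g X = c • X}.Infinite) :
    IsNilpotent X := by
  refine isNilpotent_of_spectrum fun μ hμ => ?_
  by_contra hμ0
  -- The spectrum is finite and conjugation invariant, so cμ is an eigenvalue for each admissible c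
  -- ≠ 0. The value c = 0 is inserted by hand because scaling the spectrum needs a unit.
  refine h (Set.Finite.subset (((Matrix.finite_spectrum X).preimage
    (mul_left_injective₀ hμ0).injOn).insert 0) ?_)
  rintro c ⟨g, hg⟩
  by_cases hc : c = 0
  · exact Or.inl hc
  · refine Or.inr ?_
    have h1 : spectrum ℂ (Ad g X) = spectrum ℂ X := spectrum.units_conjugate
    rw [Set.mem_preimage, ← h1, hg]
    have := spectrum.unit_smul_eq_smul (R := ℂ) X (Units.mk0 c hc)
    have e : (Units.mk0 c hc) • X = c • X := rfl
    rw [e] at this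
    rw [this]
    exact ⟨μ, hμ, rfl⟩

/-! ### One-parameter subgroups -/

/-- `exp z` as a unit. -/
def expU (z : ℂ) : ℂˣ := Units.mk0 (Complex.exp z) (Complex.exp_ne_zero z)

theorem exists_eq_expU (s : ℂˣ) : ∃ z, s = expU z :=
  ⟨Complex.log s, Units.ext (Complex.exp_log s.ne_zero).symm⟩

theorem expU_add (z w : ℂ) : expU (z + w) = expU z * expU w := Units.ext (Complex.exp_add z w)

/-- The curve z ↦ `lam (expU z)` is differentiable since its entries are Laurent polynomials in exp
z, hence it is a one-parameter group. Its generator is semisimple because the unit circle has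
compact image. -/
theorem IsAlgebraicOneParam.exists_generator {lam : ℂˣ →* GLn n} (h : IsAlgebraicOneParam lam) :
    ∃ Y : Mat n, IsSemisimpleMat Y ∧ ∀ z : ℂ, lam (expU z) = expGL (z • Y) := by
  choose p k hpk using h
  have hval : ∀ (s : ℂˣ) i j, (lam s : Mat n) i j = (p i j).eval (s : ℂ) * ((s : ℂ) ^ k i j)⁻¹ := by
    intro s i j
    have : (s : ℂ) ^ k i j ≠ 0 := pow_ne_zero _ s.ne_zero
    rw [← hpk i j s]
    field_simp
  have hdiff : ∀ i j, DifferentiableAt ℂ (fun z => (lam (expU z) : Mat n) i j) 0 := by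
    intro i j
    have e : (fun z => (lam (expU z) : Mat n) i j)
        = fun z => (p i j).eval (Complex.exp z) * (Complex.exp z ^ k i j)⁻¹ := by
      funext z
      exact hval (expU z) i j
    rw [e]
    refine DifferentiableAt.mul ?_ (DifferentiableAt.inv ?_ ?_)
    · exact (p i j).differentiable.differentiableAt.comp 0
        Complex.differentiable_exp.differentiableAt
    · exact Complex.differentiable_exp.differentiableAt.pow _
    · exact pow_ne_zero _ (Complex.exp_ne_zero _)
  let Y : Mat n := Matrix.of fun i j => deriv (fun z => (lam (expU z) : Mat n) i j) 0
  have hexp : ∀ z : ℂ, lam (expU z) = expGL (z • Y) := by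
    intro z
    have hd : HasDerivAt (fun s : ℝ => (lam (expU (s * z)) : Mat n)) (z • Y) 0 := by
      rw [hasDerivAt_mat_iff]
      intro i j
      have h1 : HasDerivAt (fun s : ℝ => (s : ℂ) * z) z 0 := by
        simpa using (Complex.ofRealCLM.hasDerivAt (x := (0 : ℝ))).mul_const z
      have h2 := (hdiff i j).hasDerivAt
      have h3 : HasDerivAt (fun z => (lam (expU z) : Mat n) i j) (Y i j) (((0 : ℝ) : ℂ) * z) := by
        simpa [Y] using h2
      exact (h3.comp (0 : ℝ) h1).congr_deriv (mul_comm _ _)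
    have := eq_exp_of_hasDerivAt (f := fun s : ℝ => (lam (expU (s * z)) : Mat n)) (by
      have : expU 0 = 1 := Units.ext Complex.exp_zero
      simp [this]) (fun s t => by
      rw [← Units.val_mul, ← map_mul, ← expU_add]
      push_cast
      rw [add_mul]) hd 1
    refine Units.ext ?_
    simpa using this
  refine ⟨Y, ?_, hexp⟩
  have hs : IsSemisimpleMat (Complex.I • Y) := by
    -- On the unit circle 1/u is the conjugate of u, so there the Laurent polynomials agree with
    -- this function, which is continuous on all of ℂ.
    let F : ℂ → Mat n := fun u => Matrix.of fun i j =>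
      (p i j).eval u * ((starRingEnd ℂ) u) ^ k i j
    have hF : Continuous F := by
      refine continuous_matrix fun i j => ?_
      exact (p i j).continuous.mul (Complex.continuous_conj.pow _)
    refine isSemisimpleMat_of_isCompact (s := F '' Metric.sphere 0 1)
      ((isCompact_sphere 0 1).image hF) fun t => ⟨Complex.exp (t * Complex.I), ?_, ?_⟩
    · simp [Complex.norm_exp_ofReal_mul_I]
    · rw [smul_smul, ← expGL_val, ← hexp]
      ext i j
      rw [hval]
      simp only [F, Matrix.of_apply]
      congr 1
      change _ = (Complex.exp _ ^ _)⁻¹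
      rw [← inv_pow, ← Complex.exp_neg, ← Complex.exp_conj]
      simp
  have := hs.smul (c := -Complex.I) (by simp)
  simpa [smul_smul] using this

namespace CartanData

variable {D : HorosymmetricSpace n} (C : CartanData D)

/-- The generator of `lam` is semisimple, lies in 𝔩 and commutes with T; maximality of T puts it in
𝔱. The λ-weights of root spaces are defined thanks to this. -/
theorem lam_mem_T (s : ℂˣ) : D.lam s ∈ C.T := by
  obtain ⟨Y, hY, hexp⟩ := D.lam_algebraic.exists_generator
  have hYL : Y ∈ lieAlg D.L := fun z => by
    rw [← hexp]
    refine ⟨D.lam_mem _, Subgroup.mem_centralizer_iff.2 ?_⟩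
    rintro _ ⟨s, rfl⟩
    rw [← map_mul, ← map_mul, mul_comm]
  have hYT : Y ∈ lieAlg C.T := by
    refine C.mem_lieAlg_T hYL hY fun t ht => commute_exp_iff.1 fun z => ?_
    have := Subgroup.mem_centralizer_iff.1 (C.T_le_L ht).2 (D.lam (expU z)) ⟨_, rfl⟩
    rw [hexp] at this
    exact (congrArg Units.val this).symm
  obtain ⟨z, rfl⟩ := exists_eq_expU s
  rw [hexp]
  exact hYT z

/-! ### Root spaces -/

variable {C} {α β γ : C.Chars} {X Y : Mat n}

theorem T_le_G (C : CartanData D) : C.T ≤ D.G := C.T_le_L.trans D.L_le_G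

theorem rootSpace_Ad (hX : X ∈ C.rootSpace α) (t : C.T) : Ad (t : GLn n) X = (α t : ℂ) • X := hX.2 t

theorem mem_rootSpace_iff : X ∈ C.rootSpace α ↔
    X ∈ lieAlg D.G ∧ ∀ t : C.T, Ad (t : GLn n) X = (α t : ℂ) • X := Iff.rfl

theorem rootSpace_smul (hX : X ∈ C.rootSpace α) (c : ℂ) : c • X ∈ C.rootSpace α :=
  mem_rootSpace_iff.2 ⟨lieAlg_smul hX.1 c, fun t => by
    rw [map_smul, rootSpace_Ad hX, smul_comm]⟩

theorem rootSpace_add (hX : X ∈ C.rootSpace α) (hY : Y ∈ C.rootSpace α) :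
    X + Y ∈ C.rootSpace α :=
  mem_rootSpace_iff.2 ⟨lieAlg_add D.G_algebraic hX.1 hY.1, fun t => by
    rw [map_add, rootSpace_Ad hX, rootSpace_Ad hY, smul_add]⟩

theorem rootSpace_neg (hX : X ∈ C.rootSpace α) : -X ∈ C.rootSpace α := by
  simpa using rootSpace_smul hX (-1)

theorem rootSpace_sub (hX : X ∈ C.rootSpace α) (hY : Y ∈ C.rootSpace α) :
    X - Y ∈ C.rootSpace α := by
  rw [sub_eq_add_neg]
  exact rootSpace_add hX (rootSpace_neg hY)

theorem rootSpace_lie (hX : X ∈ C.rootSpace α) (hY : Y ∈ C.rootSpace β) :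
    ⁅X, Y⁆ ∈ C.rootSpace (α * β) :=
  mem_rootSpace_iff.2 ⟨lieAlg_lie D.G_algebraic hX.1 hY.1, fun t => by
    rw [Ad_lie, rootSpace_Ad hX, rootSpace_Ad hY, MonoidHom.mul_apply, Units.val_mul]
    simp only [Ring.lie_def, smul_mul_smul_comm, smul_sub, mul_comm]⟩

theorem rootSpace_unique (hX : X ∈ C.rootSpace α) (hX' : X ∈ C.rootSpace β) (h0 : X ≠ 0) :
    α = β := by
  ext t
  have := (rootSpace_Ad hX t).symm.trans (rootSpace_Ad hX' t)
  exact smul_left_injective ℂ h0 this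

theorem dσ_rootSpace (hX : X ∈ C.rootSpace α) (hL : X ∈ lieAlg D.L) :
    D.dσ X ∈ C.rootSpace (C.σChar α) := by
  refine mem_rootSpace_iff.2 ⟨lieL_le (HorosymmetricSpace.dσ_mem hL), fun t => ?_⟩
  have h1 := HorosymmetricSpace.dσ_conj hL (D.σ (Subgroup.inclusion C.T_le_L t))
  rw [D.σ_involutive] at h1
  have h2 : Ad ((C.σT t : C.T) : GLn n) X = (α (C.σT t) : ℂ) • X := rootSpace_Ad hX _
  have h3 : D.dσ (Ad ((C.σT t : C.T) : GLn n) X) = Ad (t : GLn n) (D.dσ X) := h1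
  rw [← h3, h2, HorosymmetricSpace.dσ_smul hL]
  rfl

/-- The character found is the complex conjugate of α∘θ. That it is the inverse of α is extracted
later from the normalization of the root vectors. -/
theorem dθ_rootSpace_aux (C : CartanData D) (α : C.Chars) : ∃ β : C.Chars,
    ∀ X ∈ C.rootSpace α, C.dθ X ∈ C.rootSpace β := by
  let θT : C.T →* C.T :=
    { toFun := fun t => ⟨C.θ (Subgroup.inclusion C.T_le_G t), C.θ_T _ t.2⟩
      map_one' := by ext1; simp
      map_mul' := fun _ _ => by ext1; simp }
  refine ⟨(Units.map (starRingEnd ℂ).toMonoidHom).comp (α.comp θT), fun X hX =>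
    mem_rootSpace_iff.2 ⟨C.dθ_mem hX.1, fun t => ?_⟩⟩
  have h1 := C.dθ_conj hX.1 (C.θ (Subgroup.inclusion C.T_le_G t))
  rw [C.θ_involutive] at h1
  have h2 : Ad ((θT t : C.T) : GLn n) X = (α (θT t) : ℂ) • X := rootSpace_Ad hX _
  have h3 : C.dθ (Ad ((θT t : C.T) : GLn n) X) = Ad (t : GLn n) (C.dθ X) := h1
  rw [← h3, h2, C.dθ_smul hX.1]
  rfl

/-- If a character takes finitely many values on a connected group, it is trivial there. -/
theorem eq_one_of_finite (hX : X ∈ C.rootSpace γ) (h0 : X ≠ 0) {M : Subgroup (GLn n)}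
    (hM : M ≤ C.T) (hMa : IsAlgebraic M) (hMc : IsConnectedAlg M)
    (hfin : {c : ℂˣ | ∃ t : M, γ (Subgroup.inclusion hM t) = c}.Finite) (t : M) :
    γ (Subgroup.inclusion hM t) = 1 := by
  -- The characters are abstract homomorphisms, not assumed regular. The closed subgroup needed for
  -- connectedness is therefore the stabilizer of the weight vector X, which cuts out the kernel of
  -- γ in M.
  let S : Subgroup (GLn n) :=
    { carrier := {g | Ad g X = X}
      one_mem' := Ad_one X
      mul_mem' := fun {g h} hg hh => by
        have hg' : Ad g X = X := hg
        have hh' : Ad h X = X := hh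
        change Ad (g * h) X = X
        rw [← Ad_Ad, hh', hg']
      inv_mem' := fun {g} hg => by
        have hg' : Ad g X = X := hg
        change Ad g⁻¹ X = X
        nth_rw 1 [← hg']
        rw [Ad_Ad, inv_mul_cancel, Ad_one] }
  have hmemS : ∀ g, g ∈ S ↔ Ad g X = X := fun g => Iff.rfl
  have hS : IsAlgebraic S := by
    refine IsAlgebraic.of_regFun (f := fun (ij : Fin n × Fin n) (g : GLn n) =>
      ((g : Mat n) * X * ((g⁻¹ : GLn n) : Mat n)) ij.1 ij.2 - X ij.1 ij.2) (fun ij => ?_)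
      fun g => ?_
    · refine RegFun.sub ?_ (RegFun.const _)
      exact RegFun.mul_entry (f₁ := fun g : GLn n => (g : Mat n) * X)
        (f₂ := fun g : GLn n => ((g⁻¹ : GLn n) : Mat n))
        (RegFun.mul_entry (f₁ := fun g : GLn n => (g : Mat n)) (f₂ := fun _ => X) RegFun.entry
          fun _ _ => RegFun.const _) RegFun.inv_entry _ _
    · rw [hmemS]
      constructor
      · intro h ij
        rw [Ad_apply] at h
        rw [h, sub_self]
      · intro h
        ext i j
        exact sub_eq_zero.1 (h (i, j))
  let φ : M →* ℂˣ := γ.comp (Subgroup.inclusion hM)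
  have hker : S.subgroupOf M = φ.ker := by
    ext t
    rw [Subgroup.mem_subgroupOf, MonoidHom.mem_ker, hmemS]
    have h1 : Ad (t : GLn n) X = (φ t : ℂ) • X := rootSpace_Ad hX (Subgroup.inclusion hM t)
    rw [h1]
    constructor
    · intro h
      refine Units.ext (smul_left_injective ℂ h0 ?_)
      simpa using h
    · intro h
      rw [h]; simp
  have hidx : S.relIndex M ≠ 0 := by
    rw [Subgroup.relIndex, hker, Subgroup.index_ker]
    have : Finite φ.range := hfin
    exact Nat.card_pos.ne'
  have hle := hMc.le_of_relIndex hMa hS hidx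
  have : t ∈ φ.ker := by
    rw [← hker]
    exact hle t.2
  exact this

/-- A character of order two takes only the values 1 and -1, so it is trivial on the connected group
T. -/
theorem root_sq_ne_one (h : γ ∈ C.roots) : γ * γ ≠ 1 := by
  intro h2
  obtain ⟨h1, X, hX, h0⟩ := h
  refine h1 (MonoidHom.ext fun t => ?_)
  refine eq_one_of_finite hX h0 le_rfl C.T_torus.isAlgebraic C.T_torus.connected ?_ t
  refine Set.Finite.subset (Set.toFinite {1, -1}) ?_
  rintro c ⟨t, rfl⟩
  have h3 := DFunLike.congr_fun h2 t
  have h4 : ((γ t : ℂˣ) : ℂ) * (γ t : ℂˣ) = 1 := by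
    rw [← Units.val_mul]; exact congrArg Units.val h3
  rcases mul_self_eq_one_iff.1 h4 with h5 | h5
  · left; exact Units.ext h5
  · right; exact Units.ext h5

/-- Conjugation by T multiplies X by all values of γ. There are infinitely many of them, since
otherwise γ would be trivial. -/
theorem root_isNilpotent (h : γ ∈ C.roots) (hX : X ∈ C.rootSpace γ) : IsNilpotent X := by
  obtain ⟨h1, X', hX', h0⟩ := h
  refine isNilpotent_of_infinite fun hfin => h1 (MonoidHom.ext fun t => ?_)
  refine eq_one_of_finite hX' h0 le_rfl C.T_torus.isAlgebraic C.T_torus.connected ?_ t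
  refine Set.Finite.of_finite_image (f := fun u : ℂˣ => (u : ℂ)) (hfin.subset ?_)
    Units.val_injective.injOn
  rintro _ ⟨_, ⟨t, rfl⟩, rfl⟩
  exact ⟨(t : GLn n), rootSpace_Ad hX t⟩

theorem ev_eq_of {x : Mat n} {c : ℂ}
    (h : ∀ t : ℝ, (γ (expIn C.T (t • x)) : ℂ) = Complex.exp (t * c)) : C.ev γ x = c := by
  have h3 : HasDerivAt (fun t : ℝ => Complex.exp (t * c)) c 0 := by
    have h4 : HasDerivAt (fun t : ℝ => (t : ℂ) * c) c 0 := by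
      simpa using (Complex.ofRealCLM.hasDerivAt (x := (0 : ℝ))).mul_const c
    simpa using h4.cexp
  rw [ev, dChar]
  simp only [h]
  exact h3.deriv

/-- A nonzero vector of weight γ is what makes the abstract character γ differentiable along 𝔱: the
line it spans is stable under exp(tx), so it is an eigenline of ad x. -/
theorem lie_eq_ev_smul {x : Mat n} (hx : x ∈ lieAlg C.T) (hX : X ∈ C.rootSpace γ)
    (h0 : X ≠ 0) : ⁅x, X⁆ = C.ev γ x • X ∧
      ∀ t : ℝ, (γ (expIn C.T (t • x)) : ℂ) = Complex.exp (t * C.ev γ x) := by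
  have hAd : ∀ t : ℝ, Ad (expGL (t • x)) X = (γ (expIn C.T (t • x)) : ℂ) • X := fun t => by
    rw [← rootSpace_Ad hX, expIn_val (lieAlg_real_smul hx t)]
  obtain ⟨c, hc⟩ := exists_lie_eq_smul fun t => ⟨_, hAd t⟩
  have h2 : ∀ t : ℝ, (γ (expIn C.T (t • x)) : ℂ) = Complex.exp (t * c) := by
    intro t
    have h3 : ⁅t • x, X⁆ = ((t : ℂ) * c) • X := by
      rw [← smul_smul, ← hc, Complex.coe_smul]
      simp [Ring.lie_def, smul_sub]
    exact smul_left_injective ℂ h0 ((hAd t).symm.trans (Ad_exp h3))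
  rw [ev_eq_of h2]
  exact ⟨hc, h2⟩

theorem lie_rootSpace {x : Mat n} (hx : x ∈ lieAlg C.T) (hX : X ∈ C.rootSpace γ) :
    ⁅x, X⁆ = C.ev γ x • X := by
  by_cases h0 : X = 0
  · rw [h0, smul_zero, Ring.lie_def, mul_zero, zero_mul, sub_zero]
  · exact (lie_eq_ev_smul hx hX h0).1

theorem root_exp {x : Mat n} (hx : x ∈ lieAlg C.T) (hγ : γ ∈ C.roots) (t : ℝ) :
    (γ (expIn C.T (t • x)) : ℂ) = Complex.exp (t * C.ev γ x) := by
  obtain ⟨-, X, hX, h0⟩ := hγ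
  exact (lie_eq_ev_smul hx hX h0).2 t

theorem ev_inv {x : Mat n} (hx : x ∈ lieAlg C.T) (hγ : γ ∈ C.roots) :
    C.ev γ⁻¹ x = -C.ev γ x := by
  refine ev_eq_of fun t => ?_
  rw [MonoidHom.inv_apply, Units.val_inv_eq_inv_val, root_exp hx hγ, mul_neg, Complex.exp_neg]

theorem ev_mul {x : Mat n} (hx : x ∈ lieAlg C.T) (hα : α ∈ C.roots) (hβ : β ∈ C.roots) :
    C.ev (α * β) x = C.ev α x + C.ev β x := by
  refine ev_eq_of fun t => ?_
  rw [MonoidHom.mul_apply, Units.val_mul, root_exp hx hα, root_exp hx hβ, ← Complex.exp_add,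
    mul_add]

/-! ### The grading defined by `λ` -/

theorem exists_weight (hX : X ∈ C.rootSpace γ) (h0 : X ≠ 0) :
    ∃ k : ℤ, ∀ s : ℂˣ, γ ⟨D.lam s, C.lam_mem_T s⟩ = s ^ k := by
  obtain ⟨Y, hY, hexp⟩ := D.lam_algebraic.exists_generator
  have hYT : Y ∈ lieAlg C.T := fun z => by rw [← hexp]; exact C.lam_mem_T _
  obtain ⟨hc, -⟩ := lie_eq_ev_smul hYT hX h0
  set c := C.ev γ Y
  have h1 : ∀ z : ℂ, (γ ⟨D.lam (expU z), C.lam_mem_T _⟩ : ℂ) = Complex.exp (z * c) := by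
    intro z
    have h3 : ⁅z • Y, X⁆ = (z * c) • X := by
      rw [← smul_smul, ← hc]; simp [Ring.lie_def, smul_sub]
    have h4 := Ad_exp h3
    rw [← hexp] at h4
    exact smul_left_injective ℂ h0 ((rootSpace_Ad hX ⟨D.lam (expU z), C.lam_mem_T _⟩).symm.trans h4)
  -- `lam` is a homomorphism on ℂˣ, so z = 2πi acts trivially and the weight is an integer.
  have h2 : Complex.exp (2 * Real.pi * Complex.I * c) = 1 := by
    rw [← h1]
    have e : expU (2 * Real.pi * Complex.I) = 1 := Units.ext Complex.exp_two_pi_mul_I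
    simp only [e, map_one]
    have : (⟨1, C.T.one_mem⟩ : C.T) = 1 := rfl
    simp [this]
  obtain ⟨k, hk⟩ := Complex.exp_eq_one_iff.1 h2
  have hck : c = k := by
    have : (2 * Real.pi * Complex.I : ℂ) ≠ 0 := Complex.two_pi_I_ne_zero
    rw [mul_comm (k : ℂ)] at hk
    exact mul_left_cancel₀ this hk
  refine ⟨k, fun s => ?_⟩
  obtain ⟨z, rfl⟩ := exists_eq_expU s
  refine Units.ext ?_
  rw [h1, hck, Units.val_zpow_eq_zpow_val, mul_comm, Complex.exp_int_mul]
  rfl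

theorem mem_lieL_of_fixed (hX : X ∈ lieAlg D.G) (h : ∀ s, Ad (D.lam s) X = X) : X ∈ lieAlg D.L :=
  mem_lieAlg_levi.2 ⟨hX, fun s => Ad_eq_self_iff.1 (h s)⟩

theorem Ad_lam_of_mem_lieL (hX : X ∈ lieAlg D.L) (s : ℂˣ) : Ad (D.lam s) X = X :=
  Ad_eq_self_iff.2 ((mem_lieAlg_levi.1 hX).2 s)

/-- Conjugation by λ(s) scales X by a positive power of s, so the conjugates of exp(zX) tend to 1 as
s → 0. -/
theorem mem_liePu_of_pos (hX : X ∈ lieAlg D.G) {k : ℤ} (hk : 0 < k)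
    (h : ∀ s : ℂˣ, Ad (D.lam s) X = ((s ^ k : ℂˣ) : ℂ) • X) : X ∈ lieAlg D.Pu := by
  intro z
  refine ⟨hX z, ?_⟩
  obtain ⟨m, rfl⟩ := Int.eq_ofNat_of_zero_le hk.le
  have e : (fun s : ℂˣ => D.lam s * expGL (z • X) * (D.lam s)⁻¹)
      = fun s : ℂˣ => expGL (((s : ℂ) ^ m) • z • X) := by
    funext s
    rw [← expGL_conj]
    congr 1
    have := h s
    rw [Ad_apply] at this
    rw [mul_smul_comm, smul_mul_assoc, this, smul_comm]
    simp
  rw [e]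
  have h1 : Tendsto (fun s : ℂˣ => (s : ℂ)) toZero (𝓝 0) := tendsto_comap
  have hm : m ≠ 0 := by rintro rfl; simp at hk
  have hc : Continuous fun c : ℂ => expGL ((c ^ m) • z • X) :=
    continuous_expGL.comp ((continuous_id.pow m).smul continuous_const)
  have h0 : expGL (((0 : ℂ) ^ m) • z • X) = 1 := by simp [hm]
  rw [← h0]
  exact (hc.tendsto 0).comp h1

/-- Conjugating by λ at the powers of 2 shows X conjugate to infinitely many of its multiples. -/
theorem isNilpotent_of_pos {k : ℤ} (hk : 0 < k)
    (h : ∀ s : ℂˣ, Ad (D.lam s) X = ((s ^ k : ℂˣ) : ℂ) • X) : IsNilpotent X := by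
  refine isNilpotent_of_infinite ?_
  have hinj : Function.Injective fun j : ℕ => ((((2 : ℂ) ^ j) ^ k : ℂ)) := by
    intro i j hij
    have : ((2 : ℂ) ^ ((i : ℤ) * k)) = (2 : ℂ) ^ ((j : ℤ) * k) := by
      simpa [zpow_mul] using hij
    have h3 := congrArg (fun c : ℂ => ‖c‖) this
    simp only [norm_zpow, Complex.norm_ofNat] at h3
    have h4 := zpow_right_injective₀ (a := (2 : ℝ)) (by norm_num) (by norm_num) h3
    have := mul_right_cancel₀ hk.ne' h4
    exact_mod_cast this
  refine (Set.infinite_range_of_injective hinj).mono ?_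
  rintro _ ⟨j, rfl⟩
  refine ⟨D.lam (Units.mk0 ((2 : ℂ) ^ j) (pow_ne_zero _ two_ne_zero)), ?_⟩
  rw [h]
  simp

/-- Lying in 𝔩 means being fixed by λ, which depends on γ∘λ alone. -/
theorem rootSpace_subset_lieL (hX : X ∈ C.rootSpace γ) (h0 : X ≠ 0) (hL : X ∈ lieAlg D.L) :
    C.rootSpace γ ⊆ lieAlg D.L := by
  intro Y hY
  refine mem_lieL_of_fixed hY.1 fun s => ?_
  have h1 := rootSpace_Ad hX ⟨D.lam s, C.lam_mem_T s⟩
  rw [Ad_lam_of_mem_lieL hL s] at h1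
  have h2 := rootSpace_Ad hY ⟨D.lam s, C.lam_mem_T s⟩
  have h3 : (γ ⟨D.lam s, C.lam_mem_T s⟩ : ℂ) = 1 :=
    smul_left_injective ℂ h0 (by simpa using h1.symm)
  rw [h3, one_smul] at h2
  exact h2

theorem mem_rootsL (hX : X ∈ C.rootSpace γ) (h0 : X ≠ 0) (hL : X ∈ lieAlg D.L) (hγ : γ ≠ 1) :
    γ ∈ C.rootsL := ⟨⟨hγ, X, hX, h0⟩, rootSpace_subset_lieL hX h0 hL⟩

end CartanData

/-! ### Elements of 𝔞_s -/

open HorosymmetricSpace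

namespace CartanData

variable {D : HorosymmetricSpace n} {C : CartanData D} {x y : Mat n}

theorem aS_mem_T (hx : x ∈ C.aS) : x ∈ lieAlg C.T := lieAlg_mono C.Ts_le_T hx.1

theorem aS_mem_L (hx : x ∈ C.aS) : x ∈ lieAlg D.L := lieAlg_mono C.T_le_L (aS_mem_T hx)

theorem aS_mem_G (hx : x ∈ C.aS) : x ∈ lieAlg D.G := lieL_le (aS_mem_L hx)

theorem I_smul_mem_lieK (hx : x ∈ C.aS) : Complex.I • x ∈ C.lieK := by
  obtain ⟨hxT, Y, hY, rfl⟩ := hx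
  refine C.mem_lieK (lieAlg_smul (lieAlg_smul hY.1 _) _) ?_
  rw [smul_smul, C.dθ_smul hY.1, C.dθ_of_mem_lieK hY]
  simp

theorem dθ_aS (hx : x ∈ C.aS) : C.dθ x = -x := by
  obtain ⟨-, Y, hY, rfl⟩ := hx
  rw [C.dθ_smul hY.1, C.dθ_of_mem_lieK hY]
  simp

theorem σT_of_mem_Ts {t : C.T} (ht : (t : GLn n) ∈ C.Ts) : C.σT t = t⁻¹ := by
  refine Subtype.ext ?_
  have := C.Ts_split.2.2 (Subgroup.inclusion C.T_le_L t) ht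
  exact congrArg (fun l : D.L => (l : GLn n)) this

theorem dσ_lieTs (hx : x ∈ lieAlg C.Ts) : D.dσ x = -x := by
  have hxL : x ∈ lieAlg D.L := lieAlg_mono (C.Ts_le_T.trans C.T_le_L) hx
  refine exp_smul_injective fun t => ?_
  have h1 := C.Ts_split.2.2 (expIn D.L (t • x)) (by
    rw [expIn_val (lieAlg_real_smul hxL t)]
    exact expGL_real_mem hx t)
  have h2 : D.dσ (t • x) = t • D.dσ x := by simpa using dσ_smul hxL (t : ℂ)
  rw [σ_exp (lieAlg_real_smul hxL t), h2, ← expIn_neg (lieAlg_real_smul hxL t)] at h1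
  have h3 := congrArg Subtype.val h1
  rw [expIn_val (lieAlg_real_smul (dσ_mem hxL) t),
    expIn_val (lieAlg_neg (lieAlg_real_smul hxL t)), ← smul_neg] at h3
  exact congrArg Units.val h3

theorem dσ_aS (hx : x ∈ C.aS) : D.dσ x = -x := dσ_lieTs hx.1

theorem commute_T_lieT (hx : x ∈ lieAlg C.T) (t : C.T) : Commute ((t : GLn n) : Mat n) x :=
  commute_exp_iff.1 fun z => congrArg Units.val (C.T_comm t ⟨expGL (z • x), hx z⟩)

theorem commute_lieT (hx : x ∈ lieAlg C.T) (hy : y ∈ lieAlg C.T) : Commute x y :=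
  commute_exp_iff.1 fun z => (commute_T_lieT hx ⟨expGL (z • y), hy z⟩).symm

theorem ev_zero (γ : C.Chars) : C.ev γ 0 = 0 := ev_eq_of fun t => by simp

theorem chars_inv_inv (γ : C.Chars) : (γ⁻¹)⁻¹ = γ := by
  ext t
  simp

theorem chars_eq_inv {β γ : C.Chars} (h : β * γ = 1) : β = γ⁻¹ := by
  refine MonoidHom.ext fun t => ?_
  rw [MonoidHom.inv_apply]
  exact eq_inv_of_mul_eq_one_left (DFunLike.congr_fun h t)

theorem chars_inv_ne_one {γ : C.Chars} (h : γ ≠ 1) : γ⁻¹ ≠ 1 := fun h1 => h (by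
  rw [← chars_inv_inv γ, h1]
  ext t
  simp)

end CartanData

/-! ### Roots, coroots and root vectors under σ and θ -/

open CartanData

namespace ReferenceData

variable {D : HorosymmetricSpace n} {C : CartanData D} (R : ReferenceData C)
variable {α β γ : C.Chars} {x X : Mat n}

theorem coroot_ne_zero (hα : α ∈ C.roots) : R.coroot α ≠ 0 := by
  intro h
  have := (R.coroot_spec α hα).2
  rw [h, ev_zero] at this
  norm_num at this

theorem coroot_mem (hα : α ∈ C.roots) : R.coroot α ∈ C.rootSpace 1 := by
  obtain ⟨⟨x, hx, y, hy, h⟩, -⟩ := R.coroot_spec α hα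
  rw [h, ← mul_inv_cancel α]
  exact rootSpace_lie hx hy

/-- If θ maps 𝔤_α into 𝔤_β, then [θ(e_α), e_α] has weight α + β. This bracket is the coroot, which
is nonzero of weight zero, so β = -α. -/
theorem dθ_rootSpace (R : ReferenceData C) (hα : α ∈ C.roots) (hX : X ∈ C.rootSpace α) :
    C.dθ X ∈ C.rootSpace α⁻¹ := by
  obtain ⟨β, hβ⟩ := C.dθ_rootSpace_aux α
  have h1 := rootSpace_lie (hβ _ (R.e_mem α hα)) (R.e_mem α hα)
  rw [R.e_bracket α hα] at h1
  have h2 := rootSpace_unique h1 (R.coroot_mem hα) (R.coroot_ne_zero hα)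
  rw [← chars_eq_inv h2]
  exact hβ _ hX

theorem dθ_ne_zero (hX : X ∈ lieAlg D.G) (h0 : X ≠ 0) : C.dθ X ≠ 0 := by
  intro h
  have := C.dθ_dθ hX
  have h1 : C.dθ (0 : Mat n) = 0 := by simpa using C.dθ_smul (lieAlg_zero D.G) 0
  rw [h, h1] at this
  exact h0 this.symm

theorem inv_mem_roots (R : ReferenceData C) (hα : α ∈ C.roots) : α⁻¹ ∈ C.roots := by
  obtain ⟨h1, X, hX, h0⟩ := id hα
  exact ⟨chars_inv_ne_one h1, C.dθ X, R.dθ_rootSpace hα hX, dθ_ne_zero hX.1 h0⟩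

/-- Apply θ to [x, X] = α(x)X: θ(x) = -x, θ(X) has weight -α, and θ conjugates the scalar. -/
theorem conj_ev (R : ReferenceData C) (hα : α ∈ C.roots) (hx : x ∈ C.aS) :
    (starRingEnd ℂ) (C.ev α x) = C.ev α x := by
  obtain ⟨h1, X, hX, h0⟩ := id hα
  have hxT := aS_mem_T hx
  have h2 := congrArg C.dθ (lie_rootSpace hxT hX)
  rw [C.dθ_lie (aS_mem_G hx) hX.1, dθ_aS hx, C.dθ_smul hX.1] at h2
  have h3 := lie_rootSpace hxT (R.dθ_rootSpace hα hX)
  rw [ev_inv hxT hα] at h3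
  have h4 : ⁅-x, C.dθ X⁆ = -⁅x, C.dθ X⁆ := by simp only [Ring.lie_def]; noncomm_ring
  rw [h4, h3, neg_smul, neg_neg] at h2
  exact (smul_left_injective ℂ (dθ_ne_zero hX.1 h0) h2).symm

theorem dθ_coroot (hα : α ∈ C.roots) : C.dθ (R.coroot α) = -R.coroot α := by
  have he := (R.e_mem α hα).1
  rw [← R.e_bracket α hα, C.dθ_lie (C.dθ_mem he) he, C.dθ_dθ he]
  simp only [Ring.lie_def]
  abel

theorem coroot_mem_lieL (hα : α ∈ C.roots) : R.coroot α ∈ lieAlg D.L :=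
  mem_lieL_of_fixed (R.coroot_mem hα).1 fun s => by
    have := rootSpace_Ad (R.coroot_mem hα) ⟨D.lam s, C.lam_mem_T s⟩
    simpa using this

/-- This vector is negated by σ and by θ and commutes with T_s; maximality of T_s does the rest. It
is what allows du to be evaluated on 𝓟 of a coroot. -/
theorem projP_coroot_mem_aS (hα : α ∈ C.roots) : D.projP (R.coroot α) ∈ C.aS := by
  have hc := R.coroot_mem_lieL hα
  have hσc := dσ_mem hc
  have hd := lieAlg_sub D.L_algebraic hc hσc
  have hP : D.projP (R.coroot α) ∈ lieAlg D.L := lieAlg_smul hd _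
  have hθ : C.dθ (D.projP (R.coroot α)) = -D.projP (R.coroot α) := by
    rw [projP, C.dθ_smul (lieL_le hd), C.dθ_sub (lieL_le hc) (lieL_le hσc), ← C.dσ_dθ hc,
      R.dθ_coroot hα, dσ_neg hc, ← smul_neg]
    congr 1
    · rw [map_inv₀, Complex.conj_ofNat]
    · abel
  have hσ : D.dσ (D.projP (R.coroot α)) = -D.projP (R.coroot α) := by
    rw [projP, dσ_smul hd, dσ_sub hc hσc, dσ_dσ hc, ← smul_neg, neg_sub]
  refine C.mem_aS (C.mem_lieAlg_Ts_of_neg hP hθ hσ fun t ht => ?_) (lieL_le hP) hθ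
  have h1 : D.dσ (R.coroot α) ∈ C.rootSpace (C.σChar 1) := dσ_rootSpace (R.coroot_mem hα) hc
  have hone : C.σChar 1 = 1 := by ext t; simp [σChar]
  rw [hone] at h1
  have h2 := rootSpace_Ad (rootSpace_smul (rootSpace_sub (R.coroot_mem hα) h1) (2⁻¹ : ℂ))
    ⟨t, C.Ts_le_T ht⟩
  rw [MonoidHom.one_apply, Units.val_one, one_smul] at h2
  exact Ad_eq_self_iff.1 h2

theorem coroot_eq (α : C.Chars) :
    R.coroot α = D.projP (R.coroot α) + D.projH (R.coroot α) := by
  rw [projP, projH, ← smul_add, sub_add_add_cancel, ← two_smul ℂ, smul_smul]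
  norm_num

/-- `σ` acts trivially on the root spaces of the roots of `L` that it fixes. -/
theorem dσ_eq_self (R : ReferenceData C) (hγ : γ ∈ C.roots) (hσγ : C.σChar γ = γ)
    (hX : X ∈ C.rootSpace γ) (hL : X ∈ lieAlg D.L) : D.dσ X = X := by
  have hσX := dσ_rootSpace hX hL
  rw [hσγ] at hσX
  -- The anti-invariant part of X. If it is nonzero, w - θ(w) will enlarge 𝔱_s beyond 𝔱.
  set w := X - D.dσ X with hw
  have hwL : w ∈ lieAlg D.L := lieAlg_sub D.L_algebraic hL (dσ_mem hL)
  have hwγ : w ∈ C.rootSpace γ := rootSpace_sub hX hσX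
  have hσw : D.dσ w = -w := by rw [hw, dσ_sub hL (dσ_mem hL), dσ_dσ hL]; abel
  have hθw := R.dθ_rootSpace hγ hwγ
  have hθwL := C.dθ_mem_L hwL
  by_contra hne
  have hw0 : w ≠ 0 := fun h => hne (sub_eq_zero.1 h).symm
  -- σ fixes γ and inverts T_s, so γ takes only the values 1 and -1 there, and T_s is connected.
  have hone : ∀ t ∈ C.Ts, ∀ ht : t ∈ C.T, γ ⟨t, ht⟩ = 1 := by
    intro t ht htT
    refine eq_one_of_finite hwγ hw0 C.Ts_le_T C.Ts_split.1.isAlgebraic C.Ts_split.1.connected ?_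
      ⟨t, ht⟩
    refine Set.Finite.subset (Set.toFinite {1, -1}) ?_
    rintro c ⟨s, rfl⟩
    set s' : C.T := Subgroup.inclusion C.Ts_le_T s
    have h1 : C.σT s' = s'⁻¹ := σT_of_mem_Ts s.2
    have h2 : γ s' = (γ s')⁻¹ := by
      conv_lhs => rw [← hσγ, σChar, MonoidHom.comp_apply, h1, map_inv]
    have h4 : ((γ s' : ℂˣ) : ℂ) * (γ s' : ℂˣ) = 1 := by
      rw [← Units.val_mul]
      nth_rw 1 [h2]
      simp
    rcases mul_self_eq_one_iff.1 h4 with h5 | h5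
    · left; exact Units.ext h5
    · right; exact Units.ext h5
  have hx : w - C.dθ w ∈ lieAlg C.Ts := by
    refine C.mem_lieAlg_Ts_of_neg (lieAlg_sub D.L_algebraic hwL hθwL) ?_ ?_ fun t ht => ?_
    · rw [C.dθ_sub hwγ.1 hθw.1, C.dθ_dθ hwγ.1]; abel
    · rw [dσ_sub hwL hθwL, C.dσ_dθ hwL, hσw, C.dθ_neg hwγ.1]; abel
    · refine Ad_eq_self_iff.1 ?_
      have e1 : Ad t w = w := by
        have := rootSpace_Ad hwγ ⟨t, C.Ts_le_T ht⟩
        rwa [hone t ht, Units.val_one, one_smul] at this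
      have e2 : Ad t (C.dθ w) = C.dθ w := by
        have := rootSpace_Ad hθw ⟨t, C.Ts_le_T ht⟩
        rwa [MonoidHom.inv_apply, hone t ht, inv_one, Units.val_one, one_smul] at this
      rw [map_sub, e1, e2]
  -- Now w - θ(w) lies in 𝔱 and is fixed by T. Comparing the weights γ and -γ forces γ = -γ,
  -- impossible for a root.
  have hxT := lieAlg_mono C.Ts_le_T hx
  obtain ⟨t, ht⟩ : ∃ t, γ t ≠ 1 := by
    by_contra h
    push Not at h
    exact hγ.1 (MonoidHom.ext h)
  have h1 := Ad_eq_self_iff.2 (commute_T_lieT hxT t)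
  rw [map_sub, rootSpace_Ad hwγ, rootSpace_Ad hθw] at h1
  have h2 : ((γ t : ℂ) - 1) • w = ((γ⁻¹ t : ℂˣ) - 1 : ℂ) • C.dθ w := by
    rw [sub_smul, sub_smul, one_smul, one_smul, sub_eq_sub_iff_sub_eq_sub]
    exact h1
  have h3 : ((γ t : ℂ) - 1) ≠ 0 := fun h => ht (Units.ext (sub_eq_zero.1 h))
  have h4 : w = (((γ t : ℂ) - 1)⁻¹ * ((γ⁻¹ t : ℂˣ) - 1 : ℂ)) • C.dθ w := by
    rw [← smul_smul, ← h2, smul_smul, inv_mul_cancel₀ h3, one_smul]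
  have h5 : w ∈ C.rootSpace γ⁻¹ := by
    rw [h4]; exact rootSpace_smul hθw _
  have h6 := rootSpace_unique hwγ h5 hw0
  refine root_sq_ne_one hγ ?_
  nth_rw 2 [h6]
  exact mul_inv_cancel γ

theorem rootsQu_mem_roots (R : ReferenceData C) (hα : α ∈ C.rootsQu) : α ∈ C.roots :=
  R.pos_subset (R.rootsQu_subset hα)

/-- A negative weight would place α in Φ_{Pᵘ}, making both α and -α positive. Weight zero would make
conjugation by λ constant on exp(tX), which nevertheless has to tend to 1. -/
theorem exists_pos_weight (R : ReferenceData C) (hα : α ∈ C.rootsQu) : ∃ k : ℤ, 0 < k ∧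
    ∀ Y ∈ C.rootSpace α⁻¹, ∀ s : ℂˣ, Ad (D.lam s) Y = ((s ^ k : ℂˣ) : ℂ) • Y := by
  have hα' := R.rootsQu_mem_roots hα
  have hPu : α⁻¹ ∈ C.rootsPu := hα
  obtain ⟨h1, X, hX, h0⟩ := id hPu.1
  obtain ⟨k, hk⟩ := exists_weight hX h0
  have hAd : ∀ Y ∈ C.rootSpace α⁻¹, ∀ s : ℂˣ, Ad (D.lam s) Y = ((s ^ k : ℂˣ) : ℂ) • Y := by
    intro Y hY s
    rw [← hk s]
    exact rootSpace_Ad hY ⟨D.lam s, C.lam_mem_T s⟩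
  refine ⟨k, ?_, hAd⟩
  by_contra hneg
  rcases (not_lt.1 hneg).lt_or_eq with hlt | rfl
  · have hpos : ∀ Y ∈ C.rootSpace α, ∀ s : ℂˣ, Ad (D.lam s) Y = ((s ^ (-k) : ℂˣ) : ℂ) • Y := by
      intro Y hY s
      have := rootSpace_Ad hY ⟨D.lam s, C.lam_mem_T s⟩
      rw [zpow_neg, ← hk s, MonoidHom.inv_apply, inv_inv]
      exact this
    have hmem : α ∈ C.rootsPu :=
      ⟨hα', fun Y hY => mem_liePu_of_pos hY.1 (by omega) (hpos Y hY)⟩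
    have h2 : α⁻¹ ∈ C.rootsQu := by
      change (α⁻¹)⁻¹ ∈ C.rootsPu
      rwa [chars_inv_inv]
    exact R.pos_not α (R.rootsQu_subset hα) (R.rootsQu_subset h2)
  · refine h0 (exp_smul_injective fun t => ?_)
    have h2 := expGL_real_mem (hPu.2 hX) t
    have h3 : (fun s : ℂˣ => D.lam s * expGL (t • X) * (D.lam s)⁻¹) = fun _ => expGL (t • X) := by
      funext s
      rw [← expGL_conj, mul_smul_comm, smul_mul_assoc, ← Ad_apply, hAd X hX s]
      simp
    have h4 := h2.2
    rw [h3] at h4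
    have hne : (toZero).NeBot := by
      refine comap_neBot_iff.2 fun s hs => ?_
      obtain ⟨z, hz, hz0⟩ : ∃ z ∈ s, z ≠ 0 := by
        have := (mem_nhdsWithin_of_mem_nhds hs : s ∈ 𝓝[≠] (0 : ℂ))
        obtain ⟨z, hz, hz'⟩ := (Filter.inter_mem this self_mem_nhdsWithin :
          s ∩ {0}ᶜ ∈ 𝓝[≠] (0 : ℂ)) |> Filter.nonempty_of_mem
        exact ⟨z, hz, hz'⟩
      exact ⟨Units.mk0 z hz0, hz⟩
    have h5 := tendsto_nhds_unique h4 tendsto_const_nhds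
    have h6 := congrArg Units.val h5
    rw [smul_zero, exp_zero]
    simpa using h6.symm

end ReferenceData

/-! ### Characters on nilpotent elements -/

theorem exists_polynomial_exp {X : Mat n} (hX : IsNilpotent X) (i j : Fin n) :
    ∃ P : Polynomial ℂ, ∀ t : ℂ, (exp (t • X)) i j = P.eval t := by
  obtain ⟨k, hk⟩ := hX
  refine ⟨∑ m ∈ Finset.range k, Polynomial.monomial m (((m.factorial : ℂ)⁻¹) * (X ^ m) i j),
    fun t => ?_⟩
  have h1 : exp (t • X) = ∑ m ∈ Finset.range k, ((m.factorial : ℂ)⁻¹) • (t • X) ^ m := by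
    rw [exp_eq_tsum ℂ]
    refine tsum_eq_sum fun m hm => ?_
    have hkm : k ≤ m := by simpa using hm
    rw [smul_pow, pow_eq_zero_of_le hkm hk, smul_zero, smul_zero]
  rw [h1, Matrix.sum_apply, Polynomial.eval_finsetSum]
  refine Finset.sum_congr rfl fun m _ => ?_
  simp only [smul_pow, Matrix.smul_apply, smul_eq_mul, Polynomial.eval_monomial]
  ring

/-- A nonvanishing regular function is constant along unipotent one-parameter groups. -/
theorem eval_const_of_isNilpotent {X : Mat n} (hX : IsNilpotent X)
    (p : MvPolynomial ((Fin n × Fin n) ⊕ (Fin n × Fin n)) ℂ)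
    (h : ∀ t : ℂ, MvPolynomial.eval (coords (expGL (t • X))) p ≠ 0) (t : ℂ) :
    MvPolynomial.eval (coords (expGL (t • X))) p = MvPolynomial.eval (coords (1 : GLn n)) p := by
  choose P hP using exists_polynomial_exp hX
  choose Q hQ using exists_polynomial_exp hX.neg
  let F : (Fin n × Fin n) ⊕ (Fin n × Fin n) → Polynomial ℂ :=
    Sum.elim (fun ij => P ij.1 ij.2) (fun ij => Q ij.1 ij.2)
  have hF : ∀ t : ℂ, coords (expGL (t • X)) = fun c => (F c).eval t := by
    intro t
    funext c
    rcases c with ⟨i, j⟩ | ⟨i, j⟩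
    · exact hP i j t
    · have := hQ i j t
      rw [smul_neg] at this
      simp only [coords, Sum.elim_inr, F]
      rw [expGL_inv_val, this]
  let r : Polynomial ℂ := MvPolynomial.aeval F p
  have hr : ∀ t : ℂ, MvPolynomial.eval (coords (expGL (t • X))) p = r.eval t := by
    intro t
    rw [hF]
    have := MvPolynomial.polynomial_eval_eval₂ (x := t) Polynomial.C F p
    have hid : (Polynomial.evalRingHom t).comp Polynomial.C = RingHom.id ℂ := by ext; simp
    rw [hid] at this
    exact this.symm
  -- A complex polynomial without zeros is constant.
  have hdeg : r.degree = 0 := by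
    by_contra hne
    obtain ⟨z, hz⟩ := IsAlgClosed.exists_root r hne
    exact h z ((hr z).trans hz)
  have hC := Polynomial.eq_C_of_degree_le_zero hdeg.le
  have h1 : MvPolynomial.eval (coords (1 : GLn n)) p = r.eval 0 := by
    rw [← hr]; simp
  rw [h1, hr, hC]
  simp

open CartanData

/-! ### The Lie algebra of `H` and its characters -/

namespace HorosymmetricSpace

variable {D : HorosymmetricSpace n} {X : Mat n}

theorem H_le_G (D : HorosymmetricSpace n) : D.H ≤ D.G := D.H_le_parabolic.trans fun _ h => h.1

theorem liePu_le (hX : X ∈ lieAlg D.Pu) : X ∈ lieAlg D.H := lieAlg_mono D.radical_le_H hX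

/-- 𝔩^σ is the Lie algebra of L^σ, and also of its neutral component, which is contained in H. -/
theorem mem_lieH_of_fixed (hX : X ∈ lieAlg D.L) (h : D.dσ X = X) : X ∈ lieAlg D.H := by
  have h1 : X ∈ lieAlg ((D.σ.eqLocus (MonoidHom.id _)).map D.L.subtype) := fun z => by
    refine ⟨expIn D.L (z • X), ?_, expIn_val (lieAlg_smul hX z)⟩
    change D.σ _ = _
    rw [σ_exp (lieAlg_smul hX z), dσ_smul hX, h]
    rfl
  exact lieAlg_mono (D.fixed_le_H.trans inf_le_right) (lieAlg_neutralComponent _ h1)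

theorem projH_mem_lieL (hX : X ∈ lieAlg D.L) : D.projH X ∈ lieAlg D.L :=
  lieAlg_smul (lieAlg_add D.L_algebraic hX (dσ_mem hX)) _

theorem dσ_projH (hX : X ∈ lieAlg D.L) : D.dσ (D.projH X) = D.projH X := by
  rw [projH, dσ_smul (lieAlg_add D.L_algebraic hX (dσ_mem hX)), dσ_add hX (dσ_mem hX), dσ_dσ hX,
    add_comm]

theorem projH_mem_lieH (hX : X ∈ lieAlg D.L) : D.projH X ∈ lieAlg D.H :=
  mem_lieH_of_fixed (projH_mem_lieL hX) (dσ_projH hX)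

end HorosymmetricSpace

theorem eq_cexp_of_hasDerivAt {f : ℝ → ℂ} {c : ℂ} (h0 : f 0 = 1)
    (hadd : ∀ s t, f (s + t) = f s * f t) (hd : HasDerivAt f c 0) (t : ℝ) :
    f t = Complex.exp (t * c) := by
  rw [eq_exp_of_hasDerivAt_aux h0 hadd hd t, Complex.exp_eq_exp_ℂ]
  simp

/-- `ℓ` is the differential of the character `χ` of `H`. -/
structure IsDChar (D : HorosymmetricSpace n) (χ : D.H →* ℂˣ) (ℓ : Mat n →ₗ[ℂ] ℂ) : Prop where
  dChar_eq : ∀ X ∈ lieAlg D.H, dChar D.H χ X = ℓ X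
  map_exp : ∀ X ∈ lieAlg D.H, ∀ t : ℝ, (χ (expIn D.H (t • X)) : ℂ) = Complex.exp (t * ℓ X)
  nilpotent : ∀ X ∈ lieAlg D.H, IsNilpotent X → ℓ X = 0

/-- Regularity of χ supplies a complex linear differential, and also its vanishing on nilpotent
elements, along which the nowhere vanishing χ is constant. -/
theorem exists_isDChar {D : HorosymmetricSpace n} {χ : D.H →* ℂˣ}
    (hχ : IsRegular D.H fun h => (χ h : ℂ)) : ∃ ℓ, IsDChar D χ ℓ := by
  obtain ⟨p, hp⟩ := hχ
  obtain ⟨ℓ, hℓ⟩ := exists_hasDerivAt_eval p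
  have hval : ∀ X ∈ lieAlg D.H, ∀ t : ℝ, (χ (expIn D.H (t • X)) : ℂ)
      = MvPolynomial.eval (coords (expGL (t • X))) p := fun X hX t => by
    rw [← expIn_val (lieAlg_real_smul hX t)]
    exact hp _
  have hd : ∀ X ∈ lieAlg D.H, HasDerivAt (fun t : ℝ => (χ (expIn D.H (t • X)) : ℂ)) (ℓ X) 0 :=
    fun X hX => by
      rw [funext (hval X hX)]
      exact hℓ X
  refine ⟨ℓ, ⟨fun X hX => (hd X hX).deriv, fun X hX t => ?_, fun X hX hnil => ?_⟩⟩
  · refine eq_cexp_of_hasDerivAt (f := fun t : ℝ => (χ (expIn D.H (t • X)) : ℂ)) (by simp)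
      (fun s t => ?_) (hd X hX) t
    rw [expIn_add_smul hX, map_mul, Units.val_mul]
  · have hne : ∀ t : ℂ, MvPolynomial.eval (coords (expGL (t • X))) p ≠ 0 := fun t => by
      rw [← expIn_val (lieAlg_smul hX t)]
      have := hp (expIn D.H (t • X))
      simp only at this
      rw [← this]
      exact Units.ne_zero _
    have hc := eval_const_of_isNilpotent hnil p hne
    have h1 := hℓ X
    have e : (fun t : ℝ => MvPolynomial.eval (coords (expGL (t • X))) p)
        = fun _ => MvPolynomial.eval (coords (1 : GLn n)) p := by
      funext t
      have := hc t
      rwa [Complex.coe_smul] at this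
    rw [e] at h1
    exact h1.unique (hasDerivAt_const _ _)

/-! ### The second order jet of an invariant potential -/

/-- The first derivative `lin` and the second derivative `B` at `exp(a)` of a function that is
invariant under `K` on the left and equivariant for `-2 Re ℓ` under `H` on the right. -/
structure JetData {D : HorosymmetricSpace n} (C : CartanData D) (a : Mat n)
    (ℓ : Mat n →ₗ[ℂ] ℂ) where
  lin : Mat n →ₗ[ℝ] ℝ
  B : Mat n →ₗ[ℝ] Mat n →ₗ[ℝ] ℝ
  B_sub : ∀ X Y, B X Y - B Y X = lin ⁅X, Y⁆
  B_H : ∀ X ∈ lieAlg D.G, ∀ h ∈ lieAlg D.H, B X h = 0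
  lin_H : ∀ h ∈ lieAlg D.H, lin h = -2 * (ℓ h).re
  B_K : ∀ k ∈ C.lieK, ∀ Y ∈ lieAlg D.G, B (Ad (expGL (-a)) k) Y = 0
  lin_K : ∀ k ∈ C.lieK, lin (Ad (expGL (-a)) k) = 0

namespace JetData

variable {D : HorosymmetricSpace n} {C : CartanData D} {a : Mat n} {ℓ : Mat n →ₗ[ℂ] ℂ}
  (J : JetData C a ℓ) {X Y W h : Mat n} {c : ℝ}

open Complex (I)

/-- The hermitian part of the second derivative. -/
def S (X Y : Mat n) : ℂ :=
  (1 / 4 : ℂ) * ((J.B X Y : ℂ) + (J.B (I • X) (I • Y) : ℂ)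
    + I * ((J.B X (I • Y) : ℂ) - (J.B (I • X) Y : ℂ)))

/-- The antiholomorphic part of the second derivative. -/
def N (X Y : Mat n) : ℂ :=
  (1 / 4 : ℂ) * ((J.B X Y : ℂ) - (J.B (I • X) (I • Y) : ℂ)
    + I * ((J.B X (I • Y) : ℂ) + (J.B (I • X) Y : ℂ)))

/-- The antilinear part of the first derivative. -/
def Lam (X : Mat n) : ℂ := (1 / 2 : ℂ) * ((J.lin X : ℂ) + I * (J.lin (I • X) : ℂ))

theorem I_smul_lie (X Y : Mat n) : ⁅I • X, Y⁆ = I • ⁅X, Y⁆ := by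
  simp [Ring.lie_def, smul_sub]

theorem lie_I_smul (X Y : Mat n) : ⁅X, I • Y⁆ = I • ⁅X, Y⁆ := by
  simp [Ring.lie_def, smul_sub]

theorem I_I_smul (X : Mat n) : I • I • X = -X := by rw [smul_smul, Complex.I_mul_I, neg_one_smul]

/-- B fails to be symmetric by lin of a bracket. In S these defects cancel, because [iX, iY] = -[X,
Y] and [iX, Y] = [X, iY]. -/
theorem S_conj (X Y : Mat n) : (starRingEnd ℂ) (J.S X Y) = J.S Y X := by
  have h1 : J.B Y X = J.B X Y - J.lin ⁅X, Y⁆ := by rw [← J.B_sub]; ring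
  have h2 : J.B (I • Y) (I • X) = J.B (I • X) (I • Y) + J.lin ⁅X, Y⁆ := by
    have := J.B_sub (I • X) (I • Y)
    rw [I_smul_lie, lie_I_smul, I_I_smul, map_neg] at this
    linarith
  have h3 : J.B Y (I • X) = J.B (I • X) Y - J.lin (I • ⁅X, Y⁆) := by
    rw [← I_smul_lie, ← J.B_sub]; ring
  have h4 : J.B (I • Y) X = J.B X (I • Y) - J.lin (I • ⁅X, Y⁆) := by
    rw [← lie_I_smul, ← J.B_sub]; ring
  simp only [S, h1, h2, h3, h4]
  simp only [map_mul, map_add, map_sub, Complex.conj_ofReal, Complex.conj_I, map_div₀, map_one,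
    Complex.conj_ofNat]
  push_cast
  ring

theorem S_add_left (X X' Y : Mat n) : J.S (X + X') Y = J.S X Y + J.S X' Y := by
  simp only [S, smul_add, map_add, LinearMap.add_apply]
  push_cast
  ring

theorem S_sub_left (X X' Y : Mat n) : J.S (X - X') Y = J.S X Y - J.S X' Y := by
  simp only [S, smul_sub, map_sub, LinearMap.sub_apply]
  push_cast
  ring

theorem N_add_left (X X' Y : Mat n) : J.N (X + X') Y = J.N X Y + J.N X' Y := by
  simp only [N, smul_add, map_add, LinearMap.add_apply]
  push_cast
  ring

theorem Lam_add (X Y : Mat n) : J.Lam (X + Y) = J.Lam X + J.Lam Y := by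
  simp only [Lam, smul_add, map_add]
  push_cast
  ring

theorem Lam_sub (X Y : Mat n) : J.Lam (X - Y) = J.Lam X - J.Lam Y := by
  simp only [Lam, smul_sub, map_sub]
  push_cast
  ring

theorem Lam_neg (X : Mat n) : J.Lam (-X) = -J.Lam X := by
  simp only [Lam, smul_neg, map_neg]
  push_cast
  ring

theorem Lam_real_smul (r : ℝ) (X : Mat n) : J.Lam ((r : ℂ) • X) = r * J.Lam X := by
  have h : I • (r : ℂ) • X = r • I • X := by rw [smul_comm, Complex.coe_smul]
  simp only [Lam, h]
  simp only [Complex.coe_smul, map_smul, smul_eq_mul]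
  push_cast
  ring

/-- Here B(h, Y) = lin[h, Y], because B(Y, h) = 0; the bracket is complex bilinear, so taking the
part antilinear in both variables gives Lam. -/
theorem N_eq_Lam (hh : h ∈ lieAlg D.H) (hY : Y ∈ lieAlg D.G) : J.N h Y = J.Lam ⁅h, Y⁆ := by
  have hH : ∀ {Z Z' : Mat n}, Z ∈ lieAlg D.H → Z' ∈ lieAlg D.G → J.B Z Z' = J.lin ⁅Z, Z'⁆ := by
    intro Z Z' hZ hZ'
    rw [← J.B_sub, J.B_H Z' hZ' Z hZ, sub_zero]
  have hIh := lieAlg_smul hh I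
  have hIY := lieAlg_smul hY I
  simp only [N, Lam, hH hh hY, hH hIh hIY, hH hh hIY, hH hIh hY, I_smul_lie, lie_I_smul, I_I_smul,
    map_neg]
  push_cast
  ring

theorem S_H_right (hX : X ∈ lieAlg D.G) (hh : h ∈ lieAlg D.H) : J.S X h = 0 := by
  have hIh := lieAlg_smul hh I
  have hIX := lieAlg_smul hX I
  simp [S, J.B_H _ hX _ hh, J.B_H _ hIX _ hIh, J.B_H _ hX _ hIh, J.B_H _ hIX _ hh]

/-- Together with its mirror image this says that S descends to 𝔤/𝔥, as a form on the tangent space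
of G/H must. -/
theorem S_H_left (hX : X ∈ lieAlg D.G) (hh : h ∈ lieAlg D.H) : J.S h X = 0 := by
  rw [← S_conj, J.S_H_right hX hh, map_zero]

theorem Lam_H (hh : h ∈ lieAlg D.H) : J.Lam h = -(starRingEnd ℂ) (ℓ h) := by
  rw [Lam, J.lin_H h hh, J.lin_H _ (lieAlg_smul hh I), map_smul]
  apply Complex.ext <;> simp

/-- `W` is an eigenvector of `ad a` with the real eigenvalue `c`, and `θ(W)` one with the
eigenvalue `-c`. -/
structure IsWeight (C : CartanData D) (a W : Mat n) (c : ℝ) : Prop where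
  mem : W ∈ lieAlg D.G
  lie : ⁅a, W⁆ = (c : ℂ) • W
  lie_θ : ⁅a, C.dθ W⁆ = (-c : ℂ) • C.dθ W

theorem IsWeight.smul (hW : IsWeight C a W c) (z : ℂ) : IsWeight C a (z • W) c where
  mem := lieAlg_smul hW.mem z
  lie := by
    rw [smul_comm, ← hW.lie]; simp [Ring.lie_def, smul_sub]
  lie_θ := by
    rw [C.dθ_smul hW.mem, smul_comm, ← hW.lie_θ]; simp [Ring.lie_def, smul_sub]

/-- The element is W + θ(W); Ad(exp(-a)) scales its two summands oppositely. -/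
theorem IsWeight.Ad_K (hW : IsWeight C a W c) : ∃ k ∈ C.lieK,
    Ad (expGL (-a)) k = Real.exp (-c) • W + Real.exp c • C.dθ W := by
  refine ⟨W + C.dθ W, C.mem_lieK (lieAlg_add D.G_algebraic hW.mem (C.dθ_mem hW.mem)) ?_, ?_⟩
  · rw [C.dθ_add hW.mem (C.dθ_mem hW.mem), C.dθ_dθ hW.mem, add_comm]
  · have h1 : ⁅-a, W⁆ = ((-c : ℝ) : ℂ) • W := by
      have : ⁅-a, W⁆ = -⁅a, W⁆ := by simp only [Ring.lie_def]; noncomm_ring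
      rw [this, hW.lie]; push_cast; rw [neg_smul]
    have h2 : ⁅-a, C.dθ W⁆ = (c : ℂ) • C.dθ W := by
      have : ⁅-a, C.dθ W⁆ = -⁅a, C.dθ W⁆ := by simp only [Ring.lie_def]; noncomm_ring
      rw [this, hW.lie_θ, neg_smul, neg_neg]
    rw [map_add, Ad_exp h1, Ad_exp h2, ← Complex.ofReal_exp, ← Complex.ofReal_exp,
      Complex.coe_smul, Complex.coe_smul]

theorem B_θ (hW : IsWeight C a W c) (hY : Y ∈ lieAlg D.G) :
    J.B (C.dθ W) Y = -Real.exp (-2 * c) * J.B W Y := by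
  obtain ⟨k, hk, e⟩ := hW.Ad_K
  have h1 := J.B_K k hk Y hY
  rw [e, map_add, map_smul, map_smul, LinearMap.add_apply, LinearMap.smul_apply,
    LinearMap.smul_apply, smul_eq_mul, smul_eq_mul] at h1
  have h2 : Real.exp (-2 * c) = Real.exp (-c) * Real.exp (-c) := by
    rw [← Real.exp_add]; ring_nf
  have h3 : Real.exp (-c) * Real.exp c = 1 := by rw [← Real.exp_add]; simp
  linear_combination (Real.exp (-c)) * h1 - J.B (C.dθ W) Y * h3 + J.B W Y * h2

theorem lin_θ (hW : IsWeight C a W c) : J.lin (C.dθ W) = -Real.exp (-2 * c) * J.lin W := by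
  obtain ⟨k, hk, e⟩ := hW.Ad_K
  have h1 := J.lin_K k hk
  rw [e, map_add, map_smul, map_smul, smul_eq_mul, smul_eq_mul] at h1
  have h2 : Real.exp (-2 * c) = Real.exp (-c) * Real.exp (-c) := by
    rw [← Real.exp_add]; ring_nf
  have h3 : Real.exp (-c) * Real.exp c = 1 := by rw [← Real.exp_add]; simp
  linear_combination (Real.exp (-c)) * h1 - J.lin (C.dθ W) * h3 + J.lin W * h2

theorem I_smul_dθ (hW : W ∈ lieAlg D.G) : I • C.dθ W = -C.dθ (I • W) := by
  rw [C.dθ_smul hW]; simp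

/-- The central trade: since θ is antilinear, moving θ onto the first variable exchanges the
sesquilinear part of B for the part antilinear in both variables. -/
theorem N_θ (hW : IsWeight C a W c) (hY : Y ∈ lieAlg D.G) :
    J.N (C.dθ W) Y = -Real.exp (-2 * c) * J.S W Y := by
  have hIY := lieAlg_smul hY I
  simp only [N, S, I_smul_dθ hW.mem, map_neg, LinearMap.neg_apply, J.B_θ hW hY,
    J.B_θ (hW.smul I) hY, J.B_θ hW hIY, J.B_θ (hW.smul I) hIY]
  push_cast
  ring

theorem Lam_θ (hW : IsWeight C a W c) :
    J.Lam (C.dθ W) = -Real.exp (-2 * c) * (starRingEnd ℂ) (J.Lam W) := by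
  simp only [Lam, I_smul_dθ hW.mem, map_neg, J.lin_θ hW, J.lin_θ (hW.smul I)]
  simp only [map_mul, map_add, Complex.conj_ofReal, Complex.conj_I, map_div₀, map_one,
    Complex.conj_ofNat]
  push_cast
  ring

theorem cast_exp_mul_exp (c : ℝ) : (Real.exp (2 * c) : ℂ) * Real.exp (-2 * c) = 1 := by
  rw [← Complex.ofReal_mul, ← Real.exp_add]; simp

theorem S_of_θ_mem (hW : IsWeight C a W c) (hθ : C.dθ W ∈ lieAlg D.H) (hY : Y ∈ lieAlg D.G) :
    J.S W Y = Real.exp (2 * c) * J.Lam ⁅Y, C.dθ W⁆ := by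
  have h1 := J.N_θ hW hY
  rw [J.N_eq_Lam hθ hY] at h1
  have h2 : ⁅Y, C.dθ W⁆ = -⁅C.dθ W, Y⁆ := by simp only [Ring.lie_def]; abel
  rw [h2, J.Lam_neg, h1]
  linear_combination -J.S W Y * cast_exp_mul_exp c

/-- The form `S` on `e - σ(e)` where `e + σ(e)` and its image under `θ` lie in `𝔥`. -/
theorem S_sub_of_add_mem {e e' : Mat n} (he : IsWeight C a e c) (he' : IsWeight C a e' (-c))
    (hc : c ≠ 0) (hμ : e + e' ∈ lieAlg D.H) (hθμ : C.dθ (e + e') ∈ lieAlg D.H)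
    (hY : Y ∈ lieAlg D.G) :
    J.S (e - e') Y = -(1 / Real.sinh (2 * c) : ℝ) * J.Lam ⁅Y, C.dθ (e + e')⁆ := by
  -- This says S(e', Y) = -S(e, Y). Inserted in `h2` below it leaves 2 sinh(2c) S(e, Y), which can
  -- be divided out because c ≠ 0.
  have h1 := J.S_H_left hY hμ
  rw [S_add_left] at h1
  have h2 := J.N_eq_Lam hθμ hY
  rw [C.dθ_add he.mem he'.mem, N_add_left, J.N_θ he hY, J.N_θ he' hY,
    ← C.dθ_add he.mem he'.mem] at h2
  have h3 : ⁅Y, C.dθ (e + e')⁆ = -⁅C.dθ (e + e'), Y⁆ := by simp only [Ring.lie_def]; abel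
  have hs : (Real.sinh (2 * c) : ℂ) ≠ 0 := by
    rw [Ne, Complex.ofReal_eq_zero, Real.sinh_eq_zero]
    simpa using hc
  have hs2 : 2 * (Real.sinh (2 * c) : ℂ) = Real.exp (2 * c) - Real.exp (-2 * c) := by
    rw [Real.sinh_eq]
    push_cast
    ring_nf
  have hneg : Real.exp (-2 * -c) = Real.exp (2 * c) := by ring_nf
  rw [hneg] at h2
  rw [S_sub_left, h3, J.Lam_neg, ← h2]
  have h5 : ((1 / Real.sinh (2 * c) : ℝ) : ℂ) * (2 * Real.sinh (2 * c)) = 2 := by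
    rw [Complex.ofReal_div, Complex.ofReal_one]
    field_simp
  rw [eq_neg_of_add_eq_zero_right h1]
  linear_combination -(J.S e Y) * h5 + ((1 / Real.sinh (2 * c) : ℝ) : ℂ) * (J.S e Y) * hs2

end JetData

open ReferenceData

/-! ### The character `χ ∘ 𝓗` -/

section chiL

variable {D : HorosymmetricSpace n} {C : CartanData D} {χ : D.H →* ℂˣ} {ℓ : Mat n →ₗ[ℂ] ℂ}
  {w w' : Mat n}

theorem chiL_eq (hℓ : IsDChar D χ ℓ) (hw : w ∈ lieAlg D.L) : chiL χ w = ℓ (D.projH w) :=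
  hℓ.dChar_eq _ (projH_mem_lieH hw)

theorem two_mul_chiL (hℓ : IsDChar D χ ℓ) (hw : w ∈ lieAlg D.L) :
    2 * chiL χ w = ℓ (w + D.dσ w) := by
  rw [chiL_eq hℓ hw, projH, map_smul, smul_eq_mul]
  ring

theorem chiL_of_fixed (hℓ : IsDChar D χ ℓ) (hw : w ∈ lieAlg D.L) (h : D.dσ w = w) :
    chiL χ w = ℓ w := by
  have := two_mul_chiL hℓ hw
  rw [h, map_add, ← two_mul] at this
  exact mul_left_cancel₀ two_ne_zero this

theorem chiL_dσ (w : Mat n) (hw : w ∈ lieAlg D.L) : chiL χ (D.dσ w) = chiL χ w := by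
  rw [chiL, chiL, projH, projH, dσ_dσ hw, add_comm]

theorem chiL_add (hℓ : IsDChar D χ ℓ) (hw : w ∈ lieAlg D.L) (hw' : w' ∈ lieAlg D.L) :
    chiL χ (w + w') = chiL χ w + chiL χ w' := by
  have h := two_mul_chiL hℓ (lieAlg_add D.L_algebraic hw hw')
  have h1 := two_mul_chiL hℓ hw
  have h2 := two_mul_chiL hℓ hw'
  rw [dσ_add hw hw', map_add, map_add, map_add] at h
  rw [map_add] at h1 h2
  refine mul_left_cancel₀ (two_ne_zero (α := ℂ)) ?_
  linear_combination h - h1 - h2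

theorem chiL_smul (hℓ : IsDChar D χ ℓ) (hw : w ∈ lieAlg D.L) (c : ℂ) :
    chiL χ (c • w) = c * chiL χ w := by
  rw [chiL_eq hℓ hw, chiL_eq hℓ (lieAlg_smul hw c), projH, projH, dσ_smul hw, ← smul_add,
    smul_comm, map_smul, smul_eq_mul]

theorem chiL_sub (hℓ : IsDChar D χ ℓ) (hw : w ∈ lieAlg D.L) (hw' : w' ∈ lieAlg D.L) :
    chiL χ (w - w') = chiL χ w - chiL χ w' := by
  have : w - w' = w + (-1 : ℂ) • w' := by rw [neg_one_smul, sub_eq_add_neg]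
  rw [this, chiL_add hℓ hw (lieAlg_smul hw' _), chiL_smul hℓ hw']
  ring

/-- The differential `ℓ` is imaginary on `𝔨 ∩ 𝔩^σ`. -/
def IsUnitaryOn (C : CartanData D) (ℓ : Mat n →ₗ[ℂ] ℂ) : Prop :=
  ∀ w ∈ lieAlg D.L, D.dσ w = w → ℓ (C.dθ w) = -(starRingEnd ℂ) (ℓ w)

theorem chiL_dθ (hℓ : IsDChar D χ ℓ) (hθ : IsUnitaryOn C ℓ) (hw : w ∈ lieAlg D.L) :
    chiL χ (C.dθ w) = -(starRingEnd ℂ) (chiL χ w) := by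
  have h1 := two_mul_chiL hℓ hw
  have h2 := two_mul_chiL hℓ (C.dθ_mem_L hw)
  have hμ := lieAlg_add D.L_algebraic hw (dσ_mem hw)
  rw [C.dσ_dθ hw, ← C.dθ_add (lieL_le hw) (lieL_le (dσ_mem hw)),
    hθ _ hμ (by rw [dσ_add hw (dσ_mem hw), dσ_dσ hw, add_comm]), ← h1] at h2
  simp only [map_mul, Complex.conj_ofNat] at h2
  refine mul_left_cancel₀ (two_ne_zero (α := ℂ)) ?_
  linear_combination h2

end chiL

/-! ### Lam on weight vectors of 𝔩 -/

namespace JetData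

variable {D : HorosymmetricSpace n} {C : CartanData D} {a : Mat n} {ℓ : Mat n →ₗ[ℂ] ℂ}
  (J : JetData C a ℓ) {X Y W W' h : Mat n} {c c' : ℝ} {χ : D.H →* ℂˣ} {γ : C.Chars}

theorem ofReal_re_ev (R : ReferenceData C) (ha : a ∈ C.aS) (hγ : γ ∈ C.roots) :
    (((C.ev γ a).re : ℝ) : ℂ) = C.ev γ a :=
  Complex.conj_eq_iff_re.1 (R.conj_ev hγ ha)

theorem isWeight_root (R : ReferenceData C) (ha : a ∈ C.aS) (hγ : γ ∈ C.roots)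
    (hX : X ∈ C.rootSpace γ) : IsWeight C a X (C.ev γ a).re where
  mem := hX.1
  lie := by
    rw [ofReal_re_ev R ha hγ]
    exact lie_rootSpace (aS_mem_T ha) hX
  lie_θ := by
    rw [ofReal_re_ev R ha hγ, ← ev_inv (aS_mem_T ha) hγ]
    exact lie_rootSpace (aS_mem_T ha) (R.dθ_rootSpace hγ hX)

theorem neg_lie_mat (X Y : Mat n) : ⁅-X, Y⁆ = -⁅X, Y⁆ := by
  simp only [Ring.lie_def]; noncomm_ring

theorem IsWeight.dσ (ha : a ∈ C.aS) (hW : IsWeight C a W c) (hL : W ∈ lieAlg D.L) :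
    IsWeight C a (D.dσ W) (-c) := by
  have key : ∀ {Z : Mat n} {z : ℂ}, Z ∈ lieAlg D.L → ⁅a, Z⁆ = z • Z →
      ⁅a, D.dσ Z⁆ = (-z) • D.dσ Z := by
    intro Z z hZ h
    have h1 := congrArg D.dσ h
    rw [dσ_lie (aS_mem_L ha) hZ, dσ_aS ha, dσ_smul hZ, neg_lie_mat] at h1
    rw [neg_smul, ← h1, neg_neg]
  refine ⟨lieL_le (dσ_mem hL), ?_, ?_⟩
  · push_cast
    exact key hL hW.lie
  · rw [← C.dσ_dθ hL, key (C.dθ_mem_L hL) hW.lie_θ]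
    push_cast
    rfl

theorem IsWeight.θ (hW : IsWeight C a W c) : IsWeight C a (C.dθ W) (-c) where
  mem := C.dθ_mem hW.mem
  lie := by push_cast; exact hW.lie_θ
  lie_θ := by
    rw [C.dθ_dθ hW.mem]; push_cast; rw [neg_neg]; exact hW.lie

theorem lie_lie_of_lie {a W W' : Mat n} {z z' : ℂ} (h : ⁅a, W⁆ = z • W) (h' : ⁅a, W'⁆ = z' • W') :
    ⁅a, ⁅W, W'⁆⁆ = (z + z') • ⁅W, W'⁆ := by
  have h1 : ⁅a, ⁅W, W'⁆⁆ = ⁅⁅a, W⁆, W'⁆ + ⁅W, ⁅a, W'⁆⁆ := by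
    simp only [Ring.lie_def]; noncomm_ring
  rw [h1, h, h', add_smul]
  simp [Ring.lie_def, smul_sub]

theorem IsWeight.lie_lie (hW : IsWeight C a W c) (hW' : IsWeight C a W' c') :
    IsWeight C a ⁅W, W'⁆ (c + c') where
  mem := lieAlg_lie D.G_algebraic hW.mem hW'.mem
  lie := by push_cast; exact lie_lie_of_lie hW.lie hW'.lie
  lie_θ := by
    rw [C.dθ_lie hW.mem hW'.mem, lie_lie_of_lie hW.lie_θ hW'.lie_θ]
    push_cast
    congr 1
    ring

theorem IsWeight.ev_eq (ha : a ∈ C.aS) (hW : IsWeight C a W c) (hγ : W ∈ C.rootSpace γ)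
    (h0 : W ≠ 0) : C.ev γ a = c :=
  smul_left_injective ℂ h0 ((lie_rootSpace (aS_mem_T ha) hγ).symm.trans hW.lie)

/-- Put x = Lam(W), y = Lam(σ(W)). Both W + σ(W) and its image under θ lie in 𝔥, where Lam is known,
so x + y and e^(-2c) x + e^(2c) y both equal -2 times the conjugate of χ(W). For c ≠ 0 this system
has the stated solution. -/
theorem Lam_weight (ha : a ∈ C.aS) (hℓ : IsDChar D χ ℓ) (hθ : IsUnitaryOn C ℓ)
    (hL : W ∈ lieAlg D.L) (hW : IsWeight C a W c) (hc : c ≠ 0) :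
    J.Lam W = -2 * (starRingEnd ℂ) (chiL χ W) / (1 + Real.exp (-2 * c)) := by
  have hμ := lieAlg_add D.L_algebraic hL (dσ_mem hL)
  have hσμ : D.dσ (W + D.dσ W) = W + D.dσ W := by
    rw [dσ_add hL (dσ_mem hL), dσ_dσ hL, add_comm]
  have hW' := hW.dσ ha hL
  have h1 := J.Lam_H (mem_lieH_of_fixed hμ hσμ)
  have hσθμ : D.dσ (C.dθ (W + D.dσ W)) = C.dθ (W + D.dσ W) := by rw [C.dσ_dθ hμ, hσμ]
  have h2 := J.Lam_H (mem_lieH_of_fixed (C.dθ_mem_L hμ) hσθμ)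
  rw [hθ _ hμ hσμ, C.dθ_add hW.mem hW'.mem, Lam_add, J.Lam_θ hW, J.Lam_θ hW'] at h2
  have h3 := congrArg (starRingEnd ℂ) h2
  simp only [map_add, map_mul, map_neg, Complex.conj_conj, Complex.conj_ofReal, neg_neg] at h3
  rw [Lam_add, ← two_mul_chiL hℓ hL, map_mul, Complex.conj_ofNat] at h1
  have hneg : Real.exp (-2 * -c) = Real.exp (2 * c) := by ring_nf
  rw [hneg] at h3
  have h4 : (starRingEnd ℂ) (ℓ W) + (starRingEnd ℂ) (ℓ (D.dσ W))
      = 2 * (starRingEnd ℂ) (chiL χ W) := by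
    rw [← map_add, ← map_add, ← two_mul_chiL hℓ hL, map_mul, Complex.conj_ofNat]
  rw [h4] at h3
  have hEF := cast_exp_mul_exp c
  have hE1 : (Real.exp (2 * c) : ℂ) - 1 ≠ 0 := by
    rw [sub_ne_zero]
    exact_mod_cast fun h => hc (by simpa using h)
  have hF1 : (1 + Real.exp (-2 * c) : ℂ) ≠ 0 := by
    have : (0 : ℝ) < 1 + Real.exp (-2 * c) := by positivity
    exact_mod_cast this.ne'
  rw [eq_div_iff hF1]
  refine mul_left_cancel₀ hE1 ?_
  linear_combination h3 + (Real.exp (2 * c) : ℂ) * h1 + J.Lam W * hEF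

theorem Lam_zero : J.Lam 0 = 0 := by simp [Lam]

theorem Lam_eq_zero_of_nilpotent (hℓ : IsDChar D χ ℓ) (hX : X ∈ lieAlg D.H)
    (hnil : IsNilpotent X) : J.Lam X = 0 := by
  rw [J.Lam_H hX, hℓ.nilpotent X hX hnil, map_zero, neg_zero]

theorem Lam_eq_zero_of_pos (hℓ : IsDChar D χ ℓ) (hX : X ∈ lieAlg D.G) {k : ℤ} (hk : 0 < k)
    (h : ∀ s : ℂˣ, Ad (D.lam s) X = ((s ^ k : ℂˣ) : ℂ) • X) : J.Lam X = 0 :=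
  J.Lam_eq_zero_of_nilpotent hℓ (liePu_le (mem_liePu_of_pos hX hk h)) (isNilpotent_of_pos hk h)

theorem ofReal_tanh_eq (c : ℝ) :
    (1 : ℂ) / (1 + Real.exp (-2 * c)) - 1 / (1 + Real.exp (2 * c)) = Complex.tanh c := by
  have h1 : (1 + Real.exp (-2 * c) : ℂ) ≠ 0 := by
    have : (0 : ℝ) < 1 + Real.exp (-2 * c) := by positivity
    exact_mod_cast this.ne'
  have h2 : (1 + Real.exp (2 * c) : ℂ) ≠ 0 := by
    have : (0 : ℝ) < 1 + Real.exp (2 * c) := by positivity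
    exact_mod_cast this.ne'
  have h3 : Complex.cosh c ≠ 0 := by
    rw [← Complex.ofReal_cosh]; exact_mod_cast (Real.cosh_pos c).ne'
  have e1 : (Real.exp (2 * c) : ℂ) = Complex.exp c * Complex.exp c := by
    rw [← Complex.exp_add]; push_cast; ring_nf
  have e2 : (Real.exp (-2 * c) : ℂ) = Complex.exp (-c) * Complex.exp (-c) := by
    rw [← Complex.exp_add]; push_cast; ring_nf
  have e3 : Complex.exp c * Complex.exp (-c) = 1 := by rw [← Complex.exp_add]; simp
  rw [Complex.tanh_eq_sinh_div_cosh, div_sub_div _ _ h1 h2, div_eq_div_iff (mul_ne_zero h1 h2) h3,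
    e1, e2, Complex.sinh, Complex.cosh]
  generalize Complex.exp c = E at *
  generalize Complex.exp (-c) = F at *
  have hEE : (E * E) * (F * F) = 1 := by linear_combination (E * F + 1) * e3
  linear_combination (-(E - F) / 2) * hEE + (E - F) * e3

/-- The key formula for root vectors of `L`. -/
theorem Lam_sub_dσ (R : ReferenceData C) (ha : a ∈ C.aS) (hreg : ∀ β ∈ C.rootsS, C.ev β a ≠ 0)
    (hℓ : IsDChar D χ ℓ) (hθ : IsUnitaryOn C ℓ) (hL : W ∈ lieAlg D.L) (hγ : W ∈ C.rootSpace γ)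
    (hγ1 : γ ≠ 1) (hW : IsWeight C a W c) :
    J.Lam (W - D.dσ W) = -2 * (starRingEnd ℂ) (chiL χ W) * Complex.tanh c := by
  by_cases h0 : W = 0
  · subst h0
    have hσ0 : D.dσ (0 : Mat n) = 0 := by simpa using dσ_smul (lieAlg_zero D.L) 0
    rw [hσ0, sub_zero, Lam_zero, chiL_of_fixed hℓ hL hσ0]
    simp
  -- If σ fixes γ then W = σ(W) is nilpotent in 𝔥 and both sides vanish. Otherwise γ is in Φ_s and
  -- regularity of a gives c ≠ 0.
  have hroot := mem_rootsL hγ h0 hL hγ1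
  by_cases hσ : C.σChar γ = γ
  · have h1 := R.dσ_eq_self hroot.1 hσ hγ hL
    have h2 := hℓ.nilpotent W (mem_lieH_of_fixed hL h1) (root_isNilpotent hroot.1 hγ)
    rw [h1, sub_self, Lam_zero, chiL_of_fixed hℓ hL h1, h2]
    simp
  · have hc : c ≠ 0 := by
      rintro rfl
      exact hreg γ ⟨hroot, hσ⟩ (by rw [hW.ev_eq ha hγ h0]; simp)
    rw [Lam_sub, J.Lam_weight ha hℓ hθ hL hW hc,
      J.Lam_weight ha hℓ hθ (dσ_mem hL) (hW.dσ ha hL) (neg_ne_zero.2 hc), chiL_dσ W hL,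
      ← ofReal_tanh_eq]
    have : -2 * -c = 2 * c := by ring
    rw [this]
    ring

end JetData

/-! ### The coefficients of the hermitian form in the reference basis -/

namespace CartanData

variable {D : HorosymmetricSpace n} {C : CartanData D} {β γ : C.Chars} {x : Mat n}

theorem chars_mul_inv_ne_one (h : β ≠ γ) : β * γ⁻¹ ≠ 1 := fun h1 =>
  h ((chars_eq_inv h1).trans (chars_inv_inv γ))

theorem σChar_inv (γ : C.Chars) : C.σChar γ⁻¹ = (C.σChar γ)⁻¹ := rfl

theorem ev_one (x : Mat n) : C.ev 1 x = 0 := ev_eq_of fun t => by simp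

theorem Ad_exp_neg_of_commute {a x : Mat n} (h : Commute a x) : Ad (expGL (-a)) x = x := by
  rw [Ad_exp (c := 0), Complex.exp_zero, one_smul]
  rw [JetData.neg_lie_mat, Ring.lie_def, h.eq, sub_self, neg_zero, zero_smul]

end CartanData

namespace JetData

variable {D : HorosymmetricSpace n} {C : CartanData D} {a : Mat n} {ℓ : Mat n →ₗ[ℂ] ℂ}
  (J : JetData C a ℓ) (R : ReferenceData C) {X Y W x y : Mat n} {c : ℝ} {χ : D.H →* ℂˣ}
  {α α₁ α₂ β β₁ β₂ γ : C.Chars} {u : Mat n → ℝ}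

open Complex (I)

/-- The jet restricts to the first and second differentials of `u` on `𝔞_s`. -/
structure Extends (J : JetData C a ℓ) (u : Mat n → ℝ) : Prop where
  lin_eq : ∀ x ∈ C.aS, J.lin x = diff1 u a x
  B_eq : ∀ x ∈ C.aS, ∀ y ∈ C.aS, J.B x y = diff2 u a x y

theorem lin_I_smul (ha : a ∈ C.aS) (hx : x ∈ C.aS) : J.lin (I • x) = 0 := by
  have h := J.lin_K _ (I_smul_mem_lieK hx)
  rwa [map_smul, Ad_exp_neg_of_commute (commute_lieT (aS_mem_T ha) (aS_mem_T hx))] at h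

/-- The vector ix lies in 𝔨 and commutes with a, so Ad(exp(-a)) does not move it. -/
theorem B_I_smul (ha : a ∈ C.aS) (hx : x ∈ C.aS) (hY : Y ∈ lieAlg D.G) :
    J.B (I • x) Y = 0 := by
  have h := J.B_K _ (I_smul_mem_lieK hx) Y hY
  rwa [map_smul, Ad_exp_neg_of_commute (commute_lieT (aS_mem_T ha) (aS_mem_T hx))] at h

theorem S_aS (ha : a ∈ C.aS) (hx : x ∈ C.aS) (hy : y ∈ C.aS) :
    J.S x y = (1 / 4 : ℂ) * (J.B x y : ℂ) := by
  have h1 : J.B x (I • y) = 0 := by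
    have h := J.B_sub x (I • y)
    rw [B_I_smul J ha hy (aS_mem_G hx), lie_I_smul, Ring.lie_def,
      (commute_lieT (aS_mem_T hx) (aS_mem_T hy)).eq, sub_self, smul_zero, map_zero] at h
    simpa using h
  rw [S, h1, B_I_smul J ha hx (aS_mem_G hy), B_I_smul J ha hx (lieAlg_smul (aS_mem_G hy) I)]
  simp

theorem Lam_aS (ha : a ∈ C.aS) (hx : x ∈ C.aS) : J.Lam x = (1 / 2 : ℂ) * (J.lin x : ℂ) := by
  rw [Lam, J.lin_I_smul ha hx]
  simp

theorem isWeight_coroot (ha : a ∈ C.aS) (hα : α ∈ C.roots) : IsWeight C a (R.coroot α) 0 := by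
  have h : ⁅a, R.coroot α⁆ = 0 := by
    rw [lie_rootSpace (aS_mem_T ha) (R.coroot_mem hα), ev_one, zero_smul]
  have hneg : ⁅a, -R.coroot α⁆ = -⁅a, R.coroot α⁆ := by
    simp only [Ring.lie_def]; noncomm_ring
  exact ⟨(R.coroot_mem hα).1, by simp [h], by rw [R.dθ_coroot hα, hneg, h]; simp⟩

theorem chiL_coroot_re (hℓ : IsDChar D χ ℓ) (hθ : IsUnitaryOn C ℓ) (hα : α ∈ C.roots) :
    ((chiL χ (R.coroot α)).re : ℂ) = chiL χ (R.coroot α) := by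
  have h := chiL_dθ hℓ hθ (R.coroot_mem_lieL hα)
  rw [R.dθ_coroot hα, ← neg_one_smul ℂ, chiL_smul hℓ (R.coroot_mem_lieL hα)] at h
  exact Complex.conj_eq_iff_re.1 (by linear_combination h)

theorem Lam_coroot (ha : a ∈ C.aS) (hu : J.Extends u) (hℓ : IsDChar D χ ℓ)
    (hθ : IsUnitaryOn C ℓ) (hα : α ∈ C.roots) :
    J.Lam (R.coroot α)
      = (1 / 2 : ℂ) * ((duP (D := D) u a (R.coroot α) : ℂ) - 2 * chiL χ (R.coroot α)) := by
  have h1 := J.Lam_θ (isWeight_coroot R ha hα)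
  rw [R.dθ_coroot hα, Lam_neg] at h1
  -- θ negates the coroot, which has weight zero, so `Lam_θ` makes Lam real there. What remains is
  -- lin, split as du on the 𝓟-part and χ on the 𝓗-part.
  have h2 : J.lin (I • R.coroot α) = 0 := by
    have h3 : (starRingEnd ℂ) (J.Lam (R.coroot α)) = J.Lam (R.coroot α) := by
      simpa using h1.symm
    have h4 := congrArg Complex.im h3
    simp only [Lam] at h4
    simp at h4
    linarith
  have hP := R.projP_coroot_mem_aS hα
  have hL := R.coroot_mem_lieL hα
  have h5 : J.lin (R.coroot α) = duP (D := D) u a (R.coroot α) - 2 * (chiL χ (R.coroot α)).re := by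
    conv_lhs => rw [R.coroot_eq α]
    rw [map_add, hu.lin_eq _ hP, J.lin_H _ (projH_mem_lieH hL), ← chiL_eq hℓ hL, duP]
    ring
  rw [Lam, h2, h5]
  push_cast
  rw [chiL_coroot_re R hℓ hθ hα]
  ring

theorem dθ_e_mem_lieH (hα : α ∈ C.rootsQu) : C.dθ (R.e α) ∈ lieAlg D.H :=
  liePu_le (hα.2 (R.dθ_rootSpace (R.rootsQu_mem_roots hα)
    (R.e_mem _ (R.rootsQu_mem_roots hα))))

theorem S_e (ha : a ∈ C.aS) (hα : α ∈ C.rootsQu) (hY : Y ∈ lieAlg D.G) :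
    J.S (R.e α) Y = Real.exp (2 * (C.ev α a).re) * J.Lam ⁅Y, C.dθ (R.e α)⁆ :=
  J.S_of_θ_mem (isWeight_root R ha (R.rootsQu_mem_roots hα) (R.e_mem _ (R.rootsQu_mem_roots hα)))
    (dθ_e_mem_lieH R hα) hY

/-- Bracketing with 𝔩 preserves the positive λ-weight of θ(e_α), so the bracket stays in the Lie
algebra of Pᵘ, where Lam vanishes. -/
theorem S_e_lieL (ha : a ∈ C.aS) (hℓ : IsDChar D χ ℓ) (hα : α ∈ C.rootsQu)
    (hY : Y ∈ lieAlg D.L) : J.S (R.e α) Y = 0 := by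
  have hr := R.rootsQu_mem_roots hα
  obtain ⟨k, hk, h⟩ := R.exists_pos_weight hα
  have he := R.dθ_rootSpace hr (R.e_mem _ hr)
  rw [J.S_e R ha hα (lieL_le hY), J.Lam_eq_zero_of_pos hℓ
    (lieAlg_lie D.G_algebraic (lieL_le hY) he.1) hk, mul_zero]
  intro s
  rw [Ad_lie, Ad_lam_of_mem_lieL hY, h _ he]
  simp [Ring.lie_def, smul_sub]

/-- Split by the sign of the λ-weight. Positive weight lies in the Lie algebra of Pᵘ; negative
weight reduces to it through θ; weight zero outside Φ_s means a σ-fixed root of L, whose root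
vectors are nilpotent elements of 𝔥. -/
theorem Lam_root_eq_zero (R : ReferenceData C) (ha : a ∈ C.aS) (hℓ : IsDChar D χ ℓ) (hγ : γ ≠ 1)
    (hS : γ ∉ C.rootsS) (hW : W ∈ C.rootSpace γ) : J.Lam W = 0 := by
  by_cases h0 : W = 0
  · rw [h0, Lam_zero]
  have hr : γ ∈ C.roots := ⟨hγ, W, hW, h0⟩
  obtain ⟨k, hk⟩ := exists_weight hW h0
  have hAd : ∀ s : ℂˣ, Ad (D.lam s) W = ((s ^ k : ℂˣ) : ℂ) • W := fun s => by
    rw [← hk s]; exact hW.2 ⟨D.lam s, C.lam_mem_T s⟩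
  rcases lt_trichotomy k 0 with hneg | rfl | hpos
  · have hW' := R.dθ_rootSpace hr hW
    have h1 : J.Lam (C.dθ W) = 0 := by
      refine J.Lam_eq_zero_of_pos hℓ hW'.1 (k := -k) (by omega) fun s => ?_
      have := hW'.2 ⟨D.lam s, C.lam_mem_T s⟩
      rw [MonoidHom.inv_apply, hk s] at this
      rw [zpow_neg]
      exact this
    rw [J.Lam_θ (isWeight_root R ha hr hW)] at h1
    have h2 : (-Real.exp (-2 * (C.ev γ a).re) : ℂ) ≠ 0 := by
      rw [neg_ne_zero]
      exact_mod_cast (Real.exp_pos _).ne'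
    simpa using (mul_eq_zero.1 h1).resolve_left h2
  · have hL : W ∈ lieAlg D.L := mem_lieL_of_fixed hW.1 fun s => by simpa using hAd s
    have hrL := mem_rootsL hW h0 hL hγ
    have hσ : C.σChar γ = γ := by
      by_contra h
      exact hS ⟨hrL, h⟩
    exact J.Lam_eq_zero_of_nilpotent hℓ (mem_lieH_of_fixed hL (R.dσ_eq_self hr hσ hW hL))
      (root_isNilpotent hr hW)
  · exact J.Lam_eq_zero_of_pos hℓ hW.1 hpos hAd

theorem lie_skew_mat (X Y : Mat n) : ⁅X, Y⁆ = -⁅Y, X⁆ := by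
  simp only [Ring.lie_def]; abel

theorem S_e_e (ha : a ∈ C.aS) (hreg : ∀ β ∈ C.rootsS, C.ev β a ≠ 0) (hu : J.Extends u)
    (hℓ : IsDChar D χ ℓ) (hθ : IsUnitaryOn C ℓ) (h₁ : α₁ ∈ C.rootsQu) (h₂ : α₂ ∈ C.rootsQu) :
    J.S (R.e α₁) (R.e α₂) = omegaAA R u χ a α₁ α₂ := by
  have hr₁ := R.rootsQu_mem_roots h₁
  have hr₂ := R.rootsQu_mem_roots h₂
  have he₁ := R.e_mem _ hr₁
  have he₂ := R.e_mem _ hr₂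
  have hy := rootSpace_lie he₂ (R.dθ_rootSpace hr₁ he₁)
  rw [J.S_e R ha h₁ he₂.1, omegaAA]
  split_ifs with h hS
  · subst h
    rw [lie_skew_mat, R.e_bracket _ hr₁, Lam_neg, J.Lam_coroot R ha hu hℓ hθ hr₁]
    have : (Real.exp (2 * (C.ev α₁ a).re) : ℂ) = Complex.exp (2 * C.ev α₁ a) := by
      push_cast
      rw [ofReal_re_ev R ha hr₁]
    rw [this]
    ring
  -- The bracket [e₂, θ(e₁)] is a vector of weight α₂ - α₁ in 𝔩, nonzero on a by regularity, so
  -- `Lam_weight` applies. Then `chiL_dθ` turns it into [θ(e₂), e₁].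
  · have hw := (isWeight_root R ha hr₂ he₂).lie_lie (isWeight_root R ha hr₁ he₁).θ
    have hL := hS.1.2 hy
    have hc : (C.ev α₂ a).re + -(C.ev α₁ a).re ≠ 0 := by
      intro h0
      have := hreg _ hS
      rw [ev_mul (aS_mem_T ha) hr₂ (R.inv_mem_roots hr₁), ev_inv (aS_mem_T ha) hr₁,
        ← ofReal_re_ev R ha hr₁, ← ofReal_re_ev R ha hr₂] at this
      exact this (by exact_mod_cast h0)
    have hχ := chiL_dθ hℓ hθ hL
    rw [C.dθ_lie he₂.1 (C.dθ_mem he₁.1), C.dθ_dθ he₁.1] at hχ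
    rw [J.Lam_weight ha hℓ hθ hL hw hc, hχ, ← ofReal_re_ev R ha hr₁, ← ofReal_re_ev R ha hr₂]
    generalize (C.ev α₁ a).re = c₁
    generalize (C.ev α₂ a).re = c₂
    have e1 : (Real.exp (2 * c₁) : ℂ) * Complex.exp (-2 * c₁) = 1 := by
      push_cast; rw [← Complex.exp_add]; simp
    have e2 : (Real.exp (-2 * (c₂ + -c₁)) : ℂ) = Real.exp (2 * c₁) * Complex.exp (-2 * c₂) := by
      push_cast; rw [← Complex.exp_add]; ring_nf
    have n1 : (1 + Real.exp (-2 * (c₂ + -c₁)) : ℂ) ≠ 0 := by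
      have : (0 : ℝ) < 1 + Real.exp (-2 * (c₂ + -c₁)) := by positivity
      exact_mod_cast this.ne'
    have n2 : (Complex.exp (-2 * c₁) + Complex.exp (-2 * c₂) : ℂ) ≠ 0 := by
      have : (0 : ℝ) < Real.exp (-2 * c₁) + Real.exp (-2 * c₂) := by positivity
      exact_mod_cast this.ne'
    rw [← mul_div_assoc, div_eq_div_iff n1 n2, e2]
    linear_combination -2 * (starRingEnd ℂ) (chiL χ ⁅R.e α₂, C.dθ (R.e α₁)⁆) * e1
  · rw [J.Lam_root_eq_zero R ha hℓ (chars_mul_inv_ne_one (Ne.symm h)) hS hy, mul_zero]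

/-! #### The roots of the symmetric fiber -/

theorem rootsSPos_mem_roots (hβ : β ∈ R.rootsSPos) : β ∈ C.roots := R.pos_subset hβ.1

theorem e_mem_lieL (hβ : β ∈ R.rootsSPos) : R.e β ∈ lieAlg D.L :=
  hβ.2.1.2 (R.e_mem _ (rootsSPos_mem_roots R hβ))

theorem tau_mem_lieL (hβ : β ∈ R.rootsSPos) : R.tau β ∈ lieAlg D.L :=
  lieAlg_sub D.L_algebraic (e_mem_lieL R hβ) (dσ_mem (e_mem_lieL R hβ))

theorem mu_mem_lieL (hβ : β ∈ R.rootsSPos) : R.mu β ∈ lieAlg D.L :=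
  lieAlg_add D.L_algebraic (e_mem_lieL R hβ) (dσ_mem (e_mem_lieL R hβ))

theorem dσ_mu (hβ : β ∈ R.rootsSPos) : D.dσ (R.mu β) = R.mu β := by
  have hL := e_mem_lieL R hβ
  rw [mu, dσ_add hL (dσ_mem hL), dσ_dσ hL, add_comm]

theorem dθ_mu (hβ : β ∈ R.rootsSPos) :
    C.dθ (R.mu β) = C.dθ (R.e β) + D.dσ (C.dθ (R.e β)) := by
  have hL := e_mem_lieL R hβ
  rw [mu, C.dθ_add (lieL_le hL) (lieL_le (dσ_mem hL)), C.dσ_dθ hL]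

theorem isWeight_e (ha : a ∈ C.aS) (hβ : β ∈ R.rootsSPos) :
    IsWeight C a (R.e β) (C.ev β a).re :=
  isWeight_root R ha (rootsSPos_mem_roots R hβ) (R.e_mem _ (rootsSPos_mem_roots R hβ))

theorem re_ev_ne_zero (ha : a ∈ C.aS) (hreg : ∀ β ∈ C.rootsS, C.ev β a ≠ 0)
    (hβ : β ∈ R.rootsSPos) : (C.ev β a).re ≠ 0 := fun h => hreg β hβ.2 (by
  rw [← ofReal_re_ev R ha (rootsSPos_mem_roots R hβ), h, Complex.ofReal_zero])

theorem S_tau (ha : a ∈ C.aS) (hreg : ∀ β ∈ C.rootsS, C.ev β a ≠ 0) (hβ : β ∈ R.rootsSPos)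
    (hY : Y ∈ lieAlg D.G) : J.S (R.tau β) Y
      = -(1 / Real.sinh (2 * (C.ev β a).re) : ℝ) * J.Lam ⁅Y, C.dθ (R.mu β)⁆ := by
  have hμ := mu_mem_lieL R hβ
  have hσθ : D.dσ (C.dθ (R.mu β)) = C.dθ (R.mu β) := by rw [C.dσ_dθ hμ, dσ_mu R hβ]
  exact J.S_sub_of_add_mem (isWeight_e R ha hβ) ((isWeight_e R ha hβ).dσ ha (e_mem_lieL R hβ))
    (re_ev_ne_zero R ha hreg hβ) (mem_lieH_of_fixed hμ (dσ_mu R hβ))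
    (mem_lieH_of_fixed (C.dθ_mem_L hμ) hσθ) hY

theorem S_tau_aS (ha : a ∈ C.aS) (hreg : ∀ β ∈ C.rootsS, C.ev β a ≠ 0)
    (hℓ : IsDChar D χ ℓ) (hθ : IsUnitaryOn C ℓ) (hβ : β ∈ R.rootsSPos) (hx : x ∈ C.aS) :
    J.S (R.tau β) x = (starRingEnd ℂ) ((1 / 2 : ℂ) * C.ev β x * (1 - Complex.tanh (C.ev β a) ^ 2)
      * chiL χ (C.dθ (R.mu β))) := by
  have hr := rootsSPos_mem_roots R hβ
  have hL := e_mem_lieL R hβ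
  have hf := R.dθ_rootSpace hr (R.e_mem _ hr)
  have hfL := C.dθ_mem_L hL
  have h1 : ⁅x, C.dθ (R.e β)⁆ = -C.ev β x • C.dθ (R.e β) := by
    rw [lie_rootSpace (aS_mem_T hx) hf, ev_inv (aS_mem_T hx) hr]
  have h2 : ⁅x, D.dσ (C.dθ (R.e β))⁆ = C.ev β x • D.dσ (C.dθ (R.e β)) := by
    have := congrArg D.dσ h1
    rw [dσ_lie (aS_mem_L hx) hfL, dσ_aS hx, dσ_smul hfL, neg_lie_mat, neg_smul] at this
    exact neg_injective this
  have h3 : ⁅x, C.dθ (R.mu β)⁆ = ((-(C.ev β x).re : ℝ) : ℂ) •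
      (C.dθ (R.e β) - D.dσ (C.dθ (R.e β))) := by
    have hadd : ∀ A B : Mat n, ⁅x, A + B⁆ = ⁅x, A⁆ + ⁅x, B⁆ := fun A B => by
      simp only [Ring.lie_def]; noncomm_ring
    rw [dθ_mu R hβ, hadd, h1, h2, Complex.ofReal_neg, ofReal_re_ev R hx hr, smul_sub, neg_smul,
      neg_smul]
    abel
  have h4 : chiL χ (C.dθ (R.mu β)) = 2 * chiL χ (C.dθ (R.e β)) := by
    rw [dθ_mu R hβ, chiL_add hℓ hfL (dσ_mem hfL), chiL_dσ _ hfL, two_mul]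
  have hw := (isWeight_e R ha hβ).θ
  have h5 := J.Lam_sub_dσ R ha hreg hℓ hθ hfL hf (R.inv_mem_roots hr).1 hw
  have hc := re_ev_ne_zero R ha hreg hβ
  rw [J.S_tau R ha hreg hβ (aS_mem_G hx), h3, Lam_real_smul, h5, h4,
    ← ofReal_re_ev R ha hr, ← ofReal_re_ev R hx hr]
  generalize (C.ev β a).re = c at hc
  simp only [map_mul, map_sub, map_pow, map_one, map_div₀, Complex.conj_ofReal, Complex.conj_ofNat,
    ← Complex.ofReal_tanh, Complex.ofReal_re, Real.tanh_neg]
  have hcosh := (Real.cosh_pos c).ne'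
  have hsinh : Real.sinh c ≠ 0 := by rwa [Ne, Real.sinh_eq_zero]
  have key : 1 / Real.sinh (2 * c) * Real.tanh c * 2 = 1 - Real.tanh c ^ 2 := by
    rw [Real.tanh_eq_sinh_div_cosh, Real.sinh_two_mul]
    field_simp
    linarith [Real.cosh_sq c]
  have key' : ((1 / Real.sinh (2 * c) : ℝ) : ℂ) * (Real.tanh c : ℝ) * 2
      = 1 - (Real.tanh c : ℝ) ^ 2 := by
    exact_mod_cast key
  push_cast at key' ⊢
  linear_combination ((C.ev β x).re * (starRingEnd ℂ) (chiL χ (C.dθ (R.e β)))) * key'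

/-- The bracket is sorted into two terms of the shape Z - σ(Z) with Z a weight vector, the shape
that `Lam_sub_dσ` evaluates. -/
theorem lie_tau_dθ_mu (h₁ : β₁ ∈ R.rootsSPos) (h₂ : β₂ ∈ R.rootsSPos) :
    ⁅R.tau β₂, C.dθ (R.mu β₁)⁆
      = (⁅R.e β₂, C.dθ (R.e β₁)⁆ - D.dσ ⁅R.e β₂, C.dθ (R.e β₁)⁆)
        + (⁅R.e β₂, D.dσ (C.dθ (R.e β₁))⁆ - D.dσ ⁅R.e β₂, D.dσ (C.dθ (R.e β₁))⁆) := by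
  have hL₁ := C.dθ_mem_L (e_mem_lieL R h₁)
  have hL₂ := e_mem_lieL R h₂
  rw [dθ_mu R h₁, dσ_lie hL₂ hL₁, dσ_lie hL₂ (dσ_mem hL₁), dσ_dσ hL₁, tau]
  simp only [Ring.lie_def]
  noncomm_ring

/-- The adapted positive system makes -σ(β₁) positive, so β₂ - σ(β₁) is a sum of two positive roots
and cannot vanish. -/
theorem mul_σChar_inv_ne_one (h₁ : β₁ ∈ R.rootsSPos) (h₂ : β₂ ∈ R.rootsSPos) :
    β₂ * C.σChar β₁⁻¹ ≠ 1 := by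
  rw [σChar_inv]
  intro h
  rcases R.pos_adapted β₁ ⟨h₁.1, h₁.2.1⟩ with h' | h'
  · exact h₁.2.2 h'
  · refine R.pos_not _ h'.1 ?_
    rw [← chars_eq_inv h]
    exact h₂.1

/-- The contribution of the brackets `[e₂, σθ(e₁)]`, which are never of weight zero. -/
theorem Lam_lie_dσ (ha : a ∈ C.aS) (hreg : ∀ β ∈ C.rootsS, C.ev β a ≠ 0)
    (hℓ : IsDChar D χ ℓ) (hθ : IsUnitaryOn C ℓ) (h₁ : β₁ ∈ R.rootsSPos)
    (h₂ : β₂ ∈ R.rootsSPos) :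
    J.Lam (⁅R.e β₂, D.dσ (C.dθ (R.e β₁))⁆ - D.dσ ⁅R.e β₂, D.dσ (C.dθ (R.e β₁))⁆)
      = 2 * chiL χ ⁅C.dθ (R.e β₂), D.dσ (R.e β₁)⁆
        * Complex.tanh (((C.ev β₂ a).re + (C.ev β₁ a).re : ℝ)) := by
  have hL₁ := e_mem_lieL R h₁
  have hL₂ := e_mem_lieL R h₂
  have hθL := C.dθ_mem_L hL₁
  have hr₁ := rootsSPos_mem_roots R h₁
  have hr₂ := rootsSPos_mem_roots R h₂
  have hz := rootSpace_lie (R.e_mem _ hr₂)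
    (dσ_rootSpace (R.dθ_rootSpace hr₁ (R.e_mem _ hr₁)) hθL)
  have hzL := lieAlg_lie D.L_algebraic hL₂ (dσ_mem hθL)
  have hw := (isWeight_e R ha h₂).lie_lie ((isWeight_e R ha h₁).θ.dσ ha hθL)
  have hχ := chiL_dθ hℓ hθ hzL
  rw [C.dθ_lie (lieL_le hL₂) (lieL_le (dσ_mem hθL)), ← C.dσ_dθ hθL, C.dθ_dθ (lieL_le hL₁)] at hχ
  rw [J.Lam_sub_dσ R ha hreg hℓ hθ hzL hz (mul_σChar_inv_ne_one R h₁ h₂) hw, hχ, neg_neg]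
  ring

theorem Lam_lie (ha : a ∈ C.aS) (hreg : ∀ β ∈ C.rootsS, C.ev β a ≠ 0)
    (hℓ : IsDChar D χ ℓ) (hθ : IsUnitaryOn C ℓ) (h₁ : β₁ ∈ R.rootsSPos)
    (h₂ : β₂ ∈ R.rootsSPos) (h : β₁ ≠ β₂) :
    J.Lam (⁅R.e β₂, C.dθ (R.e β₁)⁆ - D.dσ ⁅R.e β₂, C.dθ (R.e β₁)⁆)
      = 2 * chiL χ ⁅C.dθ (R.e β₂), R.e β₁⁆
        * Complex.tanh (((C.ev β₂ a).re - (C.ev β₁ a).re : ℝ)) := by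
  have hL₁ := e_mem_lieL R h₁
  have hL₂ := e_mem_lieL R h₂
  have hθL := C.dθ_mem_L hL₁
  have hr₁ := rootsSPos_mem_roots R h₁
  have hr₂ := rootsSPos_mem_roots R h₂
  have hy := rootSpace_lie (R.e_mem _ hr₂) (R.dθ_rootSpace hr₁ (R.e_mem _ hr₁))
  have hyL := lieAlg_lie D.L_algebraic hL₂ hθL
  have hw := (isWeight_e R ha h₂).lie_lie (isWeight_e R ha h₁).θ
  have hχ := chiL_dθ hℓ hθ hyL
  rw [C.dθ_lie (lieL_le hL₂) (lieL_le hθL), C.dθ_dθ (lieL_le hL₁)] at hχ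
  rw [J.Lam_sub_dσ R ha hreg hℓ hθ hyL hy (chars_mul_inv_ne_one h.symm) hw, hχ, sub_eq_add_neg]
  ring

theorem chiL_lie_conj (hℓ : IsDChar D χ ℓ) (hθ : IsUnitaryOn C ℓ) (hX : X ∈ lieAlg D.L)
    (hY : Y ∈ lieAlg D.L) :
    (starRingEnd ℂ) (chiL χ ⁅C.dθ X, Y⁆) = chiL χ ⁅C.dθ Y, X⁆ := by
  have hθX := C.dθ_mem_L hX
  have h := chiL_dθ hℓ hθ (lieAlg_lie D.L_algebraic hθX hY)
  rw [C.dθ_lie (lieL_le hθX) (lieL_le hY), C.dθ_dθ (lieL_le hX), lie_skew_mat, ← neg_one_smul ℂ,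
    chiL_smul hℓ (lieAlg_lie D.L_algebraic (C.dθ_mem_L hY) hX)] at h
  linear_combination h

theorem chiL_lie_dσ_conj (hℓ : IsDChar D χ ℓ) (hθ : IsUnitaryOn C ℓ) (hX : X ∈ lieAlg D.L)
    (hY : Y ∈ lieAlg D.L) :
    (starRingEnd ℂ) (chiL χ ⁅C.dθ X, D.dσ Y⁆) = chiL χ ⁅C.dθ Y, D.dσ X⁆ := by
  rw [chiL_lie_conj hℓ hθ hX (dσ_mem hY),
    ← chiL_dσ _ (lieAlg_lie D.L_algebraic (C.dθ_mem_L (dσ_mem hY)) hX),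
    dσ_lie (C.dθ_mem_L (dσ_mem hY)) hX, C.dσ_dθ (dσ_mem hY), dσ_dσ hY]

/-- Conjugating χ of such a bracket swaps the two vectors, and χ∘𝓗 is σ-invariant; together these
match ℜ of one bracket with the other. -/
theorem chiL_reK (hℓ : IsDChar D χ ℓ) (hθ : IsUnitaryOn C ℓ) (hX : X ∈ lieAlg D.L) :
    chiL χ (C.reK ⁅C.dθ (D.dσ X), X⁆) = chiL χ ⁅C.dθ X, D.dσ X⁆ := by
  have hw := lieAlg_lie D.L_algebraic (C.dθ_mem_L (dσ_mem hX)) hX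
  have e1 := chiL_lie_conj hℓ hθ (dσ_mem hX) hX
  have e2 := chiL_lie_dσ_conj hℓ hθ hX hX
  rw [reK, chiL_smul hℓ (lieAlg_sub D.L_algebraic hw (C.dθ_mem_L hw)),
    chiL_sub hℓ hw (C.dθ_mem_L hw), chiL_dθ hℓ hθ hw, e1]
  have e3 := congrArg (starRingEnd ℂ) e1
  rw [Complex.conj_conj] at e3
  rw [e3, e2]
  ring

/-- The bracket [e_β, θ(e_β)] is minus the coroot, whose 𝓟-part contributes du; the bracket with
σθ(e_β) has weight 2β(a) under a and contributes χ with a factor tanh 2β = sinh 2β / cosh 2β. -/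
theorem S_tau_tau_self (ha : a ∈ C.aS) (hreg : ∀ β ∈ C.rootsS, C.ev β a ≠ 0)
    (hu : J.Extends u) (hℓ : IsDChar D χ ℓ) (hθ : IsUnitaryOn C ℓ) (hβ : β ∈ R.rootsSPos) :
    J.S (R.tau β) (R.tau β) = omegaBB R u χ a β β := by
  have hr := rootsSPos_mem_roots R hβ
  have hL := e_mem_lieL R hβ
  have hcL := R.coroot_mem_lieL hr
  have hP := R.projP_coroot_mem_aS hr
  have h1 : ⁅R.e β, C.dθ (R.e β)⁆ - D.dσ ⁅R.e β, C.dθ (R.e β)⁆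
      = ((-2 : ℝ) : ℂ) • D.projP (R.coroot β) := by
    rw [lie_skew_mat, R.e_bracket _ hr, dσ_neg hcL, projP, smul_smul]
    push_cast
    norm_num
    abel
  have h2 : J.Lam (⁅R.e β, C.dθ (R.e β)⁆ - D.dσ ⁅R.e β, C.dθ (R.e β)⁆)
      = -(duP (D := D) u a (R.coroot β) : ℂ) := by
    rw [h1, Lam_real_smul, J.Lam_aS ha hP, hu.lin_eq _ hP, duP]
    push_cast
    ring
  rw [J.S_tau R ha hreg hβ (lieL_le (tau_mem_lieL R hβ)), lie_tau_dθ_mu R hβ hβ, Lam_add, h2,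
    J.Lam_lie_dσ R ha hreg hℓ hθ hβ hβ, omegaBB, if_pos rfl,
    chiL_reK hℓ hθ hL, ← ofReal_re_ev R ha hr]
  have hc := re_ev_ne_zero R ha hreg hβ
  generalize (C.ev β a).re = c at hc
  have hs : Real.sinh (2 * c) ≠ 0 := by rw [Ne, Real.sinh_eq_zero]; simpa using hc
  have hch := (Real.cosh_pos (2 * c)).ne'
  have e : c + c = 2 * c := by ring
  have e' : (2 * c : ℂ) = ((2 * c : ℝ) : ℂ) := by push_cast; rfl
  rw [e, e', Complex.tanh_eq_sinh_div_cosh, ← Complex.ofReal_sinh, ← Complex.ofReal_cosh]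
  have hs' : (Real.sinh (2 * c) : ℂ) ≠ 0 := by exact_mod_cast hs
  have hch' : (Real.cosh (2 * c) : ℂ) ≠ 0 := by exact_mod_cast hch
  rw [Complex.ofReal_div, Complex.ofReal_one]
  field_simp
  ring

theorem S_tau_tau_aux (ha : a ∈ C.aS) (hreg : ∀ β ∈ C.rootsS, C.ev β a ≠ 0)
    (hℓ : IsDChar D χ ℓ) (hθ : IsUnitaryOn C ℓ) (h₁ : β₁ ∈ R.rootsSPos)
    (h₂ : β₂ ∈ R.rootsSPos) (h : β₁ ≠ β₂) :
    J.S (R.tau β₁) (R.tau β₂) = -(1 / Complex.sinh (2 * C.ev β₁ a)) *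
      (2 * chiL χ ⁅C.dθ (R.e β₂), R.e β₁⁆ * Complex.tanh (C.ev β₂ a - C.ev β₁ a)
        + 2 * chiL χ ⁅C.dθ (R.e β₂), D.dσ (R.e β₁)⁆ * Complex.tanh (C.ev β₁ a + C.ev β₂ a)) := by
  rw [J.S_tau R ha hreg h₁ (lieL_le (tau_mem_lieL R h₂)), lie_tau_dθ_mu R h₁ h₂, Lam_add,
    J.Lam_lie_dσ R ha hreg hℓ hθ h₁ h₂, J.Lam_lie R ha hreg hℓ hθ h₁ h₂ h]
  push_cast
  rw [ofReal_re_ev R ha (rootsSPos_mem_roots R h₁), ofReal_re_ev R ha (rootsSPos_mem_roots R h₂),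
    add_comm (C.ev β₂ a)]

theorem S_tau_tau (ha : a ∈ C.aS) (hreg : ∀ β ∈ C.rootsS, C.ev β a ≠ 0)
    (hu : J.Extends u) (hℓ : IsDChar D χ ℓ) (hθ : IsUnitaryOn C ℓ) (h₁ : β₁ ∈ R.rootsSPos)
    (h₂ : β₂ ∈ R.rootsSPos) : J.S (R.tau β₁) (R.tau β₂) = omegaBB R u χ a β₁ β₂ := by
  by_cases h : β₁ = β₂
  · subst h
    exact J.S_tau_tau_self R ha hreg hu hℓ hθ h₁
  have hr₁ := rootsSPos_mem_roots R h₁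
  have hr₂ := rootsSPos_mem_roots R h₂
  have e1 := J.S_tau_tau_aux R ha hreg hℓ hθ h₁ h₂ h
  have e2 := congrArg (starRingEnd ℂ) (J.S_tau_tau_aux R ha hreg hℓ hθ h₂ h₁ (Ne.symm h))
  rw [S_conj] at e2
  simp only [map_mul, map_neg, map_add, map_div₀, map_one, Complex.conj_ofNat, map_sub,
    ← Complex.sinh_conj, ← Complex.tanh_conj, R.conj_ev hr₁ ha, R.conj_ev hr₂ ha,
    chiL_lie_conj hℓ hθ (e_mem_lieL R h₁) (e_mem_lieL R h₂),
    chiL_lie_dσ_conj hℓ hθ (e_mem_lieL R h₁) (e_mem_lieL R h₂)] at e2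
  have e3 : Complex.tanh (C.ev β₁ a - C.ev β₂ a) = -Complex.tanh (C.ev β₂ a - C.ev β₁ a) := by
    rw [← Complex.tanh_neg, neg_sub]
  rw [e3, add_comm (C.ev β₂ a)] at e2
  rw [omegaBB, if_neg h]
  -- `e1` treats β₁ and β₂ asymmetrically. S is hermitian, so averaging with the conjugate for
  -- exchanged roots gives the symmetric formula.
  linear_combination (1 / 2 : ℂ) * e1 + (1 / 2 : ℂ) * e2

theorem l_mem_aS (j : Fin R.r) : R.l j ∈ C.aS := by
  rw [← R.l_span]
  exact Submodule.subset_span ⟨j, rfl⟩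

theorem S_basisVec (ha : a ∈ C.aS) (hreg : ∀ β ∈ C.rootsS, C.ev β a ≠ 0)
    (hu : J.Extends u) (hℓ : IsDChar D χ ℓ) (hθ : IsUnitaryOn C ℓ) (i j : R.Idx) :
    J.S (R.basisVec i) (R.basisVec j) = omega R u χ a i j := by
  have hl := l_mem_aS R
  rcases i with i | i | i <;> rcases j with j | j | j
  · exact (J.S_aS ha (hl i) (hl j)).trans (by rw [hu.B_eq _ (hl i) _ (hl j)]; rfl)
  · change J.S (R.l i) (R.e j) = 0
    rw [← S_conj, J.S_e_lieL R ha hℓ j.2 (aS_mem_L (hl i)), map_zero]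
  · change J.S (R.l i) (R.tau j) = omegaJB R χ a i j
    rw [← S_conj, J.S_tau_aS R ha hreg hℓ hθ j.2 (hl i), Complex.conj_conj, omegaJB]
  · exact J.S_e_lieL R ha hℓ i.2 (aS_mem_L (hl j))
  · exact J.S_e_e R ha hreg hu hℓ hθ i.2 j.2
  · exact J.S_e_lieL R ha hℓ i.2 (tau_mem_lieL R j.2)
  · exact J.S_tau_aS R ha hreg hℓ hθ i.2 (hl j)
  · change J.S (R.tau i) (R.e j) = 0
    rw [← S_conj, J.S_e_lieL R ha hℓ j.2 (tau_mem_lieL R i.2), map_zero]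
  · exact J.S_tau_tau R ha hreg hu hℓ hθ i.2 j.2

end JetData

/-! ### Second order jets along one-parameter groups -/

section Jets

variable {A : Type*} [NormedRing A] [NormedAlgebra ℝ A] [CompleteSpace A] {Φ : A → ℝ} {g : A}

theorem eventually_differentiableAt_of_contDiffAt {E F : Type*} [NormedAddCommGroup E]
    [NormedSpace ℝ E] [NormedAddCommGroup F] [NormedSpace ℝ F] {f : E → F} {x : E}
    (h : ContDiffAt ℝ 2 f x) : ∀ᶠ y in 𝓝 x, DifferentiableAt ℝ f y :=
  (h.eventually (by simp)).mono fun _ hy => hy.differentiableAt (by simp)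

theorem hasDerivAt_fderiv_apply {E : Type*} [NormedAddCommGroup E] [NormedSpace ℝ E] {f : E → ℝ}
    {x c' w' : E} {c w : ℝ → E} (hf : ContDiffAt ℝ 2 f x) (h0 : c 0 = x) (hc : HasDerivAt c c' 0)
    (hw : HasDerivAt w w' 0) :
    HasDerivAt (fun s : ℝ => fderiv ℝ f (c s) (w s))
      (fderiv ℝ (fderiv ℝ f) x c' (w 0) + fderiv ℝ f x w') 0 := by
  subst h0
  have h1 : HasFDerivAt (fderiv ℝ f) (fderiv ℝ (fderiv ℝ f) (c 0)) (c 0) :=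
    ((hf.fderiv_right (m := 1) (by norm_num)).differentiableAt (by simp)).hasFDerivAt
  have h2 : HasDerivAt (fun s => fderiv ℝ f (c s)) (fderiv ℝ (fderiv ℝ f) (c 0) c') 0 :=
    h1.comp_hasDerivAt (0 : ℝ) hc
  exact h2.clm_apply hw

theorem hasDerivAt_mul_exp (g X : A) : HasDerivAt (fun t : ℝ => g * exp (t • X)) (g * X) 0 :=
  (hasDerivAt_exp_smul_zero X).const_mul g

theorem hasDerivAt_jet_one (hΦ : DifferentiableAt ℝ Φ g) (X : A) :
    HasDerivAt (fun t : ℝ => Φ (g * exp (t • X))) (fderiv ℝ Φ g (g * X)) 0 := by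
  have h0 : g * exp ((0 : ℝ) • X) = g := by simp
  have h1 := hΦ.hasFDerivAt
  rw [← h0] at h1
  have h2 := h1.comp_hasDerivAt (0 : ℝ) (hasDerivAt_mul_exp g X)
  rwa [h0] at h2

theorem hasDerivAt_jet_two (hΦ : ContDiffAt ℝ 2 Φ g) (X Y : A) :
    HasDerivAt (fun s : ℝ => deriv (fun t : ℝ => Φ (g * exp (s • X) * exp (t • Y))) 0)
      (fderiv ℝ (fderiv ℝ Φ) g (g * X) (g * Y) + fderiv ℝ Φ g (g * X * Y)) 0 := by
  have h0 : g * exp ((0 : ℝ) • X) = g := by simp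
  have hc := hasDerivAt_mul_exp g X
  have ht : Tendsto (fun t : ℝ => g * exp (t • X)) (𝓝 0) (𝓝 g) := by
    have := hc.continuousAt.tendsto
    rwa [h0] at this
  have hev : ∀ᶠ s : ℝ in 𝓝 0, deriv (fun t : ℝ => Φ (g * exp (s • X) * exp (t • Y))) 0
      = fderiv ℝ Φ (g * exp (s • X)) (g * exp (s • X) * Y) :=
    (ht.eventually (eventually_differentiableAt_of_contDiffAt hΦ)).mono fun s hs =>
      (hasDerivAt_jet_one hs Y).deriv
  have h1 := hasDerivAt_fderiv_apply hΦ h0 hc (hc.mul_const Y)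
  rw [h0] at h1
  exact h1.congr_of_eventuallyEq hev

/-- The second Fréchet derivative is symmetric, so only the first derivative applied to g(XY - YX)
survives in the commutator. -/
theorem exists_jet (hΦ : ContDiffAt ℝ 2 Φ g) :
    ∃ (lin : A →ₗ[ℝ] ℝ) (B : A →ₗ[ℝ] A →ₗ[ℝ] ℝ),
      (∀ X, HasDerivAt (fun t : ℝ => Φ (g * exp (t • X))) (lin X) 0) ∧
      (∀ X Y, HasDerivAt
        (fun s : ℝ => deriv (fun t : ℝ => Φ (g * exp (s • X) * exp (t • Y))) 0) (B X Y) 0) ∧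
      ∀ X Y, B X Y - B Y X = lin (X * Y - Y * X) := by
  refine ⟨(fderiv ℝ Φ g).toLinearMap ∘ₗ LinearMap.mulLeft ℝ g,
    LinearMap.mk₂ ℝ (fun X Y => fderiv ℝ (fderiv ℝ Φ) g (g * X) (g * Y) + fderiv ℝ Φ g (g * X * Y))
      ?_ ?_ ?_ ?_, fun X => hasDerivAt_jet_one (hΦ.differentiableAt (by simp)) X,
    fun X Y => hasDerivAt_jet_two hΦ X Y, fun X Y => ?_⟩
  · intro X X' Y
    simp only [mul_add, add_mul, map_add, _root_.add_apply]
    ring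
  · intro c X Y
    simp only [mul_smul_comm, smul_mul_assoc, map_smul, _root_.smul_apply, smul_add]
  · intro X Y Y'
    simp only [mul_add, map_add]
    ring
  · intro c X Y
    simp only [mul_smul_comm, map_smul, smul_add]
  · have hs := hΦ.isSymmSndFDerivAt (by simp) (g * X) (g * Y)
    simp only [LinearMap.mk₂_apply, LinearMap.comp_apply, LinearMap.mulLeft_apply,
      ContinuousLinearMap.coe_coe, hs, map_sub, mul_assoc]
    ring

theorem exp_add_smul (X : A) (s t : ℝ) : exp ((s + t) • X) = exp (s • X) * exp (t • X) := by
  let _ : NormedAlgebra ℚ A := NormedAlgebra.restrictScalars ℚ ℝ A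
  rw [add_smul, exp_add_of_commute]
  exact ((Commute.refl X).smul_left s).smul_right t

variable {E : Type*} [NormedAddCommGroup E] [NormedSpace ℝ E]

theorem contDiffAt_comp_exp {k : WithTop ℕ∞} (hΦ : ContDiffAt ℝ k Φ g) (Z : E →L[ℝ] A) :
    ContDiffAt ℝ k (fun z => Φ (g * exp (Z z))) 0 := by
  have h1 : ContDiffAt ℝ k (fun z : E => g * exp (Z z)) 0 :=
    contDiffAt_const.mul ((exp_analytic (𝕂 := ℝ) (Z 0)).contDiffAt.comp (0 : E)
      Z.contDiff.contDiffAt)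
  refine ContDiffAt.comp (0 : E) ?_ h1
  simpa using hΦ

/-- Along a single direction exp((s + t)Zv) is the product of the two exponentials, so the
coordinate Hessian and B agree on the diagonal. Polarization then yields the symmetrized B. -/
theorem iteratedFDeriv_comp_exp_self (hΦ : ContDiffAt ℝ 2 Φ g) {B : A →ₗ[ℝ] A →ₗ[ℝ] ℝ}
    (hB : ∀ X Y, HasDerivAt
      (fun s : ℝ => deriv (fun t : ℝ => Φ (g * exp (s • X) * exp (t • Y))) 0) (B X Y) 0)
    (Z : E →L[ℝ] A) (v : E) :
    fderiv ℝ (fderiv ℝ fun z => Φ (g * exp (Z z))) 0 v v = B (Z v) (Z v) := by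
  obtain ⟨F, hF⟩ : ∃ F : E → ℝ, F = fun z => Φ (g * exp (Z z)) := ⟨_, rfl⟩
  rw [← hF]
  have hFd : ContDiffAt ℝ 2 F 0 := hF ▸ contDiffAt_comp_exp hΦ Z
  have hl : ∀ s : ℝ, HasDerivAt (fun s : ℝ => s • v) v s := fun s => by
    simpa using (hasDerivAt_id s).smul_const v
  have ht : Tendsto (fun s : ℝ => s • v) (𝓝 0) (𝓝 (0 : E)) := by
    simpa using (hl 0).continuousAt.tendsto
  have hev : ∀ᶠ s : ℝ in 𝓝 0,
      deriv (fun t : ℝ => Φ (g * exp (s • Z v) * exp (t • Z v))) 0 = fderiv ℝ F (s • v) v := by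
    refine (ht.eventually (eventually_differentiableAt_of_contDiffAt hFd)).mono fun s hs => ?_
    have h1 : HasDerivAt (fun t : ℝ => F (t • v)) (fderiv ℝ F (s • v) v) s := by
      have h := hs.hasFDerivAt
      exact HasFDerivAt.comp_hasDerivAt (f := fun t : ℝ => t • v) s h (hl s)
    have h2 : (fun t : ℝ => Φ (g * exp (s • Z v) * exp (t • Z v))) = fun t => F ((s + t) • v) := by
      funext t
      simp only [hF, map_smul, mul_assoc, exp_add_smul]
    rw [h2]
    have h3 : HasDerivAt (fun t : ℝ => F (t • v)) (fderiv ℝ F (s • v) v) (s + 0) := by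
      rwa [add_zero]
    exact (h3.comp_const_add s 0).deriv
  have h4 := (hB (Z v) (Z v)).congr_of_eventuallyEq (hev.mono fun s hs => hs.symm)
  have h5 := hasDerivAt_fderiv_apply hFd (zero_smul ℝ v) (hl 0) (hasDerivAt_const (0 : ℝ) v)
  rw [map_zero, add_zero] at h5
  exact h5.unique h4

theorem iteratedFDeriv_comp_exp (hΦ : ContDiffAt ℝ 2 Φ g) {B : A →ₗ[ℝ] A →ₗ[ℝ] ℝ}
    (hB : ∀ X Y, HasDerivAt
      (fun s : ℝ => deriv (fun t : ℝ => Φ (g * exp (s • X) * exp (t • Y))) 0) (B X Y) 0)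
    (Z : E →L[ℝ] A) (v w : E) :
    iteratedFDeriv ℝ 2 (fun z => Φ (g * exp (Z z))) 0 ![v, w]
      = (B (Z v) (Z w) + B (Z w) (Z v)) / 2 := by
  have h := iteratedFDeriv_comp_exp_self hΦ hB Z
  have h1 := h (v + w)
  simp only [map_add, _root_.add_apply, LinearMap.add_apply, h v, h w] at h1
  have hs := (contDiffAt_comp_exp hΦ Z).isSymmSndFDerivAt (by simp) v w
  rw [iteratedFDeriv_two_apply]
  simp only [Matrix.cons_val_zero, Matrix.cons_val_one]
  linarith

end Jets

/-! ### Pluriharmonic functions -/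

section Pluriharmonic

theorem iteratedFDeriv_re {E : Type*} [NormedAddCommGroup E] [NormedSpace ℂ E] {k : E → ℂ} {x : E}
    (hk : AnalyticAt ℂ k x) (v w : E) :
    iteratedFDeriv ℝ 2 (fun z => (k z).re) x ![v, w] = (fderiv ℂ (fderiv ℂ k) x v w).re := by
  rw [iteratedFDeriv_two_apply]
  simp only [Matrix.cons_val_zero, Matrix.cons_val_one]
  have hev : fderiv ℝ (fun z => (k z).re)
      =ᶠ[𝓝 x] fun z => Complex.reCLM.comp ((fderiv ℂ k z).restrictScalars ℝ) :=
    hk.eventually_analyticAt.mono fun z hz =>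
      (Complex.reCLM.hasFDerivAt.comp z
        (hz.differentiableAt.hasFDerivAt.restrictScalars ℝ)).fderiv
  rw [hev.fderiv_eq]
  have h1 := (hk.fderiv.differentiableAt.hasFDerivAt.restrictScalars ℝ)
  let T : (E →L[ℂ] ℂ) →L[ℝ] (E →L[ℝ] ℝ) :=
    (ContinuousLinearMap.compL ℝ E ℂ ℝ Complex.reCLM).comp
      (ContinuousLinearMap.restrictScalarsL ℂ E ℂ ℝ ℝ)
  have h2 : HasFDerivAt (fun z => T (fderiv ℂ k z)) _ x := T.hasFDerivAt.comp x h1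
  have h3 := h2.fderiv
  change fderiv ℝ (fun z => T (fderiv ℂ k z)) x v w = _
  rw [h3]
  rfl

variable {I : Type} [Fintype I]

/-- The second derivative of a holomorphic function is complex bilinear, so the four terms cancel in
pairs. -/
theorem wirtinger_re {k : (I → ℂ) → ℂ} (hk : AnalyticAt ℂ k 0) (i j : I) :
    wirtinger (fun z => (k z).re) i j = 0 := by
  have e : ∀ (inst : DecidableEq I) (l : I),
      (Pi.single l Complex.I : I → ℂ) = Complex.I • Pi.single l 1 := fun inst l => by
    rw [← Pi.single_smul', smul_eq_mul, mul_one]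
  simp only [wirtinger, secondDeriv, iteratedFDeriv_re hk]
  simp only [e, map_smul, _root_.smul_apply, smul_eq_mul]
  simp

theorem wirtinger_add {F F' : (I → ℂ) → ℝ} (hF : ContDiffAt ℝ 2 F 0) (hF' : ContDiffAt ℝ 2 F' 0)
    (i j : I) : wirtinger (fun z => F z + F' z) i j = wirtinger F i j + wirtinger F' i j := by
  have h : ∀ v w, secondDeriv (fun z => F z + F' z) v w = secondDeriv F v w + secondDeriv F' v w :=
    fun v w => by
      have := iteratedFDeriv_add_apply (i := 2) hF hF'
      simp only [secondDeriv]
      exact congrArg (fun m => m ![v, w]) this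
  simp only [wirtinger, h]
  push_cast
  ring

theorem wirtinger_congr {F F' : (I → ℂ) → ℝ} (h : F =ᶠ[𝓝 0] F') (i j : I) :
    wirtinger F i j = wirtinger F' i j := by
  have h : ∀ v w, secondDeriv F v w = secondDeriv F' v w := fun v w => by
    simp only [secondDeriv]
    rw [(h.iteratedFDeriv ℝ 2).eq_of_nhds]
  simp only [wirtinger, h]

theorem wirtinger_const_add (c : ℝ) (F : (I → ℂ) → ℝ) (i j : I) (hF : ContDiffAt ℝ 2 F 0) :
    wirtinger (fun z => c + F z) i j = wirtinger F i j := by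
  rw [wirtinger_add contDiffAt_const hF]
  simp [wirtinger, secondDeriv, iteratedFDeriv_const_of_ne]

theorem wirtinger_log_norm {k : (I → ℂ) → ℂ} (hk : AnalyticAt ℂ k 0) (h0 : k 0 ≠ 0) (i j : I) :
    wirtinger (fun z => 2 * Real.log ‖k z‖) i j = 0 := by
  -- Dividing by the value at the origin brings the argument near 1, away from the branch cut.
  have ha : AnalyticAt ℂ (fun z => 2 * Complex.log (k z / k 0)) 0 := by
    refine analyticAt_const.mul ((hk.div analyticAt_const h0).clog ?_)
    simp [h0]
  have hev : (fun z => 2 * Real.log ‖k z‖) =ᶠ[𝓝 0]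
      fun z => 2 * Real.log ‖k 0‖ + (2 * Complex.log (k z / k 0)).re := by
    filter_upwards [hk.continuousAt.eventually_ne h0] with z hz
    have : (2 * Complex.log (k z / k 0)).re = 2 * Real.log ‖k z / k 0‖ := by
      simp [Complex.log_re]
    rw [this, norm_div, Real.log_div (norm_ne_zero_iff.2 hz) (norm_ne_zero_iff.2 h0)]
    ring
  rw [wirtinger_congr hev, wirtinger_const_add, wirtinger_re ha]
  exact Complex.reCLM.contDiff.contDiffAt.comp (0 : I → ℂ) (ha.contDiffAt.restrict_scalars ℝ)

end Pluriharmonic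

/-! ### Jets of smooth functions on a closed subgroup of `GL_n` -/

section

variable {S : Subgroup (GLn n)} {g : S} {I : Type} [Fintype I] {b : I → Mat n}

theorem sum_smul_mem_lieAlg (hS : IsAlgebraic S) (hb : ∀ i, b i ∈ lieAlg S) (z : I → ℂ) :
    ∑ i, z i • b i ∈ lieAlg S :=
  (lieSub hS).sum_mem fun i _ => lieAlg_smul (hb i) (z i)

theorem continuous_coord (hS : IsAlgebraic S) (g : S) (hb : ∀ i, b i ∈ lieAlg S) :
    Continuous fun z : I → ℂ => g * expIn S (∑ i, z i • b i) :=
  continuous_const.mul (continuous_expIn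
    (continuous_finsetSum _ fun i _ => (continuous_apply i).smul continuous_const)
    fun z => sum_smul_mem_lieAlg hS hb z)

theorem tendsto_coord (hS : IsAlgebraic S) (g : S) (hb : ∀ i, b i ∈ lieAlg S) :
    Tendsto (fun z : I → ℂ => g * expIn S (∑ i, z i • b i)) (𝓝 0) (𝓝 g) := by
  simpa using (continuous_coord hS g hb).tendsto 0

theorem entries_mul_expIn {X : Mat n} (g : S) (hX : X ∈ lieAlg S) :
    entries (g * expIn S X) = fun i j => (((g : GLn n) : Mat n) * exp X) i j := by
  funext i j
  simp only [entries, Subgroup.coe_mul, Units.val_mul]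
  rw [expIn_val hX, expGL_val]

/-- The entries of a matrix, as a linear map. -/
def entriesₗ : Mat n →ₗ[ℂ] (Fin n → Fin n → ℂ) where
  toFun X i j := X i j
  map_add' _ _ := rfl
  map_smul' _ _ := rfl

/-- The linear combination map of a finite family of matrices. -/
def combₗ (b : I → Mat n) : (I → ℂ) →ₗ[ℂ] Mat n where
  toFun z := ∑ i, z i • b i
  map_add' z w := by simp [add_smul, Finset.sum_add_distrib]
  map_smul' c z := by simp [Finset.smul_sum, smul_smul]

open scoped Matrix.Norms.Operator in
theorem HolAt.analyticAt_coord (hS : IsAlgebraic S) {f : S → ℂ} (hf : HolAt f g)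
    (hb : ∀ i, b i ∈ lieAlg S) :
    AnalyticAt ℂ (fun z : I → ℂ => f (g * expIn S (∑ i, z i • b i))) 0 := by
  obtain ⟨F, hF, hev⟩ := hf
  let ι := LinearMap.toContinuousLinearMap (entriesₗ (n := n))
  let Z := LinearMap.toContinuousLinearMap (combₗ b)
  have h1 : AnalyticAt ℂ (fun z : I → ℂ => ι (((g : GLn n) : Mat n) * exp (Z z))) 0 := by
    refine (ι.analyticAt _).comp (analyticAt_const.mul ?_)
    exact (exp_analytic (𝕂 := ℂ) (Z 0)).comp (Z.analyticAt 0)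
  have h0 : ι (((g : GLn n) : Mat n) * exp (Z 0)) = entries g := by
    rw [map_zero, exp_zero, mul_one]
    rfl
  have h2 : AnalyticAt ℂ (fun z : I → ℂ => F (ι (((g : GLn n) : Mat n) * exp (Z z)))) 0 := by
    refine AnalyticAt.comp ?_ h1
    rwa [h0]
  refine h2.congr (((tendsto_coord hS g hb).eventually hev).mono fun z hz => ?_)
  change _ = f (g * expIn S (∑ i, z i • b i))
  rw [hz, entries_mul_expIn g (sum_smul_mem_lieAlg hS hb z)]
  rfl

/-- `lin` and `B` are the first and second derivative of `φ` at `g` along one-parameter groups. -/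
structure IsJet (φ : S → ℝ) (g : S) (lin : Mat n →ₗ[ℝ] ℝ) (B : Mat n →ₗ[ℝ] Mat n →ₗ[ℝ] ℝ) :
    Prop where
  hasDerivAt_lin : ∀ X ∈ lieAlg S, HasDerivAt (fun t : ℝ => φ (g * expIn S (t • X))) (lin X) 0
  hasDerivAt_B : ∀ X ∈ lieAlg S, ∀ Y ∈ lieAlg S, HasDerivAt
    (fun s : ℝ => deriv (fun t : ℝ => φ (g * expIn S (s • X) * expIn S (t • Y))) 0) (B X Y) 0
  sub : ∀ X Y, B X Y - B Y X = lin ⁅X, Y⁆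
  contDiffAt : ∀ {I : Type} [Fintype I] {b : I → Mat n}, (∀ i, b i ∈ lieAlg S) →
    ContDiffAt ℝ 2 (fun z : I → ℂ => φ (g * expIn S (∑ i, z i • b i))) 0
  secondDeriv_eq : ∀ {I : Type} [Fintype I] {b : I → Mat n}, (∀ i, b i ∈ lieAlg S) → ∀ v w,
    secondDeriv (fun z : I → ℂ => φ (g * expIn S (∑ i, z i • b i))) v w
      = (B (∑ i, v i • b i) (∑ i, w i • b i) + B (∑ i, w i • b i) (∑ i, v i • b i)) / 2

open scoped Matrix.Norms.Operator in
theorem SmoothAt.exists_isJet (hS : IsAlgebraic S) {φ : S → ℝ} (hφ : SmoothAt φ g) :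
    ∃ lin B, IsJet φ g lin B := by
  obtain ⟨Φ, hΦ, hev⟩ := hφ
  let ι := LinearMap.toContinuousLinearMap ((entriesₗ (n := n)).restrictScalars ℝ)
  have hΨ : ContDiffAt ℝ 2 (fun M : Mat n => Φ (ι M)) ((g : GLn n) : Mat n) := by
    refine ContDiffAt.comp _ ?_ ι.contDiff.contDiffAt
    exact_mod_cast contDiffAt_infty.1 hΦ 2
  obtain ⟨lin, B, h1, h2, h3⟩ := exists_jet hΨ
  have hcont : ∀ X ∈ lieAlg S, Continuous fun t : ℝ => expIn S (t • X) := fun X hX =>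
    continuous_expIn (continuous_real_smul X) fun t => lieAlg_real_smul hX t
  have hcoord : ∀ {I : Type} [Fintype I] {b : I → Mat n}, (∀ i, b i ∈ lieAlg S) →
      (fun z : I → ℂ => φ (g * expIn S (∑ i, z i • b i))) =ᶠ[𝓝 0] fun z =>
        Φ (ι (((g : GLn n) : Mat n) *
          exp (LinearMap.toContinuousLinearMap ((combₗ b).restrictScalars ℝ) z))) := by
    intro I _ b hb
    refine ((tendsto_coord hS g hb).eventually hev).mono fun z hz => ?_
    change φ (g * expIn S (∑ i, z i • b i)) = _
    rw [hz, entries_mul_expIn g (sum_smul_mem_lieAlg hS hb z)]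
    rfl
  refine ⟨lin, B, fun X hX => ?_, fun X hX Y hY => ?_, h3, fun {I} _ {b} hb => ?_,
    fun {I} _ {b} hb v w => ?_⟩
  · refine (h1 X).congr_of_eventuallyEq ?_
    have ht : Tendsto (fun t : ℝ => g * expIn S (t • X)) (𝓝 0) (𝓝 g) := by
      have hc : Continuous fun t : ℝ => g * expIn S (t • X) := continuous_const.mul (hcont X hX)
      simpa using hc.tendsto 0
    refine (ht.eventually hev).mono fun t h => ?_
    change φ (g * expIn S (t • X)) = _
    rw [h, entries_mul_expIn g (lieAlg_real_smul hX t)]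
    rfl
  · refine (h2 X Y).congr_of_eventuallyEq ?_
    have ht : Tendsto (fun p : ℝ × ℝ => g * expIn S (p.1 • X) * expIn S (p.2 • Y)) (𝓝 (0, 0))
        (𝓝 g) := by
      have hc : Continuous fun p : ℝ × ℝ => g * expIn S (p.1 • X) * expIn S (p.2 • Y) :=
        (continuous_const.mul ((hcont X hX).comp continuous_fst)).mul
          ((hcont Y hY).comp continuous_snd)
      simpa using hc.tendsto (0, 0)
    rw [nhds_prod_eq] at ht
    -- The inner derivative needs agreement for t near 0 at each fixed small s; currying extracts
    -- this from a joint neighbourhood of (0, 0).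
    refine (ht.eventually hev).curry.mono fun s hs => ?_
    refine Filter.EventuallyEq.deriv_eq (hs.mono fun t h => ?_)
    change φ (g * expIn S (s • X) * expIn S (t • Y)) = _
    rw [h, entries_mul_expIn _ (lieAlg_real_smul hY t), Subgroup.coe_mul, Units.val_mul,
      expIn_val (lieAlg_real_smul hX s), expGL_val]
    rfl
  · exact (contDiffAt_comp_exp hΨ _).congr_of_eventuallyEq (hcoord hb)
  · rw [secondDeriv, ((hcoord hb).iteratedFDeriv ℝ 2).eq_of_nhds]
    exact iteratedFDeriv_comp_exp hΨ h2 _ v w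

end

/-! ### The jet of an invariant potential -/

section Potential

variable {D : HorosymmetricSpace n} {C : CartanData D} {χ : D.H →* ℂˣ} {ℓ : Mat n →ₗ[ℂ] ℂ}
  {φ : D.G → ℝ} {a : Mat n}

/-- A function on `G` that is invariant under `K` on the left, and equivariant under `H` on the
right for the character `χ`. -/
structure IsPotential (C : CartanData D) (χ : D.H →* ℂˣ) (φ : D.G → ℝ) : Prop where
  left : ∀ k ∈ C.K, ∀ x, φ (k * x) = φ x
  right : ∀ (h : D.H) (x g : D.G), (g : GLn n) = h → φ (x * g) = φ x - 2 * Real.log ‖(χ h : ℂ)‖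

theorem IsPotential.mul_exp (hφ : IsPotential C χ φ) (hℓ : IsDChar D χ ℓ) {X : Mat n}
    (hX : X ∈ lieAlg D.H) (x : D.G) (t : ℝ) :
    φ (x * expIn D.G (t • X)) = φ x - 2 * (t * (ℓ X).re) := by
  have hXt := lieAlg_real_smul hX t
  rw [hφ.right (expIn D.H (t • X)) x _
    (by rw [expIn_val hXt, expIn_val (lieAlg_mono D.H_le_G hXt)]), hℓ.map_exp X hX,
    Complex.norm_exp, Real.log_exp]
  simp

/-- The element w + θ(w) generates a group in K ∩ H. Comparing left invariance and right
equivariance of φ at the identity gives Re ℓ(w + θ(w)) = 0; the imaginary part follows by replacing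
w with iw. -/
theorem IsPotential.isUnitaryOn (hφ : IsPotential C χ φ) (hℓ : IsDChar D χ ℓ) :
    IsUnitaryOn C ℓ := by
  have key : ∀ w ∈ lieAlg D.L, D.dσ w = w → (ℓ w).re + (ℓ (C.dθ w)).re = 0 := by
    intro w hw hσ
    have hθL := C.dθ_mem_L hw
    have hH := lieAlg_add D.H_algebraic (mem_lieH_of_fixed hw hσ)
      (mem_lieH_of_fixed hθL (by rw [C.dσ_dθ hw, hσ]))
    have hG := lieAlg_add D.G_algebraic (lieL_le hw) (lieL_le hθL)
    have hK : w + C.dθ w ∈ C.lieK := C.mem_lieK hG (by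
      rw [C.dθ_add (lieL_le hw) (lieL_le hθL), C.dθ_dθ (lieL_le hw), add_comm])
    have h1 := hφ.mul_exp hℓ hH 1 1
    have h2 := hφ.left _ (hK.2 1) 1
    rw [one_mul] at h1
    rw [mul_one, h1, map_add, Complex.add_re] at h2
    linarith
  intro w hw hσ
  have h1 := key w hw hσ
  have h2 := key (Complex.I • w) (lieAlg_smul hw _) (by rw [dσ_smul hw, hσ])
  rw [C.dθ_smul (lieL_le hw), map_smul, map_smul] at h2
  simp at h2
  apply Complex.ext
  · simp only [Complex.neg_re, Complex.conj_re]; linarith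
  · simp only [Complex.neg_im, Complex.conj_im]; linarith

theorem exp_mul_exp_Ad (ha : a ∈ lieAlg D.G) {k : Mat n} (hk : k ∈ lieAlg D.G) (s : ℝ) :
    Ad (expGL (-a)) k ∈ lieAlg D.G ∧
    expIn D.G a * expIn D.G (s • Ad (expGL (-a)) k) = expIn D.G (s • k) * expIn D.G a := by
  have e : expGL (-a) = (((expIn D.G a)⁻¹ : D.G) : GLn n) := by
    rw [← expIn_neg ha, expIn_val (lieAlg_neg ha)]
  have hm : Ad (expGL (-a)) k ∈ lieAlg D.G := by
    rw [e]
    exact lieAlg_conj hk ((expIn D.G a)⁻¹).2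
  refine ⟨hm, ?_⟩
  have h := expIn_conj (lieAlg_real_smul hk s) (expIn D.G a)⁻¹
  have h' : s • Ad (expGL (-a)) k = ((((expIn D.G a)⁻¹ : D.G) : GLn n) : Mat n) * (s • k) *
      (((((expIn D.G a)⁻¹ : D.G) : GLn n)⁻¹ : GLn n) : Mat n) := by
    rw [e, Ad_apply, Matrix.mul_smul, Matrix.smul_mul]
  rw [h', h]
  group

/-- Equivariance under H makes the inner derivative independent of s, and K-invariance makes the
whole curve independent of s once exp(a) has been moved across. -/
theorem IsPotential.exists_jetData (hφ : IsPotential C χ φ)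
    (hℓ : IsDChar D χ ℓ) (ha : a ∈ C.aS) (hs : SmoothAt φ (expIn D.G a)) :
    ∃ J : JetData C a ℓ, IsJet φ (expIn D.G a) J.lin J.B := by
  obtain ⟨lin, B, hJ⟩ := hs.exists_isJet D.G_algebraic
  have haG := aS_mem_G ha
  refine ⟨⟨lin, B, hJ.sub, fun X hX h hh => ?_, fun h hh => ?_, fun k hk Y hY => ?_,
    fun k hk => ?_⟩, hJ⟩
  · have h1 := hJ.hasDerivAt_B X hX h (lieAlg_mono D.H_le_G hh)
    have h2 : (fun s : ℝ => deriv
        (fun t : ℝ => φ (expIn D.G a * expIn D.G (s • X) * expIn D.G (t • h))) 0)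
        = fun _ => -2 * (ℓ h).re := by
      funext s
      rw [funext fun t => hφ.mul_exp hℓ hh _ t]
      have : HasDerivAt (fun t : ℝ => φ (expIn D.G a * expIn D.G (s • X)) - 2 * (t * (ℓ h).re))
          (-2 * (ℓ h).re) 0 := by
        refine ((((hasDerivAt_id (0 : ℝ)).mul_const (ℓ h).re).const_mul 2).const_sub _).congr_deriv
          ?_
        ring
      exact this.deriv
    rw [h2] at h1
    exact h1.unique (hasDerivAt_const _ _)
  · have h1 := hJ.hasDerivAt_lin h (lieAlg_mono D.H_le_G hh)
    rw [funext fun t => hφ.mul_exp hℓ hh _ t] at h1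
    refine h1.unique (((((hasDerivAt_id (0 : ℝ)).mul_const (ℓ h).re).const_mul 2).const_sub
      _).congr_deriv ?_)
    ring
  · have h1 := hJ.hasDerivAt_B _ (exp_mul_exp_Ad haG hk.1 0).1 Y hY
    have h2 : (fun s : ℝ => deriv (fun t : ℝ => φ (expIn D.G a *
        expIn D.G (s • Ad (expGL (-a)) k) * expIn D.G (t • Y))) 0)
        = fun _ => deriv (fun t : ℝ => φ (expIn D.G a * expIn D.G (t • Y))) 0 := by
      funext s
      congr 1
      funext t
      rw [(exp_mul_exp_Ad haG hk.1 s).2, mul_assoc, hφ.left _ (hk.2 s)]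
    rw [h2] at h1
    exact h1.unique (hasDerivAt_const _ _)
  · have h1 := hJ.hasDerivAt_lin _ (exp_mul_exp_Ad haG hk.1 0).1
    have h2 : (fun s : ℝ => φ (expIn D.G a * expIn D.G (s • Ad (expGL (-a)) k)))
        = fun _ => φ (expIn D.G a) := by
      funext s
      rw [(exp_mul_exp_Ad haG hk.1 s).2, hφ.left _ (hk.2 s)]
    rw [h2] at h1
    exact h1.unique (hasDerivAt_const _ _)

theorem ReferenceData.aS_add (R : ReferenceData C) {x y : Mat n} (hx : x ∈ C.aS)
    (hy : y ∈ C.aS) : x + y ∈ C.aS := by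
  rw [← R.l_span] at *
  exact add_mem hx hy

theorem ReferenceData.aS_smul (R : ReferenceData C) {x : Mat n} (hx : x ∈ C.aS) (s : ℝ) :
    s • x ∈ C.aS := by
  rw [← R.l_span] at *
  exact Submodule.smul_mem _ s hx

theorem expIn_add_aS (R : ReferenceData C) {x y : Mat n} (hx : x ∈ C.aS) (hy : y ∈ C.aS) :
    expIn D.G (x + y) = expIn D.G x * expIn D.G y :=
  expIn_add (aS_mem_G hx) (aS_mem_G hy) (aS_mem_G (R.aS_add hx hy))
    (commute_lieT (aS_mem_T hx) (aS_mem_T hy))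

theorem IsJet.extends (R : ReferenceData C) (ha : a ∈ C.aS) {J : JetData C a ℓ}
    (hJ : IsJet φ (expIn D.G a) J.lin J.B) {u : Mat n → ℝ}
    (hu : ∀ x ∈ C.aS, u x = φ (expIn D.G x)) : J.Extends u := by
  refine ⟨fun x hx => ?_, fun x hx y hy => ?_⟩
  · rw [diff1, ← (hJ.hasDerivAt_lin x (aS_mem_G hx)).deriv]
    congr 1
    funext t
    rw [hu _ (R.aS_add ha (R.aS_smul hx t)), expIn_add_aS R ha (R.aS_smul hx t)]
  · rw [diff2, ← (hJ.hasDerivAt_B x (aS_mem_G hx) y (aS_mem_G hy)).deriv]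
    congr 1
    funext s
    congr 1
    funext t
    have hax := R.aS_add ha (R.aS_smul hx s)
    rw [hu _ (R.aS_add hax (R.aS_smul hy t)), expIn_add_aS R hax (R.aS_smul hy t),
      expIn_add_aS R ha (R.aS_smul hx s)]

theorem IsJet.wirtinger_eq {J : JetData C a ℓ} (hJ : IsJet φ (expIn D.G a) J.lin J.B) {I : Type}
    [Fintype I] {b : I → Mat n} (hb : ∀ i, b i ∈ lieAlg D.G) (i j : I) :
    wirtinger (fun z => φ (expIn D.G a * expIn D.G (∑ i, z i • b i))) i j = J.S (b i) (b j) := by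
  have e : ∀ (inst : DecidableEq I) (l : I) (c : ℂ),
      ∑ i, (Pi.single l c : I → ℂ) i • b i = c • b l := fun inst l c => by
    rw [Finset.sum_eq_single l]
    · simp
    · intro k _ hk
      simp [Pi.single_eq_of_ne hk]
    · simp
  -- The coordinate Hessian sees only the symmetrized B, so S is first written as its own hermitian
  -- average.
  have h1 : J.S (b i) (b j)
      = (1 / 2 : ℂ) * (J.S (b i) (b j) + (starRingEnd ℂ) (J.S (b j) (b i))) := by
    rw [J.S_conj]; ring
  rw [h1]
  simp only [wirtinger, hJ.secondDeriv_eq hb, e, one_smul, JetData.S, map_mul, map_add, map_sub,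
    Complex.conj_ofReal, Complex.conj_I, map_div₀, map_one, Complex.conj_ofNat]
  push_cast
  ring

end Potential

/-! ### The potential of an invariant metric on a linearized line bundle -/

section Trivialization

variable {D : HorosymmetricSpace n}

theorem smul_proj_one (g : D.G) : g • D.proj 1 = D.proj g :=
  congrArg D.proj (mul_one g)

theorem continuous_proj : Continuous D.proj := continuous_quotient_mk'

theorem eventually_mem_baseSet {F : Type*} [TopologicalSpace F] {E : D.Space → Type*}
    [TopologicalSpace (TotalSpace F E)] {t : Trivialization F (π F E)} {g : D.G}
    (hg : D.proj g ∈ t.baseSet) :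
    ∀ᶠ x in 𝓝 g, D.proj x ∈ t.baseSet :=
  continuous_proj.continuousAt.eventually (t.open_baseSet.mem_nhds hg)

theorem smul_symm_one {E : D.Space → Type*} [∀ x, AddCommGroup (E x)] [∀ x, Module ℂ (E x)]
    [∀ x, TopologicalSpace (E x)] [TopologicalSpace (TotalSpace ℂ E)] [FiberBundle ℂ E]
    [VectorBundle ℂ ℂ E] {t : Trivialization ℂ (π ℂ E)} [MemTrivializationAtlas t]
    {x : D.Space} (hx : x ∈ t.baseSet) (ξ : E x) :
    (t ⟨x, ξ⟩).2 • t.symm x 1 = ξ := by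
  have : t.IsLinear ℂ := VectorBundle.trivialization_linear' t
  have h1 := (t.linearEquivAt ℂ x hx).symm.map_smul (t ⟨x, ξ⟩).2 1
  rw [smul_eq_mul, mul_one] at h1
  have h2 := (t.linearEquivAt ℂ x hx).symm_apply_apply ξ
  rw [Trivialization.linearEquivAt_apply] at h2
  rw [h2] at h1
  exact h1.symm

end Trivialization

/-! ### Linearized bundles: from the metric to its potential -/

section Bundle

variable {D : HorosymmetricSpace n} {E : D.Space → Type*}
  [∀ x, AddCommGroup (E x)] [∀ x, Module ℂ (E x)] [∀ x, TopologicalSpace (E x)]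
  [TopologicalSpace (TotalSpace ℂ E)] [FiberBundle ℂ E] [VectorBundle ℂ ℂ E]
  [MulAction D.G (TotalSpace ℂ E)] {C : CartanData D} {q : TotalSpace ℂ E → ℝ}
  {χ : D.H →* ℂˣ} {ξ₀ : E (D.proj 1)}

theorem IsLinearizedLineBundle.proj_smul (hE : IsLinearizedLineBundle D E) (g : D.G)
    (ξ : E (D.proj 1)) : (g • (⟨D.proj 1, ξ⟩ : TotalSpace ℂ E)).proj = D.proj g := by
  obtain ⟨A, hA⟩ := hE.action_linear g (D.proj 1)
  rw [hA]
  exact smul_proj_one g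

theorem IsLinearizedLineBundle.metric_smul (hE : IsLinearizedLineBundle D E)
    (hq : IsInvariantMetric D E C q) (g : D.G) (x : D.Space) (c : ℂ) (ξ : E x) :
    q (g • (⟨x, c • ξ⟩ : TotalSpace ℂ E)) = ‖c‖ * q (g • (⟨x, ξ⟩ : TotalSpace ℂ E)) := by
  obtain ⟨A, hA⟩ := hE.action_linear g x
  rw [hA, hA, map_smul, hq.norm_smul]

theorem IsLinearizedLineBundle.metric_pos (hE : IsLinearizedLineBundle D E)
    (hq : IsInvariantMetric D E C q) (g : D.G) {x : D.Space} {ξ : E x} (h : ξ ≠ 0) :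
    0 < q (g • (⟨x, ξ⟩ : TotalSpace ℂ E)) := by
  obtain ⟨A, hA⟩ := hE.action_linear g x
  rw [hA]
  refine hq.pos _ _ fun h0 => h ?_
  have h1 : g • (⟨x, ξ⟩ : TotalSpace ℂ E) = g • (⟨x, 0⟩ : TotalSpace ℂ E) := by
    rw [hA, hA, h0, map_zero]
  have h2 := MulAction.injective g h1
  rwa [TotalSpace.mk_inj] at h2

theorem isPotential_quasipotential (hE : IsLinearizedLineBundle D E)
    (hχ : IsIsotropyCharacter D E χ) (hq : IsInvariantMetric D E C q) (hξ₀ : ξ₀ ≠ 0) :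
    IsPotential C χ (quasipotential q ξ₀) where
  left k hk x := by rw [quasipotential, mul_smul, hq.invariant k hk, quasipotential]
  right h x g hg := by
    rw [quasipotential, mul_smul, hχ.smul_eq h g hg, hE.metric_smul hq, Real.log_mul
      (norm_ne_zero_iff.2 (Units.ne_zero _)) (hE.metric_pos hq x hξ₀).ne', quasipotential]
    ring

variable {t : Trivialization ℂ (π ℂ E)} [MemTrivializationAtlas t]

theorem IsInvariantMetric.eq_norm_mul (hq : IsInvariantMetric D E C q) {v : TotalSpace ℂ E}
    (hv : v.proj ∈ t.baseSet) : q v = ‖(t v).2‖ * q (frame t v.proj) := by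
  obtain ⟨x, ξ⟩ := v
  rw [frame, ← hq.norm_smul, smul_symm_one hv]

theorem IsLinearizedLineBundle.trivialization_smul (hE : IsLinearizedLineBundle D E) {g : D.G}
    (hg : D.proj g ∈ t.baseSet) (c : ℂ) (ξ : E (D.proj 1)) :
    (t (g • (⟨D.proj 1, c • ξ⟩ : TotalSpace ℂ E))).2
      = c * (t (g • (⟨D.proj 1, ξ⟩ : TotalSpace ℂ E))).2 := by
  have : t.IsLinear ℂ := VectorBundle.trivialization_linear' t
  obtain ⟨A, hA⟩ := hE.action_linear g (D.proj 1)
  rw [hA, hA, map_smul]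
  exact (t.linear ℂ (by rwa [smul_proj_one])).map_smul c (A ξ)

theorem IsLinearizedLineBundle.holAt_trivialization (hE : IsLinearizedLineBundle D E) {g : D.G}
    (hg : D.proj g ∈ t.baseSet) (ξ₀ : E (D.proj 1)) :
    HolAt (fun x => (t (x • (⟨D.proj 1, ξ₀⟩ : TotalSpace ℂ E))).2) g := by
  -- ξ₀ is a scalar multiple of a frame vector at eH; freezing the second variable of the
  -- holomorphic action at 1 then suffices.
  let t₀ := trivializationAt ℂ E (D.proj 1)
  have h₀ : D.proj 1 ∈ t₀.baseSet := mem_baseSet_trivializationAt ℂ E _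
  obtain ⟨F, hF, hev⟩ := hE.action_holomorphic t₀ t g 1 h₀ (by rwa [mul_one])
  refine ⟨fun M => (t₀ ⟨D.proj 1, ξ₀⟩).2 * F (M, entries (1 : D.G)), ?_, ?_⟩
  · refine analyticAt_const.mul (AnalyticAt.comp (g := F) hF ?_)
    exact analyticAt_id.prod analyticAt_const
  · have hc : Tendsto (fun x : D.G => (x, (1 : D.G))) (𝓝 g) (𝓝 (g, 1)) :=
      (Continuous.prodMk continuous_id continuous_const).tendsto g
    filter_upwards [hc.eventually hev, eventually_mem_baseSet hg] with x hx hb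
    rw [← hx, frame, ← hE.trivialization_smul hb, smul_symm_one h₀]

theorem IsInvariantMetric.eventually_eq (hE : IsLinearizedLineBundle D E)
    (hq : IsInvariantMetric D E C q) {g : D.G} (hg : D.proj g ∈ t.baseSet) (ξ₀ : E (D.proj 1)) :
    ∀ᶠ x in 𝓝 g, q (x • (⟨D.proj 1, ξ₀⟩ : TotalSpace ℂ E))
      = ‖(t (x • (⟨D.proj 1, ξ₀⟩ : TotalSpace ℂ E))).2‖ * q (frame t (D.proj x)) := by
  filter_upwards [eventually_mem_baseSet hg] with x hx
  have h := hE.proj_smul x ξ₀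
  rw [← h] at hx
  rw [hq.eq_norm_mul hx, h]

/-- Near a point of the domain of a trivialization `t`, the quasipotential differs from
`-ln |s|²`, where `s` is the frame of `t`, by `-2 ln` of the modulus of a holomorphic function. -/
theorem eventually_quasipotential_eq (hE : IsLinearizedLineBundle D E)
    (hq : IsInvariantMetric D E C q) (hξ₀ : ξ₀ ≠ 0) {g : D.G} (hg : D.proj g ∈ t.baseSet) :
    ∀ᶠ x in 𝓝 g, (t (x • (⟨D.proj 1, ξ₀⟩ : TotalSpace ℂ E))).2 ≠ 0 ∧
      0 < q (frame t (D.proj x)) ∧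
      quasipotential q ξ₀ x = -Real.log (q (frame t (D.proj x)) ^ 2)
        - 2 * Real.log ‖(t (x • (⟨D.proj 1, ξ₀⟩ : TotalSpace ℂ E))).2‖ := by
  filter_upwards [hq.eventually_eq hE hg ξ₀] with x hx
  have hpos := hE.metric_pos hq x hξ₀
  have h1 : (t (x • (⟨D.proj 1, ξ₀⟩ : TotalSpace ℂ E))).2 ≠ 0 := fun h => by
    rw [hx, h, norm_zero, zero_mul] at hpos
    exact hpos.false
  have h2 : 0 < q (frame t (D.proj x)) :=
    pos_of_mul_pos_right (hx ▸ hpos) (norm_nonneg _)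
  refine ⟨h1, h2, ?_⟩
  rw [quasipotential, hx, Real.log_mul (norm_ne_zero_iff.2 h1) h2.ne', Real.log_pow]
  push_cast
  ring

theorem smoothAt_quasipotential (hE : IsLinearizedLineBundle D E)
    (hq : IsInvariantMetric D E C q) (hξ₀ : ξ₀ ≠ 0) {g : D.G} (hg : D.proj g ∈ t.baseSet) :
    SmoothAt (quasipotential q ξ₀) g := by
  obtain ⟨Q, hQ, hQev⟩ := hq.smooth t g hg
  obtain ⟨c, hc, hcev⟩ := hE.holAt_trivialization hg ξ₀
  have hev := eventually_quasipotential_eq hE hq hξ₀ hg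
  obtain ⟨h1, h2, -⟩ := hev.self_of_nhds
  have hQ0 := hQev.self_of_nhds
  have hc0 := hcev.self_of_nhds
  simp only at hQ0 hc0
  rw [hc0] at h1
  rw [hQ0] at h2
  refine ⟨fun M => -Real.log (Q M ^ 2) - 2 * Real.log ‖c M‖, ?_, ?_⟩
  · have hcR : ContDiffAt ℝ ∞ c (entries g) := hc.contDiffAt.restrict_scalars ℝ
    exact ((hQ.pow 2).log (pow_pos h2 2).ne').neg.sub
      (contDiffAt_const.mul ((hcR.norm ℝ h1).log (norm_ne_zero_iff.2 h1)))
  · filter_upwards [hev, hQev, hcev] with x hx hx1 hx2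
    rw [hx.2.2, hx1, hx2]

theorem basisVec_mem_lieAlg (R : ReferenceData C) (i : R.Idx) : R.basisVec i ∈ lieAlg D.G := by
  rcases i with i | i | i
  · exact aS_mem_G (JetData.l_mem_aS R i)
  · exact (R.e_mem _ (R.rootsQu_mem_roots i.2)).1
  · exact lieL_le (JetData.tau_mem_lieL R i.2)

/-- The curvature form is `i∂∂̄` of the quasipotential. -/
theorem wirtinger_frame (R : ReferenceData C) (hE : IsLinearizedLineBundle D E)
    (hq : IsInvariantMetric D E C q) (hξ₀ : ξ₀ ≠ 0) {g : D.G} (hg : D.proj g ∈ t.baseSet)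
    (i j : R.Idx) :
    wirtinger (fun z => -Real.log (q (frame t (R.coordMap g z)) ^ 2)) i j
      = wirtinger (fun z => quasipotential q ξ₀ (g * expIn D.G (∑ i, z i • R.basisVec i))) i j := by
  have hb := basisVec_mem_lieAlg R
  let c : D.G → ℂ := fun x => (t (x • (⟨D.proj 1, ξ₀⟩ : TotalSpace ℂ E))).2
  have hev := eventually_quasipotential_eq hE hq hξ₀ hg
  have hc := (hE.holAt_trivialization hg ξ₀).analyticAt_coord D.G_algebraic hb
  have hc0 : (fun z : R.Idx → ℂ => c (g * expIn D.G (∑ i, z i • R.basisVec i))) 0 ≠ 0 := by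
    simpa [expIn_zero] using hev.self_of_nhds.1
  have h1 : (fun z : R.Idx → ℂ => -Real.log (q (frame t (R.coordMap g z)) ^ 2)) =ᶠ[𝓝 0]
      fun z => quasipotential q ξ₀ (g * expIn D.G (∑ i, z i • R.basisVec i))
        + 2 * Real.log ‖c (g * expIn D.G (∑ i, z i • R.basisVec i))‖ := by
    filter_upwards [(tendsto_coord D.G_algebraic g hb).eventually hev] with z hz
    rw [hz.2.2, ReferenceData.coordMap]
    ring
  obtain ⟨lin, B, hJ⟩ := (smoothAt_quasipotential hE hq hξ₀ hg).exists_isJet D.G_algebraic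
  rw [wirtinger_congr h1, wirtinger_add (hJ.contDiffAt hb), wirtinger_log_norm hc hc0, add_zero]
  have hcR : ContDiffAt ℝ 2 (fun z : R.Idx → ℂ => c (g * expIn D.G (∑ i, z i • R.basisVec i))) 0 :=
    hc.contDiffAt.restrict_scalars ℝ
  exact contDiffAt_const.mul ((hcR.norm ℝ hc0).log (norm_ne_zero_iff.2 hc0))

theorem curvatureForm_eq_omega (R : ReferenceData C) (hE : IsLinearizedLineBundle D E)
    (hχ : IsIsotropyCharacter D E χ) (hq : IsInvariantMetric D E C q) (hξ₀ : ξ₀ ≠ 0)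
    {u : Mat n → ℝ} (hu : ∀ x ∈ C.aS, u x = toricPotential q ξ₀ x) {a : Mat n} (ha : a ∈ C.aS)
    (hreg : ∀ β ∈ C.rootsS, C.ev β a ≠ 0) (ht : D.proj (expIn D.G a) ∈ t.baseSet)
    (v w : R.Idx → ℂ) :
    curvatureForm R q t (expIn D.G a) v w
      = ∑ i, ∑ j, omega R u χ a i j * refForm i j v w := by
  obtain ⟨ℓ, hℓ⟩ := exists_isDChar hχ.algebraic
  have hφ := isPotential_quasipotential hE hχ hq hξ₀
  obtain ⟨J, hJ⟩ := hφ.exists_jetData hℓ ha (smoothAt_quasipotential hE hq hξ₀ ht)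
  refine Finset.sum_congr rfl fun i _ => Finset.sum_congr rfl fun j _ => ?_
  rw [wirtinger_frame R hE hq hξ₀ ht, hJ.wirtinger_eq (basisVec_mem_lieAlg R),
    J.S_basisVec R ha hreg (hJ.extends R ha hu) hℓ (hφ.isUnitaryOn hℓ)]

/-! ### Bundles that are trivial on the symmetric fiber -/

/-- For l in L ∩ H the section takes the same value at lH and at eH, where l·ξ₀ = χ(l)ξ₀. -/
theorem IsTrivialOnFiber.exists_regular (hE : IsLinearizedLineBundle D E)
    (hχ : IsIsotropyCharacter D E χ) (hξ₀ : ξ₀ ≠ 0) (h : IsTrivialOnFiber D E ξ₀) :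
    ∃ f : D.L → ℂ, IsRegular D.L f ∧ (∀ l, f l ≠ 0) ∧
      ∀ (l : D.L) (h : D.H), (l : GLn n) = h → f l * (χ h : ℂ) = f 1 := by
  obtain ⟨s, f, hf, hf0, hs⟩ := h
  have hs' : ∀ (l : D.L) (x : D.Space) (ξ : E x), Subgroup.inclusion D.L_le_G l •
      (⟨D.proj 1, ξ₀⟩ : TotalSpace ℂ E) = ⟨x, ξ⟩ → s x = f l • ξ := by
    intro l x ξ hl
    have hx : x = D.proj (Subgroup.inclusion D.L_le_G l) := by
      rw [← hE.proj_smul _ ξ₀, hl]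
    subst hx
    exact hs l ξ hl
  refine ⟨f, hf, hf0, fun l h hl => ?_⟩
  have h1 := hs' l (D.proj 1) _ (hχ.smul_eq h (Subgroup.inclusion D.L_le_G l) hl ξ₀)
  have h2 := hs' 1 (D.proj 1) ξ₀ (by rw [map_one, one_smul])
  rw [h1, smul_smul] at h2
  exact smul_left_injective ℂ hξ₀ h2

/-- The differential of the trivializing function f at the identity kills root vectors, hence also y
+ σ(y), although that sum need not be nilpotent. Differentiating f·χ = f(1) along exp(r(y + σ(y)))
in L ∩ H leaves f(1)·ℓ(y + σ(y)) = 0. -/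
theorem IsTrivialOnFiber.chiL_eq_zero (hE : IsLinearizedLineBundle D E)
    (hχ : IsIsotropyCharacter D E χ) (hξ₀ : ξ₀ ≠ 0) (h : IsTrivialOnFiber D E ξ₀)
    {γ : C.Chars} (hγ : γ ≠ 1) {y : Mat n} (hy : y ∈ C.rootSpace γ) (hL : y ∈ lieAlg D.L) :
    chiL χ y = 0 := by
  obtain ⟨ℓ, hℓ⟩ := exists_isDChar hχ.algebraic
  obtain ⟨f, ⟨p, hp⟩, hf0, hf⟩ := h.exists_regular hE hχ hξ₀
  obtain ⟨δ, hδ⟩ := exists_hasDerivAt_eval p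
  have hpf : ∀ {w : Mat n}, w ∈ lieAlg D.L → f (expIn D.L w)
      = MvPolynomial.eval (coords (expGL w)) p := fun hw => by
    rw [← expIn_val hw]; exact hp _
  have hnil : ∀ {δ' : C.Chars} {w : Mat n}, δ' ≠ 1 → w ∈ C.rootSpace δ' → w ∈ lieAlg D.L →
      δ w = 0 := by
    intro δ' w hδ' hw hwL
    by_cases h0 : w = 0
    · rw [h0, map_zero]
    have h1 := eval_const_of_isNilpotent (root_isNilpotent ⟨hδ', w, hw, h0⟩ hw) p fun z => by
      rw [← hpf (lieAlg_smul hwL z)]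
      exact hf0 _
    have h2 := hδ w
    have e : (fun r : ℝ => MvPolynomial.eval (coords (expGL (r • w))) p)
        = fun _ => MvPolynomial.eval (coords (1 : GLn n)) p := by
      funext r
      have := h1 r
      rwa [Complex.coe_smul] at this
    rw [e] at h2
    exact h2.unique (hasDerivAt_const _ _)
  -- σ is an involution of T, so γ∘σ is trivial only if γ is.
  have hσγ : C.σChar γ ≠ 1 := fun h1 => hγ (by
    ext s
    have h2 : C.σT (C.σT s) = s := by
      apply Subtype.ext
      exact congrArg (Subtype.val : D.L → GLn n) (D.σ_involutive (Subgroup.inclusion C.T_le_L s))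
    have h3 := DFunLike.congr_fun h1 (C.σT s)
    rw [← h2]
    exact congrArg Units.val h3)
  have hσL := dσ_mem hL
  have hμL := lieAlg_add D.L_algebraic hL hσL
  have hμH := mem_lieH_of_fixed hμL (by rw [dσ_add hL hσL, dσ_dσ hL, add_comm])
  have hδμ : δ (y + D.dσ y) = 0 := by
    rw [map_add, hnil hγ hy hL, hnil hσγ (dσ_rootSpace hy hL) hσL, add_zero]
  have h1 : HasDerivAt (fun r : ℝ => f (expIn D.L (r • (y + D.dσ y)))) 0 0 := by
    rw [← hδμ, funext fun r => hpf (lieAlg_real_smul hμL r)]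
    exact hδ _
  have h2 : HasDerivAt (fun r : ℝ => (χ (expIn D.H (r • (y + D.dσ y))) : ℂ))
      (ℓ (y + D.dσ y)) 0 := by
    rw [funext fun r => hℓ.map_exp _ hμH r]
    have := ((Complex.ofRealCLM.hasDerivAt (x := (0 : ℝ))).mul_const (ℓ (y + D.dσ y))).cexp
    simpa using this
  have h3 := h1.mul h2
  have e : ((fun r : ℝ => f (expIn D.L (r • (y + D.dσ y)))) *
      fun r : ℝ => (χ (expIn D.H (r • (y + D.dσ y))) : ℂ)) = fun _ => f 1 := by
    funext r
    exact hf _ _ (by rw [expIn_val (lieAlg_real_smul hμL r), expIn_val (lieAlg_real_smul hμH r)])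
  rw [e] at h3
  have h4 := h3.unique (hasDerivAt_const _ _)
  simp only [zero_mul, zero_smul, expIn_zero, zero_add] at h4
  have h5 := (mul_eq_zero.1 h4).resolve_left (hf0 1)
  have h6 := two_mul_chiL hℓ hL
  rw [h5] at h6
  exact (mul_eq_zero.1 h6).resolve_left two_ne_zero

end Bundle

/-! ### The coefficients when `χ` vanishes on the root vectors of `L` -/

section Vanishing

variable {D : HorosymmetricSpace n} {C : CartanData D} (R : ReferenceData C) {χ : D.H →* ℂˣ}
  {ℓ : Mat n →ₗ[ℂ] ℂ} {u : Mat n → ℝ} {a : Mat n} {α₁ α₂ β β₁ β₂ : C.Chars}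

open JetData

theorem omegaJB_eq_zero (hℓ : IsDChar D χ ℓ)
    (hv : ∀ γ : C.Chars, γ ≠ 1 → ∀ y ∈ C.rootSpace γ, y ∈ lieAlg D.L → chiL χ y = 0)
    (hβ : β ∈ R.rootsSPos) (j : Fin R.r) : omegaJB R χ a j β = 0 := by
  have hr := rootsSPos_mem_roots R hβ
  have hL := C.dθ_mem_L (e_mem_lieL R hβ)
  rw [omegaJB, dθ_mu R hβ, chiL_add hℓ hL (dσ_mem hL), chiL_dσ _ hL,
    hv _ (R.inv_mem_roots hr).1 _ (R.dθ_rootSpace hr (R.e_mem _ hr)) hL]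
  simp

theorem omegaAA_eq_zero (hℓ : IsDChar D χ ℓ) (hθ : IsUnitaryOn C ℓ)
    (hv : ∀ γ : C.Chars, γ ≠ 1 → ∀ y ∈ C.rootSpace γ, y ∈ lieAlg D.L → chiL χ y = 0)
    (h₁ : α₁ ∈ C.rootsQu) (h₂ : α₂ ∈ C.rootsQu) (h : α₁ ≠ α₂) :
    omegaAA R u χ a α₁ α₂ = 0 := by
  have hr₁ := R.rootsQu_mem_roots h₁
  have hr₂ := R.rootsQu_mem_roots h₂
  rw [omegaAA, if_neg h]
  split_ifs with hS
  · have he₁ := R.e_mem _ hr₁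
    have he₂ := R.e_mem _ hr₂
    have hy := rootSpace_lie he₂ (R.dθ_rootSpace hr₁ he₁)
    -- The coefficient involves [θ(e₂), e₁] = θ[e₂, θ(e₁)]; θ only conjugates and negates χ∘𝓗, so
    -- vanishing on the root vector is enough.
    have h1 := chiL_dθ hℓ hθ (hS.1.2 hy)
    rw [hv _ (chars_mul_inv_ne_one h.symm) _ hy (hS.1.2 hy), C.dθ_lie he₂.1 (C.dθ_mem he₁.1),
      C.dθ_dθ he₁.1] at h1
    rw [h1]
    simp
  · rfl

theorem chiL_lie_eq_zero (hℓ : IsDChar D χ ℓ) (hθ : IsUnitaryOn C ℓ)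
    (hv : ∀ γ : C.Chars, γ ≠ 1 → ∀ y ∈ C.rootSpace γ, y ∈ lieAlg D.L → chiL χ y = 0)
    (h₁ : β₁ ∈ R.rootsSPos) (h₂ : β₂ ∈ R.rootsSPos) (h : β₁ ≠ β₂) :
    chiL χ ⁅C.dθ (R.e β₂), R.e β₁⁆ = 0 := by
  have hr₁ := rootsSPos_mem_roots R h₁
  have hr₂ := rootsSPos_mem_roots R h₂
  have hL₁ := e_mem_lieL R h₁
  have hL₂ := e_mem_lieL R h₂
  have hyL := lieAlg_lie D.L_algebraic hL₂ (C.dθ_mem_L hL₁)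
  have h1 := chiL_dθ hℓ hθ hyL
  rw [hv _ (chars_mul_inv_ne_one h.symm) _
    (rootSpace_lie (R.e_mem _ hr₂) (R.dθ_rootSpace hr₁ (R.e_mem _ hr₁))) hyL,
    C.dθ_lie (lieL_le hL₂) (C.dθ_mem (lieL_le hL₁)), C.dθ_dθ (lieL_le hL₁)] at h1
  rw [h1, map_zero, neg_zero]

theorem chiL_lie_dσ_eq_zero (hℓ : IsDChar D χ ℓ) (hθ : IsUnitaryOn C ℓ)
    (hv : ∀ γ : C.Chars, γ ≠ 1 → ∀ y ∈ C.rootSpace γ, y ∈ lieAlg D.L → chiL χ y = 0)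
    (h₁ : β₁ ∈ R.rootsSPos) (h₂ : β₂ ∈ R.rootsSPos) :
    chiL χ ⁅C.dθ (R.e β₂), D.dσ (R.e β₁)⁆ = 0 := by
  have hr₁ := rootsSPos_mem_roots R h₁
  have hr₂ := rootsSPos_mem_roots R h₂
  have hL₁ := e_mem_lieL R h₁
  have hL₂ := e_mem_lieL R h₂
  have hθL := C.dθ_mem_L hL₁
  have hzL := lieAlg_lie D.L_algebraic hL₂ (dσ_mem hθL)
  have h1 := chiL_dθ hℓ hθ hzL
  rw [hv _ (mul_σChar_inv_ne_one R h₁ h₂) _ (rootSpace_lie (R.e_mem _ hr₂)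
    (dσ_rootSpace (R.dθ_rootSpace hr₁ (R.e_mem _ hr₁)) hθL)) hzL,
    C.dθ_lie (lieL_le hL₂) (lieL_le (dσ_mem hθL)), ← C.dσ_dθ hθL, C.dθ_dθ (lieL_le hL₁)] at h1
  rw [h1, map_zero, neg_zero]

theorem omegaBB_eq_zero (hℓ : IsDChar D χ ℓ) (hθ : IsUnitaryOn C ℓ)
    (hv : ∀ γ : C.Chars, γ ≠ 1 → ∀ y ∈ C.rootSpace γ, y ∈ lieAlg D.L → chiL χ y = 0)
    (h₁ : β₁ ∈ R.rootsSPos) (h₂ : β₂ ∈ R.rootsSPos) (h : β₁ ≠ β₂) :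
    omegaBB R u χ a β₁ β₂ = 0 := by
  rw [omegaBB, if_neg h, chiL_lie_eq_zero R hℓ hθ hv h₁ h₂ h, chiL_lie_dσ_eq_zero R hℓ hθ hv h₁ h₂]
  simp

theorem omegaBB_self (hℓ : IsDChar D χ ℓ) (hθ : IsUnitaryOn C ℓ)
    (hv : ∀ γ : C.Chars, γ ≠ 1 → ∀ y ∈ C.rootSpace γ, y ∈ lieAlg D.L → chiL χ y = 0)
    (hβ : β ∈ R.rootsSPos) : omegaBB R u χ a β β
      = (duP (D := D) u a (R.coroot β) : ℂ) / Complex.sinh (2 * C.ev β a) := by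
  rw [omegaBB, if_pos rfl, chiL_reK hℓ hθ (e_mem_lieL R hβ),
    chiL_lie_dσ_eq_zero R hℓ hθ hv hβ hβ]
  simp

theorem sum_omega (hℓ : IsDChar D χ ℓ) (hθ : IsUnitaryOn C ℓ)
    (hv : ∀ γ : C.Chars, γ ≠ 1 → ∀ y ∈ C.rootSpace γ, y ∈ lieAlg D.L → chiL χ y = 0)
    (v w : R.Idx → ℂ) :
    ∑ i, ∑ j, omega R u χ a i j * refForm i j v w
      = ∑ j : Fin R.r, ∑ k : Fin R.r,
          (1 / 4 : ℂ) * (diff2 u a (R.l j) (R.l k) : ℂ) * refForm (.inl j) (.inl k) v w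
        + ∑ α : C.rootsQu,
          -Complex.exp (2 * C.ev α a) / 2 *
            ((duP (D := D) u a (R.coroot α) : ℂ) - 2 * chiL χ (R.coroot α)) *
            refForm (.inr (.inl α)) (.inr (.inl α)) v w
        + ∑ β : R.rootsSPos,
          (duP (D := D) u a (R.coroot β) : ℂ) / Complex.sinh (2 * C.ev β a) *
            refForm (.inr (.inr β)) (.inr (.inr β)) v w := by
  have hA : ∀ α : C.rootsQu, ∑ α' : C.rootsQu,
      omegaAA R u χ a α α' * refForm (I := R.Idx) (.inr (.inl α)) (.inr (.inl α')) v w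
      = omegaAA R u χ a α α * refForm (I := R.Idx) (.inr (.inl α)) (.inr (.inl α)) v w :=
    fun α => Finset.sum_eq_single α (fun α' _ h => by
      rw [omegaAA_eq_zero R hℓ hθ hv α.2 α'.2 fun e => h (Subtype.ext e.symm), zero_mul])
      (fun h => absurd (Finset.mem_univ _) h)
  have hB : ∀ β : R.rootsSPos, ∑ β' : R.rootsSPos,
      omegaBB R u χ a β β' * refForm (I := R.Idx) (.inr (.inr β)) (.inr (.inr β')) v w
      = omegaBB R u χ a β β * refForm (I := R.Idx) (.inr (.inr β)) (.inr (.inr β)) v w :=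
    fun β => Finset.sum_eq_single β (fun β' _ h => by
      rw [omegaBB_eq_zero R hℓ hθ hv β.2 β'.2 fun e => h (Subtype.ext e.symm), zero_mul])
      (fun h => absurd (Finset.mem_univ _) h)
  simp only [Fintype.sum_sum_type, omega, omegaJB_eq_zero R hℓ hv (Subtype.prop _), map_zero,
    zero_mul, Finset.sum_const_zero, add_zero, zero_add, hA, hB,
    omegaBB_self R hℓ hθ hv (Subtype.prop _), ← add_assoc]
  simp only [omegaAA, if_true, omegaJJ]

end Vanishing

end Horosym

end

open Bundle Horosym in
/-- The curvature form of a `K`-invariant metric on a `G`-linearized line bundle on a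
horosymmetric homogeneous space, at a regular point `exp(a)H`. -/
theorem theoremA {n : ℕ} (D : HorosymmetricSpace n) (C : CartanData D) (R : ReferenceData C)
    (E : D.Space → Type*) [∀ x, AddCommGroup (E x)] [∀ x, Module ℂ (E x)]
    [∀ x, TopologicalSpace (E x)] [TopologicalSpace (TotalSpace ℂ E)] [FiberBundle ℂ E]
    [VectorBundle ℂ ℂ E] [MulAction D.G (TotalSpace ℂ E)]
    (hE : IsLinearizedLineBundle D E)
    (χ : D.H →* ℂˣ) (hχ : IsIsotropyCharacter D E χ)
    (q : TotalSpace ℂ E → ℝ) (hq : IsInvariantMetric D E C q)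
    (ξ₀ : E (D.proj 1)) (hξ₀ : ξ₀ ≠ 0)
    (u : Mat n → ℝ) (hu : ∀ x ∈ C.aS, u x = toricPotential q ξ₀ x)
    (a : Mat n) (ha : a ∈ C.aS) (hreg : ∀ β ∈ C.rootsS, C.ev β a ≠ 0)
    (t : Trivialization ℂ (π ℂ E)) [MemTrivializationAtlas t]
    (ht : D.proj (expIn D.G a) ∈ t.baseSet) :
    (∀ v w : R.Idx → ℂ,
      curvatureForm R q t (expIn D.G a) v w
        = ∑ i, ∑ j, omega R u χ a i j * refForm i j v w) ∧
    (IsTrivialOnFiber D E ξ₀ → ∀ v w : R.Idx → ℂ,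
      curvatureForm R q t (expIn D.G a) v w
        = ∑ j : Fin R.r, ∑ k : Fin R.r,
            (1 / 4 : ℂ) * (diff2 u a (R.l j) (R.l k) : ℂ) * refForm (.inl j) (.inl k) v w
          + ∑ α : C.rootsQu,
            -Complex.exp (2 * C.ev α a) / 2 *
              ((duP (D := D) u a (R.coroot α) : ℂ) - 2 * chiL χ (R.coroot α)) *
              refForm (.inr (.inl α)) (.inr (.inl α)) v w
          + ∑ β : R.rootsSPos,
            (duP (D := D) u a (R.coroot β) : ℂ) / Complex.sinh (2 * C.ev β a) *
              refForm (.inr (.inr β)) (.inr (.inr β)) v w) := by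
  have key := curvatureForm_eq_omega R hE hχ hq hξ₀ hu ha hreg ht
  refine ⟨key, fun h v w => ?_⟩
  obtain ⟨ℓ, hℓ⟩ := exists_isDChar hχ.algebraic
  rw [key v w, sum_omega R hℓ ((isPotential_quasipotential hE hχ hq hξ₀).isUnitaryOn hℓ)
    fun γ hγ y hy hL => h.chiL_eq_zero hE hχ hξ₀ hγ hy hL]
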